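/- **Setting.** A metric space $T$ is a real tree if (a) for all $u,v\in T$ there is a unique isometric embedding $\phi_{u,v}:[0,d(u,v)]\to T$ with $\phi_{u,v}(0)=u$ and $\phi_{u,v}(d(u,v))=v$, and (b) for every injective continuous $\kappa:[0,1]\to T$ one has $\kappa([0,1])=\phi_{\kappa(0),\kappa(1)}([0,d(\kappa(0),\kappa(1))])$. Let $(X,d)$ be a connected, locally compact, separable metric space which is a uniform local tree: there is $0<\iota\le \mathrm{diam}(X)$ such that every open ball $B(x,\iota)$ (with the restricted metric) is a real tree. For $d(x,y)<\iota$ put $]x,y[\,=\phi_{x,y}(]0,d(x,y)[)$. Let $\mathcal S=\bigcup_{x\in X}\bigcup_{y\in B(x,\iota)}\,]x,y[$ be the skeleton, and let $\nu$ be the length measure, i.e. the one-dimensional Hausdorff measure on $\mathcal S$, so that $\nu(]x,y[)=d(x,y)$ whenever $d(x,y)<\iota$. Let $m$ be a Radon measure on $X$ with full support, and let $d_h\ge 1$ be such that for some $c,C,r_1>0$, $$c\,r^{d_h}\le m(B(x,r))\le C\,r^{d_h}\qquad (x\in X,\ 0<r<r_1).$$ A continuous function $f$ is absolutely continuous if for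 every $x\in X$ there is a function $\partial_x f$ ($\nu$-integrable along each segment $]x,u[$, $u\in B(x,\iota)$) with $f(u)-f(x)=\int_{]x,u[}\partial_x f\,d\nu$ for all $u\in B(x,\iota)$; then $|\partial f|$ denotes the function on $\mathcal S$, unique up to $\nu$-null sets, that equals $|\partial_x f|$ $\nu$-a.e. on $\mathcal S\cap B(x,\iota)$ for every $x$. For $1\le p<\infty$, $W^{1,p}(X,m)$ is the space of $f\in L^p(X,m)$ having an absolutely continuous representative with $|\partial f|\in L^p(\mathcal S,\nu)$, with seminorm $\|\partial f\|_{L^p(\mathcal S,\nu)}$. $BV(X,m)$ is the space of $f\in L^1(X,m)$ for which $$\|\partial f\|(X)=\inf\Big\{\liminf_{n\to\infty}\int_{\mathcal S}|\partial f_n|\,d\nu \;:\; f_n\in W^{1,1}(X,m),\ f_n\to f \text{ in } L^1(X,m)\Big\}$$ is finite, with seminorm $\|\partial f\|(X)$. For $\alpha\ge 0$ put $$E_{p,\alpha}(f,r)=\int_X\frac1{m(B(x,r))}\int_{B(x,r)}\frac{|f(y)-f(x)|^p}{r^{p\alpha}}\,dm(y)\,dm(x),\qquad \mathcal B^{\alpha,p}(X,m)=\Big\{f\in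 L^p(X,m):\sup_{0<r<1}E_{p,\alpha}(f,r)<\infty\Big\}.$$ Put $X_0=L^p(X,m)$ with its norm, and let $X_1$ be $W^{1,p}(X,m)$ if $p>1$ and $BV(X,m)$ if $p=1$, with the seminorm above, denoted $|\cdot|_{X_1}$. For $f\in X_0+X_1$ let $$K(f,t)=\inf\{\|g\|_{L^p(X,m)}+t\,|h|_{X_1} : f=g+h,\ g\in X_0,\ h\in X_1\},$$ and for $0\le\theta\le 1$ let $(X_0,X_1)_{\theta,\infty}$ be the space of $f\in X_0+X_1$ with $\sup_{t>0}t^{-\theta}K(f,t)<\infty$. **Theorem.** Let $1\le p<\infty$ and $\alpha_p=1+\frac{d_h-1}{p}$. 1. There exist $r_0,C_1,C_2>0$ such that for every $f\in X_0+X_1$ and every $0<r<r_0$, $$C_1\,E_{p,0}(f,r)^{1/p}\le K(f,r^{\alpha_p})\le C_2\,E_{p,0}(f,r)^{1/p}.$$ 2. If $X$ is compact, then for every $0\le\alpha\le\alpha_p$, as spaces of ($m$-a.e. classes of) functions, $$\mathcal B^{\alpha,p}(X,m)=\begin{cases}(L^1(X,m),BV(X,m))_{\alpha/\alpha_1,\infty},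 & p=1,\\ (L^p(X,m),W^{1,p}(X,m))_{\alpha/\alpha_p,\infty}, & p>1.\end{cases}$$ -/

import Mathlib

open Set Filter Topology MeasureTheory
open scoped ENNReal Pointwise

noncomputable section

namespace LocalTree

/-! ### Real trees and uniform local trees -/

/-- `φ` restricted to `[0, d(u,v)]` is an isometric embedding with `φ 0 = u` and
`φ (d(u,v)) = v`. -/
def IsGeodesic {Y : Type*} [MetricSpace Y] (φ : ℝ → Y) (u v : Y) : Prop :=
  (∀ s ∈ Icc (0 : ℝ) (dist u v), ∀ t ∈ Icc (0 : ℝ) (dist u v), dist (φ s) (φ t) = |s - t|) ∧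
    φ 0 = u ∧ φ (dist u v) = v

/-- A real tree: unique geodesics, and every injective continuous path from `a` to `b` has the
same image as the geodesic from `a` to `b`. -/
structure IsRealTree (Y : Type*) [MetricSpace Y] : Prop where
  exists_geodesic : ∀ u v : Y, ∃ φ : ℝ → Y, IsGeodesic φ u v
  unique_geodesic : ∀ (u v : Y) (φ ψ : ℝ → Y), IsGeodesic φ u v → IsGeodesic ψ u v →
    EqOn φ ψ (Icc 0 (dist u v))
  loop_free : ∀ κ : ℝ → Y, ContinuousOn κ (Icc 0 1) → InjOn κ (Icc 0 1) →
    ∀ φ : ℝ → Y, IsGeodesic φ (κ 0) (κ 1) →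
      κ '' Icc 0 1 = φ '' Icc 0 (dist (κ 0) (κ 1))

/-- Uniform local tree with radius `ι`: `0 < ι ≤ diam X`, and every ball `B(x, ι)`, with the
restricted metric, is a real tree. -/
structure IsUniformLocalTree (X : Type*) [MetricSpace X] (ι : ℝ) : Prop where
  pos : 0 < ι
  le_diam : ENNReal.ofReal ι ≤ Metric.ediam (univ : Set X)
  isRealTree_ball : ∀ x : X, IsRealTree (Metric.ball x ι)

/-- The open segment `]x,y[`. When `d(x,y) < ι` in a uniform local tree of radius `ι`, all
geodesics of `X` from `x` to `y` lie in the tree `B(x, ι)`, so there is exactly one and this is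
the image of the open interval `]0, d(x,y)[` under it. -/
def openSeg {X : Type*} [MetricSpace X] (x y : X) : Set X :=
  {z | ∃ φ : ℝ → X, IsGeodesic φ x y ∧ z ∈ φ '' Ioo 0 (dist x y)}

/-- The skeleton: the union of all open segments `]x,y[` with `y ∈ B(x, ι)`. -/
def skeleton (X : Type*) [MetricSpace X] (ι : ℝ) : Set X :=
  ⋃ x : X, ⋃ y ∈ Metric.ball x ι, openSeg x y

section Spaces

variable {X : Type*} [MetricSpace X] [MeasurableSpace X] [BorelSpace X]

/-- The length measure: one-dimensional Hausdorff measure on the skeleton. It is the measure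
carried by the skeleton which gives each segment `]x,y[` with `d(x,y) < ι` the mass `d(x,y)`
(see `lengthMeasure_openSeg`). -/
def lengthMeasure (X : Type*) [MetricSpace X] [MeasurableSpace X] [BorelSpace X] (ι : ℝ) :
    Measure X :=
  (Measure.hausdorffMeasure 1).restrict (skeleton X ι)

/-! ### Weak gradients, Sobolev and BV spaces -/

/-- `g` is a weak gradient of `f` in `B(x, ι)`: it is `ν`-integrable along each segment `]x,u[`
and `f u - f x = ∫_{]x,u[} g dν` for all `u ∈ B(x, ι)`. -/
def IsWeakGradientAt (ι : ℝ) (x : X) (f g : X → ℝ) : Prop :=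
  Measurable g ∧ ∀ u ∈ Metric.ball x ι,
    IntegrableOn g (openSeg x u) (lengthMeasure X ι) ∧
      f u - f x = ∫ z in openSeg x u, g z ∂(lengthMeasure X ι)

/-- `f` is absolutely continuous, i.e. continuous with a weak gradient `∂ₓ f` in `B(x, ι)` for
each `x`, and `G = |∂ f|`, i.e. `G = |∂ₓ f|` holds `ν`-a.e. on `B(x, ι)` for each `x`.
This determines `G` up to a `ν`-null set. -/
def IsAbsGradient (ι : ℝ) (f G : X → ℝ) : Prop :=
  Continuous f ∧ Measurable G ∧ ∀ x : X, ∃ g : X → ℝ, IsWeakGradientAt ι x f g ∧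
    ∀ᵐ z ∂((lengthMeasure X ι).restrict (Metric.ball x ι)), G z = |g z|

/-- The space `L^p(X, m)` as a set of `m`-a.e. classes of functions. -/
def lpSpace (m : Measure X) (p : ℝ) : Set (X →ₘ[m] ℝ) :=
  {f | MemLp f (ENNReal.ofReal p) m}

/-- The space `W^{1,p}(X, m)`: classes in `L^p(X, m)` which have an absolutely continuous
representative `F` with `|∂ F| ∈ L^p(ν)`. -/
def sobolev (ι : ℝ) (m : Measure X) (p : ℝ) : Set (X →ₘ[m] ℝ) :=
  {f | f ∈ lpSpace m p ∧ ∃ F G : X → ℝ, f =ᵐ[m] F ∧ IsAbsGradient ι F G ∧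
    MemLp G (ENNReal.ofReal p) (lengthMeasure X ι)}

/-- The norm `‖f‖_{L^p(X,m)}`. -/
def lpNorm (m : Measure X) (p : ℝ) (f : X →ₘ[m] ℝ) : ℝ≥0∞ :=
  eLpNorm f (ENNReal.ofReal p) m

/-- The seminorm `‖∂ f‖_{L^p(ν)}` of `W^{1,p}(X, m)`. When `m` has full support, the continuous
representative `F` is unique and `G = |∂ F|` is unique up to a `ν`-null set, so that the infimum
is over one value only (and it is `∞` if `f` has no absolutely continuous representative). -/
def gradNorm (ι : ℝ) (m : Measure X) (p : ℝ) (f : X →ₘ[m] ℝ) : ℝ≥0∞ :=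
  ⨅ (F : X → ℝ) (G : X → ℝ) (_ : f =ᵐ[m] F) (_ : IsAbsGradient ι F G),
    eLpNorm G (ENNReal.ofReal p) (lengthMeasure X ι)

/-- The total variation `‖∂ f‖(X)`: the `L¹`-relaxation of `u ↦ ∫ |∂ u| dν` on `W^{1,1}`. -/
def totalVariation (ι : ℝ) (m : Measure X) (f : X →ₘ[m] ℝ) : ℝ≥0∞ :=
  ⨅ (u : ℕ → (X →ₘ[m] ℝ)) (_ : ∀ n, u n ∈ sobolev ι m 1)
    (_ : Tendsto (fun n => lpNorm m 1 (u n - f)) atTop (𝓝 0)),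
    liminf (fun n => gradNorm ι m 1 (u n)) atTop

/-- The space `BV(X, m)`. -/
def bv (ι : ℝ) (m : Measure X) : Set (X →ₘ[m] ℝ) :=
  {f | f ∈ lpSpace m 1 ∧ totalVariation ι m f < ∞}

/-! ### Besov–Lipschitz spaces -/

/-- `E_{p,α}(f,r) = ∫ m(B(x,r))⁻¹ ∫_{B(x,r)} |f(y) - f(x)|^p / r^{pα} dm(y) dm(x)`. -/
def besovEnergy (m : Measure X) (p α : ℝ) (f : X →ₘ[m] ℝ) (r : ℝ) : ℝ≥0∞ :=
  ∫⁻ x, (m (Metric.ball x r))⁻¹ *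
    ∫⁻ y in Metric.ball x r, ENNReal.ofReal (|f y - f x| ^ p / r ^ (p * α)) ∂m ∂m

/-- The Besov–Lipschitz space `B^{α,p}(X, m)`. -/
def besov (m : Measure X) (p α : ℝ) : Set (X →ₘ[m] ℝ) :=
  {f | f ∈ lpSpace m p ∧ (⨆ r ∈ Ioo (0 : ℝ) 1, besovEnergy m p α f r) < ∞}

/-- Uniform volume control: `c Φ(r) ≤ m(B(x,r)) ≤ C Φ(r)` for all `x` and all small `r > 0`. -/
def HasUniformVolume (m : Measure X) (Φ : ℝ → ℝ) : Prop :=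
  ∃ c C r₁ : ℝ, 0 < c ∧ 0 < C ∧ 0 < r₁ ∧ ∀ (x : X) (r : ℝ), 0 < r → r < r₁ →
    ENNReal.ofReal (c * Φ r) ≤ m (Metric.ball x r) ∧
      m (Metric.ball x r) ≤ ENNReal.ofReal (C * Φ r)

end Spaces

/-! ### Real interpolation -/

/-- The `K`-functional of the couple formed by the subspaces `X₀`, `X₁` of a common vector space,
with (semi)norms `N₀`, `N₁`. -/
def kFunctional {A : Type*} [AddCommGroup A] (X₀ X₁ : Set A) (N₀ N₁ : A → ℝ≥0∞)
    (f : A) (t : ℝ) : ℝ≥0∞ :=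
  ⨅ (g ∈ X₀) (h ∈ X₁) (_ : f = g + h), N₀ g + ENNReal.ofReal t * N₁ h

/-- The real interpolation space `(X₀, X₁)_{θ,∞}`. -/
def interpInfty {A : Type*} [AddCommGroup A] (X₀ X₁ : Set A) (N₀ N₁ : A → ℝ≥0∞)
    (θ : ℝ) : Set A :=
  {f | f ∈ X₀ + X₁ ∧
    (⨆ t ∈ Ioi (0 : ℝ), ENNReal.ofReal (t ^ (-θ)) * kFunctional X₀ X₁ N₀ N₁ f t) < ∞}

/-- The exponent `α_p = 1 + (d_h - 1) / p`. -/
def alphaCrit (dh p : ℝ) : ℝ := 1 + (dh - 1) / p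

/-! ### The normalization of the length measure -/

/-- In a uniform local tree of radius `ι`, `ν(]x,y[) = d(x,y)` whenever `d(x,y) < ι`. -/
theorem lengthMeasure_openSeg {X : Type*} [MetricSpace X] [MeasurableSpace X] [BorelSpace X]
    {ι : ℝ} (hX : IsUniformLocalTree X ι) {x y : X} (hxy : dist x y < ι) :
    lengthMeasure X ι (openSeg x y) = ENNReal.ofReal (dist x y) := by
  -- geodesics of `X` from `x` to `y` agree
  have huniq : ∀ φ ψ : ℝ → X, IsGeodesic φ x y → IsGeodesic ψ x y →
      EqOn φ ψ (Icc 0 (dist x y)) := by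
    intro φ ψ hφ hψ t ht
    have key : ∀ χ : ℝ → X, IsGeodesic χ x y → ∀ t ∈ Icc (0 : ℝ) (dist x y),
        χ t ∈ Metric.ball x ι := by
      intro χ hχ t ht
      have h := hχ.1 t ht 0 ⟨le_rfl, dist_nonneg⟩
      rw [hχ.2.1, sub_zero, abs_of_nonneg ht.1] at h
      rw [Metric.mem_ball, h]
      exact ht.2.trans_lt hxy
    have hx : x ∈ Metric.ball x ι := Metric.mem_ball_self hX.pos
    have hy : y ∈ Metric.ball x ι := by rwa [Metric.mem_ball, dist_comm]
    classical
    let lft : (ℝ → X) → ℝ → Metric.ball x ι := fun χ t =>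
      if h : χ t ∈ Metric.ball x ι then ⟨χ t, h⟩ else ⟨x, hx⟩
    have hl : ∀ χ : ℝ → X, IsGeodesic χ x y → ∀ t ∈ Icc (0 : ℝ) (dist x y),
        ((lft χ t : Metric.ball x ι) : X) = χ t := by
      intro χ hχ t ht
      simp only [lft, dif_pos (key χ hχ t ht)]
    have hg : ∀ χ : ℝ → X, IsGeodesic χ x y →
        IsGeodesic (lft χ) (⟨x, hx⟩ : Metric.ball x ι) ⟨y, hy⟩ := by
      intro χ hχ
      refine ⟨fun s hs t ht => ?_, ?_, ?_⟩
      · rw [Subtype.dist_eq, hl χ hχ s hs, hl χ hχ t ht]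
        exact hχ.1 s hs t ht
      · apply Subtype.ext
        rw [hl χ hχ 0 ⟨le_rfl, dist_nonneg⟩]
        exact hχ.2.1
      · apply Subtype.ext
        have := hl χ hχ (dist x y) ⟨dist_nonneg, le_rfl⟩
        exact this.trans hχ.2.2
    have h := (hX.isRealTree_ball x).unique_geodesic _ _ _ _ (hg φ hφ) (hg ψ hψ) ht
    rw [← hl φ hφ t ht, ← hl ψ hψ t ht, h]
  -- there is one, coming from the tree `B(x, ι)`
  obtain ⟨φ, hφ⟩ : ∃ φ : ℝ → X, IsGeodesic φ x y := by
    obtain ⟨φ, h1, h2, h3⟩ := (hX.isRealTree_ball x).exists_geodesic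
      ⟨x, Metric.mem_ball_self hX.pos⟩ ⟨y, by rwa [Metric.mem_ball, dist_comm]⟩
    exact ⟨fun t => (φ t : X), h1, congrArg Subtype.val h2, congrArg Subtype.val h3⟩
  have hseg : openSeg x y = φ '' Ioo 0 (dist x y) := by
    ext z
    constructor
    · rintro ⟨ψ, hψ, t, ht, rfl⟩
      exact ⟨t, ht, huniq φ ψ hφ hψ ⟨ht.1.le, ht.2.le⟩⟩
    · exact fun hz => ⟨φ, hφ, hz⟩
  have hiso : Isometry (fun t : Icc (0 : ℝ) (dist x y) => φ t) :=
    Isometry.of_dist_eq fun s t => hφ.1 s s.2 t t.2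
  have himg : φ '' Ioo 0 (dist x y) =
      (fun t : Icc (0 : ℝ) (dist x y) => φ t) ''
        ((fun t : Icc (0 : ℝ) (dist x y) => (t : ℝ)) ⁻¹' Ioo 0 (dist x y)) := by
    ext z
    constructor
    · rintro ⟨t, ht, rfl⟩
      exact ⟨⟨t, ht.1.le, ht.2.le⟩, ht, rfl⟩
    · rintro ⟨t, ht, rfl⟩
      exact ⟨t, ht, rfl⟩
  have hsub : openSeg x y ⊆ skeleton X ι := fun z hz =>
    mem_iUnion.2 ⟨x, mem_iUnion₂.2 ⟨y, by rwa [Metric.mem_ball, dist_comm], hz⟩⟩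
  rw [lengthMeasure, Measure.restrict_eq_self _ hsub, hseg, himg,
    hiso.hausdorffMeasure_image (Or.inl zero_le_one),
    ← isometry_subtype_coe.hausdorffMeasure_image (Or.inl zero_le_one),
    Subtype.image_preimage_coe, inter_eq_self_of_subset_right Ioo_subset_Icc_self,
    hausdorffMeasure_real, Real.volume_Ioo, sub_zero]

end LocalTree

end

/-! Lower bound for `K`. Up to constants, the functional `E_{p,0}(·, r)^{1/p}` is subadditive and
bounded by the `L^p` norm, so it only has to be bounded by `r^{α_p}` times the seminorm of `X₁`. If
`F` is absolutely continuous and `y ∈ B(x, r)`, then `F y - F x` is an integral of `∂ₓF` over a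
segment of length less than `r` inside `B(x, r)`. Hölder gives `|F y - F x|^p ≤ r^{p-1} ∫_{B(x,r)}
|∂F|^p dν`. Integrating in `y` and then in `x` (Tonelli) produces two factors `r^{d_h}`, one of
which is cancelled by the normalization `m(B(x,r))⁻¹`; what remains is `r^{p-1+d_h} = r^{p α_p}`.
For `BV` the bound passes to `L¹` limits. The carriers are `IsAbsGradient.enorm_sub_rpow_le`,
`VolumeBounds.besovEnergy_le_gradNorm` and `VolumeBounds.besovEnergy_le_totalVariation`.

Upper bound for `K`. At scale `δ = r/20`, choose a maximal `δ`-separated set `A`, take the averages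
of `f` over the balls `B(a, δ)`, and let `h` be their weighted mean with cutoff weights around the
points of `A`. The obstacle is that a cutoff built from `dist a ·` has slope of order `δ⁻¹` along
all of the skeleton near `a`, whose length there may be infinite. The distance is therefore replaced
by a supremum of Gromov products `(x|b)_a` over the finitely many points `b ∈ A` near `a`
(`trimDist`). In a tree `(x|b)_a` is the distance from `a` to the projection of `x` to `[a,b]`, so
it varies only along `[a,b]`; and the trimmed distance differs from `dist a x` by less than `δ`,
because `A` is `δ`-dense. The resulting weights are constant off boundedly many segments of length
less than `8δ`, so `∫ |∂h|^p dν` costs a factor `δ · δ^{-p}` and a sum of local oscillations of `f`,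
which is bounded by the energy. This is `VolumeBounds.exists_sobolev_approx`; it gives `h` in
`W^{1,p}`, hence also in `BV` when `p = 1`.

The tree geometry enters through the four-point condition, derived from the absence of loops. That
`h` has a weak gradient in the oriented sense is `IsUniformLocalTree.exists_isAbsGradient`: the
gradient seen from `x` is the derivative along a segment times the derivative of `dist x ·`, which
is `±1` almost everywhere and records the orientation.

Interpolation. With `t = r^{α_p}` one has `t^{-α/α_p} = r^{-α}`, so the two-sided estimate matches
the suprema over small `t` and small `r`. On a space of finite measure, the remaining scales are
controlled by the `L^p` norm. -/

namespace LocalTree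

/-! ### Metric segments and the four-point condition -/

/-- The metric segment between `x` and `y`. -/
def mseg {X : Type*} [MetricSpace X] (x y : X) : Set X :=
  {z | dist x z + dist z y = dist x y}

section Geodesics

variable {Y : Type*} [MetricSpace Y]

theorem mem_mseg {x y z : Y} : z ∈ mseg x y ↔ dist x z + dist z y = dist x y := Iff.rfl

theorem mseg_comm (x y : Y) : mseg x y = mseg y x := by
  ext z
  rw [mem_mseg, mem_mseg, dist_comm x z, dist_comm z y, dist_comm x y, add_comm]

theorem isClosed_mseg (x y : Y) : IsClosed (mseg x y) :=
  isClosed_eq (by fun_prop) (by fun_prop)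

theorem IsGeodesic.dist_left {φ : ℝ → Y} {u v : Y} (h : IsGeodesic φ u v) {t : ℝ}
    (ht : t ∈ Icc 0 (dist u v)) : dist u (φ t) = t := by
  have := h.1 0 ⟨le_rfl, dist_nonneg⟩ t ht
  rwa [h.2.1, zero_sub, abs_neg, abs_of_nonneg ht.1] at this

theorem IsGeodesic.dist_right {φ : ℝ → Y} {u v : Y} (h : IsGeodesic φ u v) {t : ℝ}
    (ht : t ∈ Icc 0 (dist u v)) : dist (φ t) v = dist u v - t := by
  have := h.1 t ht (dist u v) ⟨dist_nonneg, le_rfl⟩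
  rwa [h.2.2, abs_sub_comm, abs_of_nonneg (sub_nonneg.2 ht.2)] at this

theorem IsGeodesic.mem_mseg {φ : ℝ → Y} {u v : Y} (h : IsGeodesic φ u v) {t : ℝ}
    (ht : t ∈ Icc 0 (dist u v)) : φ t ∈ mseg u v := by
  rw [LocalTree.mem_mseg, h.dist_left ht, h.dist_right ht]
  ring

theorem dist_left_mem_Icc {u v z : Y} (h : z ∈ mseg u v) : dist u z ∈ Icc 0 (dist u v) :=
  ⟨dist_nonneg, by rw [mem_mseg] at h; linarith [dist_nonneg (x := z) (y := v)]⟩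

theorem IsGeodesic.concat {φ ψ : ℝ → Y} {u v z : Y} (hz : z ∈ mseg u v)
    (hφ : IsGeodesic φ u z) (hψ : IsGeodesic ψ z v) :
    IsGeodesic (fun t => if t ≤ dist u z then φ t else ψ (t - dist u z)) u v := by
  have hz' : dist u z + dist z v = dist u v := hz
  have key : ∀ s ∈ Icc (0 : ℝ) (dist u v), ∀ t ∈ Icc (0 : ℝ) (dist u v), s ≤ t →
      dist (if s ≤ dist u z then φ s else ψ (s - dist u z))
        (if t ≤ dist u z then φ t else ψ (t - dist u z)) = |s - t| := by
    intro s hs t ht hst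
    by_cases h1 : t ≤ dist u z
    · rw [if_pos h1, if_pos (hst.trans h1)]
      exact hφ.1 s ⟨hs.1, hst.trans h1⟩ t ⟨ht.1, h1⟩
    · push Not at h1
      rw [if_neg h1.not_ge]
      have ht' : t - dist u z ∈ Icc 0 (dist z v) := ⟨by linarith, by linarith [ht.2]⟩
      by_cases h2 : s ≤ dist u z
      · rw [if_pos h2]
        have hs' : s ∈ Icc 0 (dist u z) := ⟨hs.1, h2⟩
        have e1 := hφ.dist_left hs'
        have e2 := hφ.dist_right hs'
        have e3 := hψ.dist_left ht'
        have e4 := hψ.dist_right ht'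
        -- The path through `z` gives the upper bound; the lower bound holds because the chain `u`,
        -- `φ s`, `ψ (t - dist u z)`, `v` cannot be shorter than `dist u v`.
        have t1 := dist_triangle (φ s) z (ψ (t - dist u z))
        have t2 := dist_triangle4 u (φ s) (ψ (t - dist u z)) v
        rw [abs_sub_comm, abs_of_nonneg (sub_nonneg.2 hst)]
        linarith
      · push Not at h2
        rw [if_neg h2.not_ge, hψ.1 _ ⟨by linarith, by linarith [hs.2]⟩ _ ht']
        congr 1
        ring
  refine ⟨fun s hs t ht => ?_, ?_, ?_⟩
  · rcases le_total s t with h | h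
    · exact key s hs t ht h
    · rw [dist_comm, abs_sub_comm]
      exact key t ht s hs h
  · simp only [dist_nonneg, if_true]
    exact hφ.2.1
  · by_cases h : dist u v ≤ dist u z
    · have h0 : dist z v = 0 := le_antisymm (by linarith) dist_nonneg
      have : dist u v = dist u z := by linarith
      simp only [this, le_refl, if_true]
      rw [hφ.2.2]
      exact dist_eq_zero.1 h0
    · simp only [if_neg h]
      rw [← hz', add_sub_cancel_left]
      exact hψ.2.2

namespace IsRealTree

/-- Geodesics `u → z` and `z → v` concatenate to a geodesic `u → v` through `z`, and that geodesic
is unique. -/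
theorem eq_apply (hY : IsRealTree Y) {φ : ℝ → Y} {u v z : Y} (hφ : IsGeodesic φ u v)
    (hz : z ∈ mseg u v) : φ (dist u z) = z := by
  obtain ⟨α, hα⟩ := hY.exists_geodesic u z
  obtain ⟨β, hβ⟩ := hY.exists_geodesic z v
  have := hY.unique_geodesic u v _ _ hφ (hα.concat hz hβ) (dist_left_mem_Icc hz)
  rw [this]
  simp only [le_refl, if_true]
  exact hα.2.2

theorem dist_eq_abs (hY : IsRealTree Y) {u v z w : Y} (hz : z ∈ mseg u v) (hw : w ∈ mseg u v) :
    dist z w = |dist u z - dist u w| := by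
  obtain ⟨φ, hφ⟩ := hY.exists_geodesic u v
  have := hφ.1 _ (dist_left_mem_Icc hz) _ (dist_left_mem_Icc hw)
  rwa [hY.eq_apply hφ hz, hY.eq_apply hφ hw] at this

theorem mem_mseg_of_paths (hY : IsRealTree Y) {κ : ℝ → Y} (hc : ContinuousOn κ (Icc 0 1))
    (hi : InjOn κ (Icc 0 1)) {t : ℝ} (ht : t ∈ Icc (0 : ℝ) 1) : κ t ∈ mseg (κ 0) (κ 1) := by
  obtain ⟨φ, hφ⟩ := hY.exists_geodesic (κ 0) (κ 1)
  have h : κ t ∈ φ '' Icc 0 (dist (κ 0) (κ 1)) := by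
    rw [← hY.loop_free κ hc hi φ hφ]
    exact mem_image_of_mem _ ht
  obtain ⟨s, hs, hs'⟩ := h
  rw [← hs']
  exact hφ.mem_mseg hs

/-- The median is the point where the geodesics from `a` to `b` and to `c` part for the last time.
Going back from `b` to this point and then on to `c` is an injective path, so loop-freeness puts the
point on `[b, c]`. -/
theorem exists_median (hY : IsRealTree Y) (a b c : Y) :
    ∃ o, o ∈ mseg a b ∧ o ∈ mseg a c ∧ o ∈ mseg b c := by
  obtain ⟨φ, hφ⟩ := hY.exists_geodesic a b
  obtain ⟨ψ, hψ⟩ := hY.exists_geodesic a c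
  have cont : ∀ {χ : ℝ → Y} {u v : Y}, IsGeodesic χ u v → ContinuousOn χ (Icc 0 (dist u v)) := by
    intro χ u v h
    refine (LipschitzOnWith.of_dist_le_mul (K := 1) fun s hs t ht => ?_).continuousOn
    rw [h.1 s hs t ht, Real.dist_eq]
    simp
  set M := min (dist a b) (dist a c) with hM
  have hM0 : 0 ≤ M := le_min dist_nonneg dist_nonneg
  have sub1 : Icc 0 M ⊆ Icc 0 (dist a b) := Icc_subset_Icc_right (min_le_left _ _)
  have sub2 : Icc 0 M ⊆ Icc 0 (dist a c) := Icc_subset_Icc_right (min_le_right _ _)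
  have hK : IsCompact {t | t ∈ Icc 0 M ∧ dist (φ t) (ψ t) = 0} := by
    have hd : ContinuousOn (fun t => dist (φ t) (ψ t)) (Icc 0 M) :=
      continuous_dist.comp_continuousOn
        (ContinuousOn.prodMk (ContinuousOn.mono (cont hφ) sub1) (ContinuousOn.mono (cont hψ) sub2))
    exact isCompact_Icc.of_isClosed_subset
      (hd.preimage_isClosed_of_isClosed isClosed_Icc isClosed_singleton) (fun t ht => ht.1)
  obtain ⟨l, ⟨hl, hle⟩, hmax⟩ := hK.exists_isGreatest
    ⟨0, ⟨le_rfl, hM0⟩, by rw [hφ.2.1, hψ.2.1, dist_self]⟩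
  have hl1 := sub1 hl
  have hl2 := sub2 hl
  have heq : φ l = ψ l := dist_eq_zero.1 hle
  refine ⟨φ l, hφ.mem_mseg hl1, heq ▸ hψ.mem_mseg hl2, ?_⟩
  -- If the last common parameter is an endpoint, the branching point is `b` or `c` itself;
  -- otherwise both legs below have positive length.
  rcases eq_or_lt_of_le hl1.2 with e1 | h1
  · rw [e1, hφ.2.2, LocalTree.mem_mseg]
    simp
  rcases eq_or_lt_of_le hl2.2 with e2 | h2
  · rw [heq, e2, hψ.2.2, LocalTree.mem_mseg]
    simp
  set f₁ : ℝ → ℝ := fun t => dist a b - 2 * t * (dist a b - l) with hf₁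
  set f₂ : ℝ → ℝ := fun t => l + (2 * t - 1) * (dist a c - l) with hf₂
  have r1 : ∀ t ∈ Icc (0 : ℝ) (1 / 2), f₁ t ∈ Icc l (dist a b) := by
    intro t ht
    simp only [hf₁, mem_Icc]
    constructor <;> nlinarith [ht.1, ht.2]
  have r2 : ∀ t ∈ Icc (1 / 2 : ℝ) 1, f₂ t ∈ Icc l (dist a c) := by
    intro t ht
    simp only [hf₂, mem_Icc]
    constructor <;> nlinarith [ht.1, ht.2]
  have r2' : ∀ t ∈ Ioc (1 / 2 : ℝ) 1, l < f₂ t := by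
    intro t ht
    simp only [hf₂]
    nlinarith [ht.1, ht.2]
  set κ : ℝ → Y := fun t => if t ≤ 1 / 2 then φ (f₁ t) else ψ (f₂ t) with hκ
  have hc : ContinuousOn κ (Icc 0 1) := by
    have c1 : ContinuousOn (fun t => φ (f₁ t)) (Icc 0 (1 / 2)) :=
      (cont hφ).comp (by fun_prop) fun t ht => ⟨hl.1.trans (r1 t ht).1, (r1 t ht).2⟩
    have c2 : ContinuousOn (fun t => ψ (f₂ t)) (Icc (1 / 2) 1) :=
      (cont hψ).comp (by fun_prop) fun t ht => ⟨hl.1.trans (r2 t ht).1, (r2 t ht).2⟩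
    have e1 : ContinuousOn κ (Icc 0 (1 / 2)) :=
      c1.congr fun t ht => by simp only [hκ, if_pos ht.2]
    have e2 : ContinuousOn κ (Icc (1 / 2) 1) := by
      refine c2.congr fun t ht => ?_
      rcases eq_or_lt_of_le ht.1 with h | h
      · simp only [hκ, ← h, le_refl, if_true, hf₁, hf₂]
        convert heq using 2 <;> ring
      · simp only [hκ, if_neg h.not_ge]
    have := e1.union_of_isClosed e2 isClosed_Icc isClosed_Icc
    rwa [Icc_union_Icc_eq_Icc (by norm_num) (by norm_num)] at this
  have injφ : ∀ {χ : ℝ → Y} {u v : Y}, IsGeodesic χ u v → InjOn χ (Icc 0 (dist u v)) := by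
    intro χ u v h s hs t ht hst
    rw [← h.dist_left hs, ← h.dist_left ht, hst]
  -- A common point of the two legs has the same distance to `a` along both geodesics, so it would
  -- be a common parameter beyond the last one `l`.
  have cross : ∀ s ∈ Icc (0 : ℝ) (1 / 2), ∀ t ∈ Ioc (1 / 2 : ℝ) 1, φ (f₁ s) ≠ ψ (f₂ t) := by
    intro s hs t ht h
    have hs1 := r1 s hs
    have ht1 := r2 t ⟨ht.1.le, ht.2⟩
    have d1 := hφ.dist_left (t := f₁ s) ⟨hl.1.trans hs1.1, hs1.2⟩
    have d2 := hψ.dist_left (t := f₂ t) ⟨hl.1.trans ht1.1, ht1.2⟩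
    have hst : f₁ s = f₂ t := by rw [← d1, ← d2, h]
    have hlt := r2' t ht
    have := hmax (a := f₂ t) ⟨⟨hl.1.trans ht1.1, le_min (hst ▸ hs1.2) ht1.2⟩, by
      rw [← h, hst, dist_self]⟩
    linarith
  have hinj : InjOn κ (Icc 0 1) := by
    intro s hs t ht hst
    simp only [hκ] at hst
    split_ifs at hst with i1 i2 i2
    · have s1 := r1 s ⟨hs.1, i1⟩
      have t1 := r1 t ⟨ht.1, i2⟩
      have := injφ hφ ⟨hl.1.trans s1.1, s1.2⟩ ⟨hl.1.trans t1.1, t1.2⟩ hst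
      simp only [hf₁] at this
      have h' : (dist a b - l) * (s - t) = 0 := by linarith
      rcases mul_eq_zero.1 h' with h | h <;> linarith
    · exact absurd hst (cross s ⟨hs.1, i1⟩ t ⟨not_le.1 i2, ht.2⟩)
    · exact absurd hst.symm (cross t ⟨ht.1, i2⟩ s ⟨not_le.1 i1, hs.2⟩)
    · have s1 := r2 s ⟨(not_le.1 i1).le, hs.2⟩
      have t1 := r2 t ⟨(not_le.1 i2).le, ht.2⟩
      have := injφ hψ ⟨hl.1.trans s1.1, s1.2⟩ ⟨hl.1.trans t1.1, t1.2⟩ hst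
      simp only [hf₂] at this
      have h' : (dist a c - l) * (s - t) = 0 := by linarith
      rcases mul_eq_zero.1 h' with h | h <;> linarith
  have := hY.mem_mseg_of_paths hc hinj (t := 1 / 2) ⟨by norm_num, by norm_num⟩
  have k0 : κ 0 = b := by
    simp only [hκ, hf₁]
    norm_num
    exact hφ.2.2
  have k1 : κ 1 = c := by
    simp only [hκ, hf₂]
    norm_num
    exact hψ.2.2
  have k2 : κ (1 / 2) = φ l := by
    simp only [hκ, hf₁, le_refl, if_true]
    congr 1
    ring
  rwa [k0, k1, k2] at this

/-- Real trees are `0`-hyperbolic: the four-point condition. -/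
theorem four_point (hY : IsRealTree Y) (w x y z : Y) :
    dist w y + dist x z ≤ max (dist w x + dist y z) (dist w z + dist x y) := by
  -- the point of `[w, y]` at distance `min (x|y)_w (y|z)_w` from `w`
  obtain ⟨φ, hφ⟩ := hY.exists_geodesic w y
  have gp : ∀ v : Y, (dist w v + dist w y - dist v y) / 2 ∈ Icc 0 (dist w y) := by
    intro v
    have t1 := dist_triangle w v y
    have t2 := dist_triangle v w y
    have t3 := dist_triangle w y v
    rw [dist_comm v w] at t2
    rw [dist_comm y v] at t3
    constructor <;> linarith [dist_nonneg (x := w) (y := y)]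
  -- Up to the median of `w`, `v`, `y`, which lies at distance `(v|y)_w` from `w`, the geodesic `[w,
  -- y]` runs along `[w, v]`. Below, `x` and `z` are compared through the point at the smaller of
  -- their two Gromov products.
  have on : ∀ v : Y, ∀ τ, 0 ≤ τ → τ ≤ (dist w v + dist w y - dist v y) / 2 →
      dist (φ τ) v ≤ dist w v - τ := by
    intro v τ h0 hτ
    obtain ⟨o, o1, o2, o3⟩ := hY.exists_median w v y
    rw [LocalTree.mem_mseg] at o1 o3
    have o2' : dist w o + dist o y = dist w y := o2
    rw [dist_comm v o] at o3
    have ho : dist w o = (dist w v + dist w y - dist v y) / 2 := by linarith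
    have hτ' : τ ∈ Icc 0 (dist w y) := ⟨h0, hτ.trans (gp v).2⟩
    have hd := hY.dist_eq_abs (hφ.mem_mseg hτ') o2
    rw [hφ.dist_left hτ', abs_sub_comm, abs_of_nonneg (by linarith)] at hd
    linarith [dist_triangle (φ τ) o v]
  rcases le_total ((dist w x + dist w y - dist x y) / 2)
    ((dist w z + dist w y - dist z y) / 2) with h | h
  · have h1 := on x _ (gp x).1 le_rfl
    have h2 := on z _ (gp x).1 h
    refine le_max_of_le_right ?_
    have := dist_triangle_left x z (φ ((dist w x + dist w y - dist x y) / 2))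
    linarith
  · have h1 := on x _ (gp z).1 h
    have h2 := on z _ (gp z).1 le_rfl
    refine le_max_of_le_left ?_
    have := dist_triangle_left x z (φ ((dist w z + dist w y - dist z y) / 2))
    rw [dist_comm y z]
    linarith

end IsRealTree

end Geodesics

/-! ### Local geometry of uniform local trees -/

section Local

variable {X : Type*} [MetricSpace X] {ι : ℝ}

namespace IsUniformLocalTree

/-- Clamping the parameter to `[0, dist x y]` makes the geodesic `1`-Lipschitz on all of `ℝ`, so
that it is continuous and measures can be pushed forward by it. -/
theorem exists_geodesic (hX : IsUniformLocalTree X ι) {x y : X} (hxy : dist x y < ι) :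
    ∃ φ : ℝ → X, IsGeodesic φ x y ∧ LipschitzWith 1 φ := by
  obtain ⟨φ, h1, h2, h3⟩ := (hX.isRealTree_ball x).exists_geodesic
    ⟨x, Metric.mem_ball_self hX.pos⟩ ⟨y, by rwa [Metric.mem_ball, dist_comm]⟩
  have hc : ∀ t : ℝ, max 0 (min t (dist x y)) ∈ Icc 0 (dist x y) := fun t =>
    ⟨le_max_left _ _, max_le dist_nonneg (min_le_right _ _)⟩
  have hc' : ∀ t ∈ Icc 0 (dist x y), max 0 (min t (dist x y)) = t := fun t ht => by
    rw [min_eq_left ht.2, max_eq_right ht.1]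
  refine ⟨fun t => (φ (max 0 (min t (dist x y))) : X), ⟨fun s hs t ht => ?_, ?_, ?_⟩, ?_⟩
  · beta_reduce
    rw [hc' s hs, hc' t ht]
    exact h1 s hs t ht
  · beta_reduce
    rw [hc' 0 ⟨le_rfl, dist_nonneg⟩]
    exact congrArg Subtype.val h2
  · beta_reduce
    rw [hc' _ ⟨dist_nonneg, le_rfl⟩]
    exact congrArg Subtype.val h3
  · refine LipschitzWith.of_dist_le_mul fun s t => ?_
    have := h1 _ (hc s) _ (hc t)
    rw [Subtype.dist_eq] at this
    rw [this, NNReal.coe_one, one_mul, Real.dist_eq]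
    exact (abs_max_sub_max_le_max 0 (min s (dist x y)) 0 (min t (dist x y))).trans
      (max_le (by simp) ((abs_min_sub_min_le_max s (dist x y) t (dist x y)).trans
        (max_le le_rfl (by simp))))

/-- The four-point condition for points in a common ball of radius `ι`. -/
theorem four_point (hX : IsUniformLocalTree X ι) (o : X) {w x y z : X} (hw : dist o w < ι)
    (hx : dist o x < ι) (hy : dist o y < ι) (hz : dist o z < ι) :
    dist w y + dist x z ≤ max (dist w x + dist y z) (dist w z + dist x y) := by
  have m : ∀ {v : X}, dist o v < ι → v ∈ Metric.ball o ι := fun h => by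
    rwa [Metric.mem_ball, dist_comm]
  exact (hX.isRealTree_ball o).four_point ⟨w, m hw⟩ ⟨x, m hx⟩ ⟨y, m hy⟩ ⟨z, m hz⟩

/-- Two points of a metric segment at the same distance from `u` coincide: the four-point condition
for them and the endpoints bounds the sum of `dist u v` and their distance by `dist u v`. -/
theorem eq_apply (hX : IsUniformLocalTree X ι) {φ : ℝ → X} {u v z : X} (huv : dist u v < ι)
    (hφ : IsGeodesic φ u v) (hz : z ∈ mseg u v) : φ (dist u z) = z := by
  have hI := dist_left_mem_Icc hz
  have e1 := hφ.dist_left hI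
  have e2 := hφ.dist_right hI
  have hz' : dist u z + dist z v = dist u v := hz
  have := hX.four_point u (w := u) (x := φ (dist u z)) (y := v) (z := z)
    (by simpa using hX.pos) (by rw [e1]; exact hI.2.trans_lt huv) huv (hI.2.trans_lt huv)
  rw [e1, e2, dist_comm v z, show dist u z + dist z v = dist u v from hz] at this
  have h0 : dist (φ (dist u z)) z ≤ 0 := by
    rcases le_max_iff.1 this with h | h <;> linarith
  exact dist_le_zero.1 h0

theorem openSeg_eq (hX : IsUniformLocalTree X ι) {φ : ℝ → X} {u v : X} (huv : dist u v < ι)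
    (hφ : IsGeodesic φ u v) : openSeg u v = φ '' Ioo 0 (dist u v) := by
  ext z
  constructor
  · rintro ⟨ψ, hψ, t, ht, rfl⟩
    have hI : t ∈ Icc 0 (dist u v) := Ioo_subset_Icc_self ht
    refine ⟨t, ht, ?_⟩
    have := hX.eq_apply huv hφ (hψ.mem_mseg hI)
    rwa [hψ.dist_left hI] at this
  · exact fun hz => ⟨φ, hφ, hz⟩

theorem mseg_eq (hX : IsUniformLocalTree X ι) {φ : ℝ → X} {u v : X} (huv : dist u v < ι)
    (hφ : IsGeodesic φ u v) : mseg u v = φ '' Icc 0 (dist u v) := by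
  ext z
  constructor
  · exact fun hz => ⟨_, dist_left_mem_Icc hz, hX.eq_apply huv hφ hz⟩
  · rintro ⟨t, ht, rfl⟩
    exact hφ.mem_mseg ht

/-- The two bounds on `t` are the Gromov products `(a|u)_x` and `(b|u)_x`, the parameters at which
the paths towards `a` and `b` leave `[x, u]`. Between them, `[x, u]` runs inside `[a, b]`. -/
theorem apply_mem_mseg_of_between (hX : IsUniformLocalTree X ι) {o a b x u : X} {φ : ℝ → X}
    (hφ : IsGeodesic φ x u) (ha : dist o a < ι) (hb : dist o b < ι)
    (hxu : dist o x + dist x u < ι) {t : ℝ}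
    (h1 : (dist a x + dist x u - dist a u) / 2 < t)
    (h2 : t < (dist b x + dist x u - dist b u) / 2) :
    t ∈ Ioo 0 (dist x u) ∧ φ t ∈ mseg a b := by
  have ta := dist_triangle x u a
  have ta' := dist_triangle a x u
  have tb := dist_triangle b x u
  have tb' := dist_triangle b u x
  have tc' := dist_triangle a u x
  rw [dist_comm u x] at tb' tc'
  have ht : t ∈ Ioo 0 (dist x u) := ⟨by linarith, by linarith⟩
  have hI := Ioo_subset_Icc_self ht
  refine ⟨ht, ?_⟩
  have hx : dist o x < ι := by linarith [dist_nonneg (x := x) (y := u)]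
  have hu : dist o u < ι := by linarith [dist_triangle o x u]
  have e1 := hφ.dist_left hI
  have e2 := hφ.dist_right hI
  have hz : dist o (φ t) < ι := by linarith [dist_triangle o x (φ t), hI.2]
  have fa := hX.four_point o ha hx hz hu
  have fb := hX.four_point o hb hx hz hu
  have f := hX.four_point o ha hb hu hx
  rw [e1, e2] at fa fb
  have tt := dist_triangle_right a b (φ t)
  have c1 : dist u x = dist x u := dist_comm _ _
  have c2 : dist (φ t) b = dist b (φ t) := dist_comm _ _
  rw [mem_mseg]
  have ga : dist a (φ t) ≤ dist a u - dist x u + t := by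
    rcases le_max_iff.1 fa with h | h <;> linarith
  have gb : dist b (φ t) ≤ dist b x - t := by
    rcases le_max_iff.1 fb with h | h <;> linarith
  have g : dist a u + dist b x ≤ dist a b + dist x u := by
    rcases le_max_iff.1 f with h | h <;> linarith
  linarith

end IsUniformLocalTree

/-- The Gromov product `(x|b)_a`. -/
noncomputable def gromov (a b x : X) : ℝ := (dist a x + dist a b - dist b x) / 2

theorem gromov_le (a b x : X) : gromov a b x ≤ dist a x := by
  have := dist_triangle a x b
  rw [dist_comm x b] at this
  unfold gromov
  linarith

theorem sub_dist_le_gromov (a b x : X) : dist a x - dist b x ≤ gromov a b x := by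
  have := dist_triangle a b x
  unfold gromov
  linarith

theorem openSeg_subset_ball (x y : X) : openSeg x y ⊆ Metric.ball x (dist x y) := by
  rintro z ⟨φ, hφ, t, ht, rfl⟩
  rw [Metric.mem_ball, dist_comm, hφ.dist_left (Ioo_subset_Icc_self ht)]
  exact ht.2

theorem openSeg_subset_skeleton {x y : X} (hxy : dist x y < ι) : openSeg x y ⊆ skeleton X ι :=
  fun _ hz => mem_iUnion.2 ⟨x, mem_iUnion₂.2 ⟨y, by rwa [Metric.mem_ball, dist_comm], hz⟩⟩

variable [MeasurableSpace X] [BorelSpace X]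

theorem IsGeodesic.hausdorffMeasure_image {φ : ℝ → X} {u v : X} (hφ : IsGeodesic φ u v)
    {A : Set ℝ} (hA : A ⊆ Icc 0 (dist u v)) : Measure.hausdorffMeasure 1 (φ '' A) = volume A := by
  have hiso : Isometry (fun t : Icc (0 : ℝ) (dist u v) => φ t) :=
    Isometry.of_dist_eq fun s t => hφ.1 s s.2 t t.2
  have himg : φ '' A = (fun t : Icc (0 : ℝ) (dist u v) => φ t) ''
      ((fun t : Icc (0 : ℝ) (dist u v) => (t : ℝ)) ⁻¹' A) := by
    ext z
    constructor
    · rintro ⟨t, ht, rfl⟩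
      exact ⟨⟨t, hA ht⟩, ht, rfl⟩
    · rintro ⟨t, ht, rfl⟩
      exact ⟨t, ht, rfl⟩
  rw [himg, hiso.hausdorffMeasure_image (Or.inl zero_le_one),
    ← isometry_subtype_coe.hausdorffMeasure_image (Or.inl zero_le_one),
    Subtype.image_preimage_coe, inter_eq_self_of_subset_right hA, hausdorffMeasure_real]

theorem IsGeodesic.lengthMeasure_image_le {φ : ℝ → X} {u v : X} (hφ : IsGeodesic φ u v)
    {A : Set ℝ} (hA : A ⊆ Icc 0 (dist u v)) : lengthMeasure X ι (φ '' A) ≤ volume A :=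
  (Measure.restrict_apply_le _ _).trans (hφ.hausdorffMeasure_image hA).le

namespace IsUniformLocalTree

theorem lengthMeasure_mseg_le (hX : IsUniformLocalTree X ι) {u v : X} (huv : dist u v < ι) :
    lengthMeasure X ι (mseg u v) ≤ ENNReal.ofReal (dist u v) := by
  obtain ⟨φ, hφ, -⟩ := hX.exists_geodesic huv
  rw [hX.mseg_eq huv hφ]
  refine (hφ.lengthMeasure_image_le Subset.rfl).trans ?_
  simp

theorem lengthMeasure_image (hX : IsUniformLocalTree X ι) {φ : ℝ → X} {u v : X}
    (huv : dist u v < ι) (hφ : IsGeodesic φ u v) {A : Set ℝ} (hA : A ⊆ Ioo 0 (dist u v)) :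
    lengthMeasure X ι (φ '' A) = volume A := by
  have : φ '' A ⊆ skeleton X ι :=
    (image_mono hA).trans ((hX.openSeg_eq huv hφ).symm.subset.trans (openSeg_subset_skeleton huv))
  rw [lengthMeasure, Measure.restrict_eq_self _ this,
    hφ.hausdorffMeasure_image (hA.trans Ioo_subset_Icc_self)]

/-- Arc-length parametrization of the length measure on a segment. -/
theorem restrict_openSeg (hX : IsUniformLocalTree X ι) {φ : ℝ → X} {u v : X}
    (huv : dist u v < ι) (hφ : IsGeodesic φ u v) (hc : Continuous φ) :
    (lengthMeasure X ι).restrict (openSeg u v) =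
      (volume.restrict (Ioo 0 (dist u v))).map φ := by
  ext B hB
  rw [Measure.restrict_apply hB, Measure.map_apply hc.measurable hB,
    Measure.restrict_apply (hc.measurable hB), hX.openSeg_eq huv hφ,
    ← image_preimage_inter, hX.lengthMeasure_image huv hφ inter_subset_right]

theorem setLIntegral_openSeg (hX : IsUniformLocalTree X ι) {φ : ℝ → X} {u v : X}
    (huv : dist u v < ι) (hφ : IsGeodesic φ u v) (hc : Continuous φ) {Λ : X → ℝ≥0∞}
    (hΛ : Measurable Λ) :
    ∫⁻ z in openSeg u v, Λ z ∂(lengthMeasure X ι) = ∫⁻ t in Ioo 0 (dist u v), Λ (φ t) := by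
  rw [hX.restrict_openSeg huv hφ hc, lintegral_map hΛ hc.measurable]

/-- Along `]x,u[` the Gromov product `(·|b)_a` changes on `[a,b]` only. -/
theorem abs_gromov_sub_le (hX : IsUniformLocalTree X ι) {o a b x u : X} (ha : dist o a < ι)
    (hb : dist o b < ι) (hxu : dist o x + dist x u < ι) :
    ENNReal.ofReal |gromov a b x - gromov a b u| ≤
      lengthMeasure X ι (openSeg x u ∩ mseg a b) := by
  have hd : dist x u < ι := by linarith [dist_nonneg (x := o) (y := x)]
  obtain ⟨φ, hφ, -⟩ := hX.exists_geodesic hd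
  have key : ∀ a b : X, dist o a < ι → dist o b < ι →
      ENNReal.ofReal (gromov a b u - gromov a b x) ≤
        lengthMeasure X ι (openSeg x u ∩ mseg a b) := by
    intro a b ha hb
    have hsub : ∀ t ∈ Ioo ((dist a x + dist x u - dist a u) / 2)
        ((dist b x + dist x u - dist b u) / 2), t ∈ Ioo 0 (dist x u) ∧ φ t ∈ mseg a b :=
      fun t ht => hX.apply_mem_mseg_of_between hφ ha hb hxu ht.1 ht.2
    calc ENNReal.ofReal (gromov a b u - gromov a b x)
        = volume (Ioo ((dist a x + dist x u - dist a u) / 2)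
            ((dist b x + dist x u - dist b u) / 2)) := by
          rw [Real.volume_Ioo]
          congr 1
          unfold gromov
          ring
      _ = lengthMeasure X ι (φ '' Ioo ((dist a x + dist x u - dist a u) / 2)
            ((dist b x + dist x u - dist b u) / 2)) :=
          (hX.lengthMeasure_image hd hφ fun t ht => (hsub t ht).1).symm
      _ ≤ _ := by
          refine measure_mono ?_
          rw [hX.openSeg_eq hd hφ]
          rintro _ ⟨t, ht, rfl⟩
          exact ⟨mem_image_of_mem _ (hsub t ht).1, (hsub t ht).2⟩
  rcases abs_cases (gromov a b x - gromov a b u) with ⟨h, -⟩ | ⟨h, -⟩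
  -- The other sign follows by exchanging `a` and `b`, since `(x|b)_a + (x|a)_b = dist a b`.
  · have := key b a hb ha
    rw [mseg_comm] at this
    rw [h]
    convert this using 2
    unfold gromov
    rw [dist_comm b a]
    ring
  · rw [h, neg_sub]
    exact key a b ha hb

end IsUniformLocalTree

end Local

/-! ### Functions dominated by the integral of a density along segments -/

/-- A function on `[0, D]` whose small increments are dominated by the integral of an integrable
density is absolutely continuous, and its derivative is dominated by the density. -/
theorem absolutelyContinuous_of_le_setLIntegral {F : ℝ → ℝ} {k : ℝ → ℝ≥0∞} (hk : Measurable k)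
    {D η : ℝ} (hD : 0 ≤ D) (hη : 0 < η) (hfin : ∫⁻ t in Ioo 0 D, k t ≠ ∞)
    (hF : ∀ s t, 0 ≤ s → s ≤ t → t ≤ D → t - s < η →
      ENNReal.ofReal |F s - F t| ≤ ∫⁻ τ in Ioo s t, k τ) :
    AbsolutelyContinuousOnInterval F 0 D ∧ ∀ᵐ t, t ∈ Ioo 0 D →
      DifferentiableAt ℝ F t ∧ ENNReal.ofReal |deriv F t| ≤ k t := by
  have hfin' : ∫⁻ t in Ioc 0 D, k t ≠ ∞ := by rwa [restrict_Ioo_eq_restrict_Ioc] at hfin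
  have hint : IntervalIntegrable (fun t => (k t).toReal) volume 0 D := by
    rw [intervalIntegrable_iff_integrableOn_Ioc_of_le hD]
    exact integrable_toReal_of_lintegral_ne_top hk.aemeasurable hfin'
  -- Small increments of `F` are dominated by those of the primitive `Ψ` of the density; absolute
  -- continuity and the bound on slopes are both inherited from `Ψ`.
  set Ψ : ℝ → ℝ := fun t => ∫ v in (0 : ℝ)..t, (k v).toReal with hΨ
  have hsub : ∀ s t, 0 ≤ s → s ≤ t → t ≤ D →
      Ψ t - Ψ s = (∫⁻ τ in Ioo s t, k τ).toReal := by
    intro s t hs hst ht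
    have hm : ∀ {a b : ℝ}, 0 ≤ a → a ≤ D → 0 ≤ b → b ≤ D →
        IntervalIntegrable (fun t => (k t).toReal) volume a b := fun h1 h2 h3 h4 =>
      hint.mono_set (by
        rw [uIcc_of_le hD]
        exact uIcc_subset_Icc ⟨h1, h2⟩ ⟨h3, h4⟩)
    have hfin2 : ∫⁻ t in Ioc s t, k t ≠ ∞ :=
      ne_top_of_le_ne_top hfin' (lintegral_mono_set (Ioc_subset_Ioc hs ht))
    simp only [hΨ]
    rw [intervalIntegral.integral_interval_sub_left (hm le_rfl hD (hs.trans hst) ht)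
      (hm le_rfl hD hs (hst.trans ht)), intervalIntegral.integral_of_le hst,
      integral_toReal hk.aemeasurable (ae_lt_top hk hfin2), restrict_Ioo_eq_restrict_Ioc]
  have hle : ∀ s t, s ∈ Icc 0 D → t ∈ Icc 0 D → |t - s| < η → |F s - F t| ≤ |Ψ s - Ψ t| := by
    have : ∀ s t, 0 ≤ s → s ≤ t → t ≤ D → t - s < η → |F s - F t| ≤ |Ψ s - Ψ t| := by
      intro s t hs hst ht h
      have h1 := hF s t hs hst ht h
      rw [abs_sub_comm (Ψ s), hsub s t hs hst ht, abs_of_nonneg ENNReal.toReal_nonneg]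
      refine (ENNReal.ofReal_le_iff_le_toReal ?_).1 h1
      exact ne_top_of_le_ne_top hfin (lintegral_mono_set (Ioo_subset_Ioo hs ht))
    intro s t hs ht h
    rcases le_total s t with hst | hst
    · exact this s t hs.1 hst ht.2 (lt_of_abs_lt h)
    · rw [abs_sub_comm (F s), abs_sub_comm (Ψ s)]
      exact this t s ht.1 hst hs.2 (by rw [abs_sub_comm] at h; exact lt_of_abs_lt h)
  have hΨac : AbsolutelyContinuousOnInterval Ψ 0 D :=
    hint.absolutelyContinuousOnInterval_intervalIntegral left_mem_uIcc
  have hFac : AbsolutelyContinuousOnInterval F 0 D := by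
    rw [absolutelyContinuousOnInterval_iff] at hΨac ⊢
    intro ε hε
    obtain ⟨δ, hδ, h⟩ := hΨac ε hε
    -- Total length below `η` forces every single interval to be shorter than `η`, where the
    -- domination is available.
    refine ⟨min δ η, lt_min hδ hη, fun E hE hE' => ?_⟩
    refine lt_of_le_of_lt (Finset.sum_le_sum fun i hi => ?_) (h E hE (hE'.trans_le (min_le_left _ _)))
    have hmem := hE.1 i hi
    rw [uIcc_of_le hD] at hmem
    refine hle _ _ hmem.1 hmem.2 ?_
    rw [abs_sub_comm, ← Real.dist_eq]
    refine lt_of_le_of_lt ?_ (hE'.trans_le (min_le_right _ _))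
    exact Finset.single_le_sum (f := fun i => dist (E.2 i).1 (E.2 i).2)
      (fun _ _ => dist_nonneg) hi
  refine ⟨hFac, ?_⟩
  have hlt : ∀ᵐ t, t ∈ Ioo 0 D → k t < ∞ := by
    rw [← ae_restrict_iff' measurableSet_Ioo]
    exact ae_lt_top hk hfin
  filter_upwards [hint.ae_hasDerivAt_integral, hFac.ae_differentiableAt, hlt] with t h1 h2 h3 ht
  have hI : t ∈ uIcc 0 D := by
    rw [uIcc_of_le hD]
    exact Ioo_subset_Icc_self ht
  have hd := h2 hI
  have hd' : HasDerivAt Ψ (k t).toReal t := h1 hI 0 left_mem_uIcc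
  refine ⟨hd, ?_⟩
  have hbound : |deriv F t| ≤ |(k t).toReal| := by
    refine le_of_tendsto_of_tendsto (hasDerivAt_iff_tendsto_slope.1 hd.hasDerivAt).abs
      (hasDerivAt_iff_tendsto_slope.1 hd').abs ?_
    have hn : ∀ᶠ s in 𝓝 t, s ∈ Ioo 0 D ∧ s ∈ Metric.ball t η :=
      (eventually_mem_set.2 (Ioo_mem_nhds ht.1 ht.2)).and
        (eventually_mem_set.2 (Metric.ball_mem_nhds t hη))
    filter_upwards [hn.filter_mono nhdsWithin_le_nhds] with s hs
    rw [slope_def_field, slope_def_field, abs_div, abs_div]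
    refine div_le_div_of_nonneg_right ?_ (abs_nonneg _)
    exact hle s t (Ioo_subset_Icc_self hs.1) (Ioo_subset_Icc_self ht) (by
      rw [abs_sub_comm, ← Real.dist_eq]
      exact hs.2)
  rw [abs_of_nonneg ENNReal.toReal_nonneg] at hbound
  exact (ENNReal.ofReal_le_ofReal hbound).trans (ENNReal.ofReal_toReal_le)

/-! ### Overlapping geodesics and slopes of distance functions -/

section Geodesics

variable {X : Type*} [MetricSpace X] {ι : ℝ}

theorem IsGeodesic.sub {φ : ℝ → X} {u v : X} (hφ : IsGeodesic φ u v) {s t : ℝ} (hs : 0 ≤ s)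
    (hst : s ≤ t) (ht : t ≤ dist u v) :
    IsGeodesic (fun τ => φ (s + τ)) (φ s) (φ t) ∧ dist (φ s) (φ t) = t - s := by
  have hd : dist (φ s) (φ t) = t - s := by
    rw [hφ.1 s ⟨hs, hst.trans ht⟩ t ⟨hs.trans hst, ht⟩, abs_sub_comm,
      abs_of_nonneg (sub_nonneg.2 hst)]
  refine ⟨⟨fun p hp q hq => ?_, by simp, by simp [hd]⟩, hd⟩
  rw [hd] at hp hq
  rw [hφ.1 _ ⟨by linarith [hp.1], by linarith [hp.2]⟩ _ ⟨by linarith [hq.1], by linarith [hq.2]⟩]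
  congr 1
  ring

namespace IsUniformLocalTree

theorem dist_of_mem_mseg (hX : IsUniformLocalTree X ι) {u v z w : X} (huv : dist u v < ι)
    (hz : z ∈ mseg u v) (hw : w ∈ mseg u v) : dist z w = |dist u z - dist u w| := by
  obtain ⟨φ, hφ, -⟩ := hX.exists_geodesic huv
  have := hφ.1 _ (dist_left_mem_Icc hz) _ (dist_left_mem_Icc hw)
  rwa [hX.eq_apply huv hφ hz, hX.eq_apply huv hφ hw] at this

/-- Metric segments are convex. -/
theorem mseg_subset (hX : IsUniformLocalTree X ι) {a b p q : X} (hab : dist a b < ι)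
    (hp : p ∈ mseg a b) (hq : q ∈ mseg a b) : mseg p q ⊆ mseg a b := by
  have key : ∀ p q, p ∈ mseg a b → q ∈ mseg a b → dist a p ≤ dist a q →
      mseg p q ⊆ mseg a b := by
    intro p q hp hq hpq w hw
    have h := hX.dist_of_mem_mseg hab hp hq
    rw [abs_sub_comm, abs_of_nonneg (sub_nonneg.2 hpq)] at h
    rw [mem_mseg] at hp hq hw ⊢
    have t1 := dist_triangle a p w
    have t2 := dist_triangle w q b
    have t3 := dist_triangle a w b
    linarith
  rcases le_total (dist a p) (dist a q) with h | h
  · exact key p q hp hq h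
  · rw [mseg_comm]
    exact key q p hq hp h

/-- By convexity of `[a, b]` the overlap is an interval of parameters. Its frontier is therefore
null, and almost every parameter of the overlap is an interior one, where derivatives can be
compared. -/
theorem ordConnected_preimage_mseg (hX : IsUniformLocalTree X ι) {φ : ℝ → X} {u v a b : X}
    (hφ : IsGeodesic φ u v) (hab : dist a b < ι) :
    OrdConnected {t | t ∈ Ioo 0 (dist u v) ∧ φ t ∈ mseg a b} := by
  refine ⟨fun s hs t ht r hr => ?_⟩
  have hI : r ∈ Ioo 0 (dist u v) := ⟨hs.1.1.trans_le hr.1, hr.2.trans_lt ht.1.2⟩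
  refine ⟨hI, hX.mseg_subset hab hs.2 ht.2 ?_⟩
  have hs' := Ioo_subset_Icc_self hs.1
  have ht' := Ioo_subset_Icc_self ht.1
  have hr' := Ioo_subset_Icc_self hI
  rw [mem_mseg, hφ.1 _ hs' _ hr', hφ.1 _ hr' _ ht', hφ.1 _ hs' _ ht', abs_of_nonpos (sub_nonpos.2 hr.1),
    abs_of_nonpos (sub_nonpos.2 hr.2), abs_of_nonpos (sub_nonpos.2 (hr.1.trans hr.2))]
  ring

/-- Where two geodesics overlap, they agree up to an affine isometry of the parameters, and the
derivatives along them correspond. -/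
theorem deriv_mul_deriv_dist (hX : IsUniformLocalTree X ι) {φ σ : ℝ → X} {x u a b : X}
    (hφ : IsGeodesic φ x u) (hσ : IsGeodesic σ a b) (hab : dist a b < ι) {f : X → ℝ} {t₀ : ℝ}
    (ht₀ : t₀ ∈ interior {t | t ∈ Ioo 0 (dist x u) ∧ φ t ∈ mseg a b})
    (hd : DifferentiableAt ℝ (fun t => f (φ t)) t₀) :
    deriv (fun τ => f (σ τ)) (dist a (φ t₀)) * deriv (fun τ => dist x (σ τ)) (dist a (φ t₀)) =
      deriv (fun t => f (φ t)) t₀ := by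
  set J := {t | t ∈ Ioo 0 (dist x u) ∧ φ t ∈ mseg a b} with hJ
  obtain ⟨η, hη, hball⟩ := Metric.isOpen_iff.1 isOpen_interior t₀ ht₀
  have hballJ : ∀ t, |t - t₀| < η → t ∈ J := fun t ht =>
    interior_subset (hball (by rwa [Metric.mem_ball, Real.dist_eq]))
  have hiso : ∀ s ∈ J, ∀ t ∈ J, |dist a (φ s) - dist a (φ t)| = |s - t| := by
    intro s hs t ht
    rw [← hX.dist_of_mem_mseg hab hs.2 ht.2]
    exact hφ.1 s (Ioo_subset_Icc_self hs.1) t (Ioo_subset_Icc_self ht.1)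
  have h0J : t₀ ∈ J := hballJ t₀ (by simpa using hη)
  have h1J : t₀ + η / 2 ∈ J := hballJ _ (by
    rw [add_sub_cancel_left, abs_of_pos (by linarith)]
    linarith)
  -- A distance-preserving map from a subset of the line to the line is affine with slope `±1`; the
  -- sign is read off at `t₀` and `t₀ + η / 2`.
  obtain ⟨ε, hε, haff⟩ : ∃ ε : ℝ, ε * ε = 1 ∧ ∀ t ∈ J,
      dist a (φ t) = dist a (φ t₀) + ε * (t - t₀) := by
    have hd1 := hiso _ h1J _ h0J
    rw [add_sub_cancel_left, abs_of_pos (by linarith : 0 < η / 2)] at hd1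
    rcases (abs_eq (by linarith)).1 hd1 with h | h
    · refine ⟨1, by norm_num, fun t ht => ?_⟩
      rcases abs_eq_abs.1 (hiso t ht _ h0J) with h2 | h2 <;>
        rcases abs_eq_abs.1 (hiso t ht _ h1J) with h3 | h3 <;> linarith
    · refine ⟨-1, by norm_num, fun t ht => ?_⟩
      rcases abs_eq_abs.1 (hiso t ht _ h0J) with h2 | h2 <;>
        rcases abs_eq_abs.1 (hiso t ht _ h1J) with h3 | h3 <;> linarith
  set τ₀ := dist a (φ t₀) with hτ₀
  have hεabs : |ε| = 1 := by
    have : |ε| * |ε| = 1 := by rw [← abs_mul, hε, abs_one]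
    nlinarith [abs_nonneg ε]
  have hnear : ∀ τ, |τ - τ₀| < η →
      t₀ + ε * (τ - τ₀) ∈ J ∧ σ τ = φ (t₀ + ε * (τ - τ₀)) := by
    intro τ hτ
    have hmem : t₀ + ε * (τ - τ₀) ∈ J := hballJ _ (by
      rw [add_sub_cancel_left, abs_mul, hεabs, one_mul]
      exact hτ)
    refine ⟨hmem, ?_⟩
    have h1 := haff _ hmem
    have h2 := hX.eq_apply hab hσ hmem.2
    rw [h1] at h2
    rw [← h2]
    congr 1
    linear_combination -(τ - τ₀) * hε
  have hev : ∀ᶠ τ in 𝓝 τ₀, |τ - τ₀| < η := by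
    filter_upwards [Metric.ball_mem_nhds τ₀ hη] with τ hτ
    rwa [Metric.mem_ball, Real.dist_eq] at hτ
  have hA : HasDerivAt (fun τ : ℝ => t₀ + ε * (τ - τ₀)) ε τ₀ := by
    simpa using (((hasDerivAt_id τ₀).sub_const τ₀).const_mul ε).const_add t₀
  have e1 : HasDerivAt (fun τ => f (σ τ)) (deriv (fun t => f (φ t)) t₀ * ε) τ₀ := by
    refine (HasDerivAt.comp_of_eq τ₀ hd.hasDerivAt hA (by simp)).congr_of_eventuallyEq ?_
    filter_upwards [hev] with τ hτ
    simp only [Function.comp_apply]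
    rw [(hnear τ hτ).2]
  have e2 : HasDerivAt (fun τ => dist x (σ τ)) ε τ₀ := by
    refine hA.congr_of_eventuallyEq ?_
    filter_upwards [hev] with τ hτ
    rw [(hnear τ hτ).2, hφ.dist_left (Ioo_subset_Icc_self (hnear τ hτ).1.1)]
  -- The relative orientation `ε` of the two geodesics occurs in both derivatives and cancels.
  rw [e1.deriv, e2.deriv, mul_assoc, hε, mul_one]

/-- The distance to a point `x` has slope `±1` at almost every point of a geodesic in
`B(x, ι)`. -/
theorem ae_abs_deriv_dist (hX : IsUniformLocalTree X ι) {σ : ℝ → X} {a b x : X}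
    (hσ : IsGeodesic σ a b) (hL : LipschitzWith 1 σ) :
    ∀ᵐ τ, τ ∈ Ioo 0 (dist a b) → dist x (σ τ) < ι →
      |deriv (fun τ => dist x (σ τ)) τ| = 1 := by
  have hlip : LipschitzWith 1 fun τ => dist x (σ τ) := by
    simpa [Function.comp_def] using (LipschitzWith.dist_right x).comp hL
  filter_upwards [hlip.ae_differentiableAt_real] with τ hd hτ hlt
  refine le_antisymm (by simpa using norm_deriv_le_of_lipschitz hlip (x₀ := τ)) ?_
  set D : ℝ → ℝ := fun τ => dist x (σ τ) with hD
  have hcont : Continuous D := hlip.continuous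
  have hev : ∀ᶠ s in 𝓝 τ, s ∈ Ioo 0 (dist a b) ∧ D s < ι :=
    (eventually_mem_set.2 (Ioo_mem_nhds hτ.1 hτ.2)).and (hcont.continuousAt.eventually_lt_const hlt)
  obtain ⟨η, hη, hball⟩ := Metric.eventually_nhds_iff.1 hev
  -- By the four-point condition for `x`, `σ (τ - ε)`, `σ τ`, `σ (τ + ε)`, the distance to `x` grows
  -- at full speed in at least one of the two directions. This excludes a derivative in `]-1, 1[`.
  have key : ∀ ε, 0 < ε → ε < η → D τ + ε ≤ D (τ - ε) ∨ D τ + ε ≤ D (τ + ε) := by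
    intro ε h0 h1
    have m1 := hball (y := τ - ε) (by
      rw [Real.dist_eq, sub_sub_cancel_left, abs_neg, abs_of_pos h0]
      exact h1)
    have m2 := hball (y := τ + ε) (by
      rw [Real.dist_eq, add_sub_cancel_left, abs_of_pos h0]
      exact h1)
    have i0 := Ioo_subset_Icc_self hτ
    have i1 := Ioo_subset_Icc_self m1.1
    have i2 := Ioo_subset_Icc_self m2.1
    have := hX.four_point x (w := x) (x := σ (τ - ε)) (y := σ τ) (z := σ (τ + ε))
      (by simpa using hX.pos) m1.2 hlt m2.2
    rw [hσ.1 _ i1 _ i2, hσ.1 _ i0 _ i2, hσ.1 _ i1 _ i0, abs_of_neg (by linarith),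
      abs_of_neg (by linarith), abs_of_neg (by linarith)] at this
    simp only [hD]
    rcases le_max_iff.1 this with h | h
    · left; linarith
    · right; linarith
  set l := deriv D τ with hl
  by_contra hlt1
  push Not at hlt1
  have hl1 := abs_lt.1 hlt1
  have hslope := hasDerivAt_iff_tendsto_slope.1 hd.hasDerivAt
  have hev2 : ∀ᶠ s in 𝓝[≠] τ, slope D τ s ∈ Ioo (-1 : ℝ) 1 :=
    hslope.eventually (Ioo_mem_nhds hl1.1 hl1.2)
  rw [eventually_nhdsWithin_iff, Metric.eventually_nhds_iff] at hev2
  obtain ⟨η', hη', h2⟩ := hev2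
  set ε := min η η' / 2 with hε
  have hm : 0 < min η η' := lt_min hη hη'
  have h0 : 0 < ε := by positivity
  have hεη : ε < η := by linarith [min_le_left η η']
  have hεη' : ε < η' := by linarith [min_le_right η η']
  rcases key ε h0 hεη with h | h
  · have := (h2 (y := τ - ε) (by
      rw [Real.dist_eq, sub_sub_cancel_left, abs_neg, abs_of_pos h0]
      exact hεη') (by simp [h0.ne'])).1
    rw [slope_def_field, sub_sub_cancel_left, div_neg, neg_lt_neg_iff, div_lt_one h0] at this
    linarith
  · have := (h2 (y := τ + ε) (by
      rw [Real.dist_eq, add_sub_cancel_left, abs_of_pos h0]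
      exact hεη') (by simp [h0.ne'])).2
    rw [slope_def_field, add_sub_cancel_left, div_lt_one h0] at this
    linarith

end IsUniformLocalTree

end Geodesics

/-- The sets `disjointed M n` and the complement of the union form a countable measurable partition,
indexed by `Option ℕ`. Gradients are defined piecewise in this way, each point being assigned to the
first segment that contains it. -/
theorem exists_measurable_eqOn_disjointed {X : Type*} [MeasurableSpace X] {M : ℕ → Set X}
    (hM : ∀ n, MeasurableSet (M n)) {k : ℕ → X → ℝ} (hk : ∀ n, Measurable (k n)) :
    ∃ g : X → ℝ, Measurable g ∧ (∀ n, ∀ z ∈ disjointed M n, g z = k n z) ∧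
      ∀ z, (∀ n, z ∉ M n) → g z = 0 := by
  have hkm : ∀ i : Option ℕ, Measurable (i.elim (fun _ => (0 : ℝ)) k) := by
    intro i
    cases i with
    | none => exact measurable_const
    | some n => exact hk n
  obtain ⟨g, hg, hgk⟩ := exists_measurable_piecewise
    (fun i : Option ℕ => i.elim (⋃ n, M n)ᶜ (disjointed M))
    (fun i => by
      cases i with
      | none => exact (MeasurableSet.iUnion hM).compl
      | some n => exact MeasurableSet.disjointed hM n)
    (fun i => i.elim (fun _ => (0 : ℝ)) k) hkm
    (fun i j hij z hz => by
      exfalso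
      cases i with
      | none =>
        cases j with
        | none => exact hij rfl
        | some n => exact hz.1 (mem_iUnion.2 ⟨n, disjointed_subset M n hz.2⟩)
      | some m =>
        cases j with
        | none => exact hz.2 (mem_iUnion.2 ⟨m, disjointed_subset M m hz.1⟩)
        | some n =>
          have hmn : m ≠ n := fun h => hij (by rw [h])
          exact (disjoint_left.1 (disjoint_disjointed M hmn)) hz.1 hz.2)
  refine ⟨g, hg, fun n z hz => hgk (some n) hz, fun z hz => hgk none ?_⟩
  simpa using hz

/-! ### Weak gradients from a density carried by countably many segments -/

section AbsGradient

variable {X : Type*} [MetricSpace X] [MeasurableSpace X] [BorelSpace X] {ι : ℝ}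

namespace IsUniformLocalTree

theorem setLIntegral_openSeg_sub (hX : IsUniformLocalTree X ι) {φ : ℝ → X} {u v : X}
    (huv : dist u v < ι) (hφ : IsGeodesic φ u v) (hc : Continuous φ) {Λ : X → ℝ≥0∞}
    (hΛ : Measurable Λ) {s t : ℝ} (hs : 0 ≤ s) (hst : s ≤ t) (ht : t ≤ dist u v) :
    ∫⁻ z in openSeg (φ s) (φ t), Λ z ∂(lengthMeasure X ι) = ∫⁻ τ in Ioo s t, Λ (φ τ) := by
  obtain ⟨hg, hd⟩ := hφ.sub hs hst ht
  rw [hX.setLIntegral_openSeg (by rw [hd]; linarith) hg (hc.comp (by fun_prop)) hΛ, hd]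
  have := (measurePreserving_add_left volume s).setLIntegral_comp_preimage
    (s := Ioo s t) measurableSet_Ioo (hΛ.comp hc.measurable)
  rw [preimage_const_add_Ioo, sub_self] at this
  exact this

variable {f : X → ℝ} {Λ : X → ℝ≥0∞} {δ : ℝ}

theorem absolutelyContinuous_comp_geodesic (hX : IsUniformLocalTree X ι) (hΛ : Measurable Λ)
    (hδ : 0 < δ)
    (hfin : ∀ x u, dist x u < ι → ∫⁻ z in openSeg x u, Λ z ∂(lengthMeasure X ι) ≠ ∞)
    (hf : ∀ x u, dist x u < δ →
      ENNReal.ofReal |f x - f u| ≤ ∫⁻ z in openSeg x u, Λ z ∂(lengthMeasure X ι))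
    {φ : ℝ → X} {u v : X} (huv : dist u v < ι) (hφ : IsGeodesic φ u v) (hc : Continuous φ) :
    AbsolutelyContinuousOnInterval (fun t => f (φ t)) 0 (dist u v) ∧
      ∀ᵐ t, t ∈ Ioo 0 (dist u v) → DifferentiableAt ℝ (fun t => f (φ t)) t ∧
        ENNReal.ofReal |deriv (fun t => f (φ t)) t| ≤ Λ (φ t) := by
  refine absolutelyContinuous_of_le_setLIntegral (hΛ.comp hc.measurable) dist_nonneg hδ ?_ ?_
  · have := hfin u v huv
    rwa [hX.setLIntegral_openSeg huv hφ hc hΛ] at this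
  · intro s t hs hst ht hlt
    have := hf (φ s) (φ t) (by rwa [(hφ.sub hs hst ht).2])
    rwa [hX.setLIntegral_openSeg_sub huv hφ hc hΛ hs hst ht] at this

/-- A continuous function whose small increments are dominated by the integrals of a density
carried by countably many segments is absolutely continuous, and `|∂ f|` is dominated by the
density. -/
theorem exists_isAbsGradient (hX : IsUniformLocalTree X ι) (hfc : Continuous f)
    (hΛ : Measurable Λ) (hδ : 0 < δ)
    (hfin : ∀ x u, dist x u < ι → ∫⁻ z in openSeg x u, Λ z ∂(lengthMeasure X ι) ≠ ∞)
    (hf : ∀ x u, dist x u < δ →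
      ENNReal.ofReal |f x - f u| ≤ ∫⁻ z in openSeg x u, Λ z ∂(lengthMeasure X ι))
    {a b : ℕ → X} (hab : ∀ n, dist (a n) (b n) < ι)
    (hsupp : ∀ z, (∀ n, z ∉ mseg (a n) (b n)) → Λ z = 0) :
    ∃ G : X → ℝ, IsAbsGradient ι f G ∧
      ∀ᵐ z ∂(lengthMeasure X ι), ENNReal.ofReal |G z| ≤ Λ z := by
  choose σ hσ hσL using fun n => hX.exists_geodesic (hab n)
  have hσc : ∀ n, Continuous (σ n) := fun n => (hσL n).continuous
  set M : ℕ → Set X := fun n => mseg (a n) (b n) with hM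
  have hMm : ∀ n, MeasurableSet (M n) := fun n => (isClosed_mseg _ _).measurableSet
  set F : ℕ → ℝ → ℝ := fun n τ => f (σ n τ) with hF
  have hFm : ∀ n, Measurable fun z => deriv (F n) (dist (a n) z) := fun n =>
    (measurable_deriv _).comp (by fun_prop)
  have hDm : ∀ x n, Measurable fun z => deriv (fun τ => dist x (σ n τ)) (dist (a n) z) :=
    fun x n => (measurable_deriv _).comp (by fun_prop)
  have hpiece : ∀ z, (∃ n, z ∈ M n) → ∃ n, z ∈ disjointed M n := by
    intro z hz
    have : z ∈ ⋃ n, disjointed M n := by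
      rw [iUnion_disjointed]
      exact mem_iUnion.2 hz
    exact mem_iUnion.1 this
  obtain ⟨G, hGm, hGp, hG0⟩ := exists_measurable_eqOn_disjointed hMm fun n => (hFm n).abs
  -- null sets of parameters are mapped to null sets
  have hnull : ∀ (N : ℕ → Set ℝ), (∀ n, volume (N n ∩ Ioo 0 (dist (a n) (b n))) = 0) →
      ∀ B : Set X, (∀ z ∈ B, ∃ n, z ∈ M n ∧ dist (a n) z ∈ N n) →
      lengthMeasure X ι B = 0 := by
    intro N hN B hB
    refine measure_mono_null (t := ⋃ n, σ n '' (N n ∩ Icc 0 (dist (a n) (b n))))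
      (fun z hz => ?_) (measure_iUnion_null fun n => ?_)
    · obtain ⟨n, h1, h2⟩ := hB z hz
      exact mem_iUnion.2 ⟨n, _, ⟨h2, dist_left_mem_Icc h1⟩, hX.eq_apply (hab n) (hσ n) h1⟩
    · refine le_antisymm (((hσ n).lengthMeasure_image_le inter_subset_right).trans ?_) zero_le
      rw [← hN n]
      exact (measure_congr ((ae_eq_refl _).inter Ioo_ae_eq_Icc.symm)).le
  refine ⟨G, ⟨hfc, hGm, fun x => ?_⟩, ?_⟩
  -- The derivative of `f` along the parametrization of a segment is multiplied by that of `dist x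
  -- ·`, which turns it into the derivative in the direction pointing away from `x`.
  · obtain ⟨g, hgm, hgp, hg0⟩ := exists_measurable_eqOn_disjointed hMm
      fun n => (hFm n).mul (hDm x n)
    refine ⟨g, ⟨hgm, fun u hu => ?_⟩, ?_⟩
    · have hxu : dist x u < ι := by rwa [Metric.mem_ball, dist_comm] at hu
      obtain ⟨φ, hφ, hφL⟩ := hX.exists_geodesic hxu
      have hφc := hφL.continuous
      obtain ⟨hac, hae⟩ := hX.absolutelyContinuous_comp_geodesic hΛ hδ hfin hf hxu hφ hφc
      have hfront : ∀ᵐ t, ∀ n, t ∉ frontier {t | t ∈ Ioo 0 (dist x u) ∧ φ t ∈ M n} := by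
        rw [ae_all_iff]
        intro n
        have := (hX.ordConnected_preimage_mseg hφ (hab n)).convex.addHaar_frontier volume
        exact measure_eq_zero_iff_ae_notMem.1 this
      have hgeq : ∀ᵐ t, t ∈ Ioo 0 (dist x u) → g (φ t) = deriv (fun t => f (φ t)) t := by
        filter_upwards [hae, hfront] with t h1 h2 ht
        obtain ⟨hd, hle⟩ := h1 ht
        by_cases hz : ∃ n, φ t ∈ M n
        · obtain ⟨n, hn⟩ := hpiece _ hz
          have hnM := disjointed_subset M n hn
          rw [hgp n _ hn]
          refine hX.deriv_mul_deriv_dist hφ (hσ n) (hab n) ?_ hd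
          by_contra hni
          exact h2 n ⟨subset_closure ⟨ht, hnM⟩, hni⟩
        -- Off all the segments the density vanishes, which forces the derivative of `f` along `φ`
        -- to vanish as well.
        · push Not at hz
          rw [hg0 _ hz]
          rw [hsupp _ hz, nonpos_iff_eq_zero, ENNReal.ofReal_eq_zero] at hle
          exact (abs_nonpos_iff.1 hle).symm
      have hgeq' : (fun t => g (φ t)) =ᵐ[volume.restrict (Ioo 0 (dist x u))]
          deriv (fun t => f (φ t)) := (ae_restrict_iff' measurableSet_Ioo).2 hgeq
      have hint := hac.intervalIntegrable_deriv
      rw [intervalIntegrable_iff_integrableOn_Ioo_of_le dist_nonneg] at hint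
      rw [IntegrableOn, hX.restrict_openSeg hxu hφ hφc]
      constructor
      · rw [integrable_map_measure hgm.aestronglyMeasurable hφc.aemeasurable]
        exact hint.congr hgeq'.symm
      · rw [integral_map hφc.aemeasurable hgm.aestronglyMeasurable, integral_congr_ae hgeq',
          ← integral_Ioc_eq_integral_Ioo, ← intervalIntegral.integral_of_le dist_nonneg,
          hac.integral_deriv_eq_sub, hφ.2.1, hφ.2.2]
    -- `G` and `|g|` differ by the factor `|deriv (dist x ·)|`, which is `1` outside a null set of
    -- parameters on each segment.
    · rw [ae_restrict_iff' Metric.isOpen_ball.measurableSet, ae_iff]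
      refine hnull (fun n => {τ | ¬(dist x (σ n τ) < ι →
        |deriv (fun τ => dist x (σ n τ)) τ| = 1)}) (fun n => ?_) _ fun z hz => ?_
      · have := hX.ae_abs_deriv_dist (x := x) (hσ n) (hσL n)
        rw [ae_iff] at this
        refine measure_mono_null (fun τ hτ => ?_) this
        exact fun h => hτ.1 (h hτ.2)
      · simp only [mem_ofPred_eq, Classical.not_imp] at hz
        obtain ⟨hzb, hne⟩ := hz
        by_cases hzM : ∃ n, z ∈ M n
        · obtain ⟨n, hn⟩ := hpiece _ hzM
          have hnM := disjointed_subset M n hn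
          refine ⟨n, hnM, fun h => hne ?_⟩
          rw [hX.eq_apply (hab n) (hσ n) hnM] at h
          rw [hGp n z hn, hgp n z hn, Pi.mul_apply, abs_mul, h (by rwa [Metric.mem_ball, dist_comm] at hzb),
            mul_one]
        · push Not at hzM
          exact absurd (by rw [hG0 z hzM, hg0 z hzM, abs_zero]) hne
  · rw [ae_iff]
    refine hnull (fun n => {τ | ¬(DifferentiableAt ℝ (F n) τ ∧
      ENNReal.ofReal |deriv (F n) τ| ≤ Λ (σ n τ))}) (fun n => ?_) _ fun z hz => ?_
    · have := (hX.absolutelyContinuous_comp_geodesic hΛ hδ hfin hf (hab n) (hσ n) (hσc n)).2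
      rw [ae_iff] at this
      refine measure_mono_null (fun τ hτ => ?_) this
      exact fun h => hτ.1 (h hτ.2)
    · by_cases hzM : ∃ n, z ∈ M n
      · obtain ⟨n, hn⟩ := hpiece _ hzM
        have hnM := disjointed_subset M n hn
        refine ⟨n, hnM, fun h => hz ?_⟩
        have := h.2
        rw [hX.eq_apply (hab n) (hσ n) hnM] at this
        rwa [hGp n z hn, abs_abs]
      · push Not at hzM
        exact absurd (by simp [hG0 z hzM]) hz

end IsUniformLocalTree

end AbsGradient

/-! ### Energies -/

/-- Jensen's inequality in the form of a power mean inequality. -/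
theorem rpow_lintegral_le {α : Type*} [MeasurableSpace α] {μ : Measure α} {f : α → ℝ≥0∞}
    (hf : AEMeasurable f μ) {p : ℝ} (hp : 1 ≤ p) :
    (∫⁻ x, f x ∂μ) ^ p ≤ μ univ ^ (p - 1) * ∫⁻ x, f x ^ p ∂μ := by
  rcases eq_or_lt_of_le hp with rfl | hp
  · simp
  have hpq : p.HolderConjugate (p / (p - 1)) := .conjExponent hp
  have h := ENNReal.lintegral_mul_le_Lp_mul_Lq μ hpq hf (aemeasurable_const (b := (1 : ℝ≥0∞)))
  have hp0 : 0 < p := by linarith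
  have hp1 : p - 1 ≠ 0 := by linarith
  calc (∫⁻ x, f x ∂μ) ^ p
      ≤ ((∫⁻ x, f x ^ p ∂μ) ^ (1 / p) * μ univ ^ (1 / (p / (p - 1)))) ^ p := by
        refine ENNReal.rpow_le_rpow ?_ hp0.le
        simpa using h
    _ = μ univ ^ (p - 1) * ∫⁻ x, f x ^ p ∂μ := by
        rw [ENNReal.mul_rpow_of_nonneg _ _ hp0.le, ← ENNReal.rpow_mul, ← ENNReal.rpow_mul,
          one_div_mul_cancel hp0.ne', ENNReal.rpow_one, mul_comm]
        congr 2
        field_simp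

theorem lpNorm_rpow {X : Type*} [MeasurableSpace X] {m : Measure X} {p : ℝ} (hp : 1 ≤ p) (f : X →ₘ[m] ℝ) :
    lpNorm m p f ^ p = ∫⁻ x, ‖f x‖ₑ ^ p ∂m := by
  have hp0 : 0 < p := by linarith
  rw [lpNorm, eLpNorm_eq_lintegral_rpow_enorm_toReal (by simpa using hp0) ENNReal.ofReal_ne_top,
    ENNReal.toReal_ofReal hp0.le, ← ENNReal.rpow_mul, one_div_mul_cancel hp0.ne', ENNReal.rpow_one]

theorem eLpNorm_rpow {X : Type*} [MeasurableSpace X] {μ : Measure X} {p : ℝ} (hp : 1 ≤ p) (f : X → ℝ) :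
    eLpNorm f (ENNReal.ofReal p) μ ^ p = ∫⁻ x, ‖f x‖ₑ ^ p ∂μ := by
  have hp0 : 0 < p := by linarith
  rw [eLpNorm_eq_lintegral_rpow_enorm_toReal (by simpa using hp0) ENNReal.ofReal_ne_top,
    ENNReal.toReal_ofReal hp0.le, ← ENNReal.rpow_mul, one_div_mul_cancel hp0.ne', ENNReal.rpow_one]

/-- `m(B(x, r))` is comparable to `r ^ dh`, with explicit constants. -/
structure VolumeBounds {X : Type*} [MetricSpace X] [MeasurableSpace X] (m : Measure X)
    (dh c C r₁ : ℝ) : Prop where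
  c_pos : 0 < c
  C_pos : 0 < C
  le_ball : ∀ (x : X) (r : ℝ), 0 < r → r < r₁ → ENNReal.ofReal (c * r ^ dh) ≤ m (Metric.ball x r)
  ball_le : ∀ (x : X) (r : ℝ), 0 < r → r < r₁ → m (Metric.ball x r) ≤ ENNReal.ofReal (C * r ^ dh)

section Energy

variable {X : Type*} [MetricSpace X] [MeasurableSpace X]

/-- `∫ ∫_{B(x,r)} |f(y) - f(x)|^p dm(y) dm(x)`. -/
noncomputable def pairEnergy (m : Measure X) (p : ℝ) (f : X → ℝ) (r : ℝ) : ℝ≥0∞ :=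
  ∫⁻ x, ∫⁻ y in Metric.ball x r, ‖f y - f x‖ₑ ^ p ∂m ∂m

theorem pairEnergy_congr {m : Measure X} {p r : ℝ} {f g : X → ℝ} (h : f =ᵐ[m] g) :
    pairEnergy m p f r = pairEnergy m p g r := by
  refine lintegral_congr_ae ?_
  filter_upwards [h] with x hx
  refine lintegral_congr_ae (ae_restrict_of_ae ?_)
  filter_upwards [h] with y hy
  rw [hx, hy]

theorem ofReal_abs_rpow_div {a b p : ℝ} (hp : 0 ≤ p) (hb : 0 < b) :
    ENNReal.ofReal (|a| ^ p / b) = ENNReal.ofReal b⁻¹ * ‖a‖ₑ ^ p := by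
  rw [div_eq_inv_mul, ENNReal.ofReal_mul (inv_nonneg.2 hb.le),
    ← ENNReal.ofReal_rpow_of_nonneg (abs_nonneg _) hp, ← Real.norm_eq_abs, ofReal_norm]

theorem besovEnergy_eq_mul {m : Measure X} {p α r : ℝ} (hp : 1 ≤ p) (hr : 0 < r)
    (f : X →ₘ[m] ℝ) :
    besovEnergy m p α f r = ENNReal.ofReal (r ^ (p * α))⁻¹ * besovEnergy m p 0 f r := by
  have hp0 : 0 ≤ p := by linarith
  unfold besovEnergy
  rw [← lintegral_const_mul' _ _ ENNReal.ofReal_ne_top]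
  refine lintegral_congr fun x => ?_
  rw [mul_left_comm, ← lintegral_const_mul' _ _ ENNReal.ofReal_ne_top]
  congr 1
  refine lintegral_congr fun y => ?_
  rw [ofReal_abs_rpow_div hp0 (Real.rpow_pos_of_pos hr _),
    ofReal_abs_rpow_div hp0 (Real.rpow_pos_of_pos hr _)]
  simp

theorem besovEnergy_zero {m : Measure X} {p r : ℝ} (hp : 1 ≤ p) (f : X →ₘ[m] ℝ) :
    besovEnergy m p 0 f r =
      ∫⁻ x, (m (Metric.ball x r))⁻¹ * ∫⁻ y in Metric.ball x r, ‖f y - f x‖ₑ ^ p ∂m ∂m := by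
  unfold besovEnergy
  refine lintegral_congr fun x => ?_
  congr 1
  refine lintegral_congr fun y => ?_
  have := ofReal_abs_rpow_div (a := f y - f x) (b := 1) (p := p) (by linarith) one_pos
  simpa using this

variable {m : Measure X} {dh c C r₁ p r : ℝ}

namespace VolumeBounds

theorem besovEnergy_le (hV : VolumeBounds m dh c C r₁) (hp : 1 ≤ p) (hr : 0 < r) (hr₁ : r < r₁)
    (f : X →ₘ[m] ℝ) :
    besovEnergy m p 0 f r ≤ ENNReal.ofReal (c * r ^ dh)⁻¹ * pairEnergy m p f r := by
  have hpos : 0 < c * r ^ dh := mul_pos hV.c_pos (Real.rpow_pos_of_pos hr _)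
  rw [besovEnergy_zero hp, pairEnergy, ← lintegral_const_mul' _ _ ENNReal.ofReal_ne_top]
  refine lintegral_mono fun x => ?_
  gcongr
  rw [ENNReal.ofReal_inv_of_pos hpos]
  exact ENNReal.inv_le_inv.2 (hV.le_ball x r hr hr₁)

theorem pairEnergy_le (hV : VolumeBounds m dh c C r₁) (hp : 1 ≤ p) (hr : 0 < r) (hr₁ : r < r₁)
    (f : X →ₘ[m] ℝ) :
    pairEnergy m p f r ≤ ENNReal.ofReal (C * r ^ dh) * besovEnergy m p 0 f r := by
  have hpos : 0 < c * r ^ dh := mul_pos hV.c_pos (Real.rpow_pos_of_pos hr _)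
  rw [besovEnergy_zero hp, pairEnergy, ← lintegral_const_mul' _ _ ENNReal.ofReal_ne_top]
  refine lintegral_mono fun x => ?_
  have h0 : m (Metric.ball x r) ≠ 0 :=
    ((ENNReal.ofReal_pos.2 hpos).trans_le (hV.le_ball x r hr hr₁)).ne'
  have h1 : m (Metric.ball x r) ≠ ∞ := ne_top_of_le_ne_top ENNReal.ofReal_ne_top
    (hV.ball_le x r hr hr₁)
  calc ∫⁻ y in Metric.ball x r, ‖f y - f x‖ₑ ^ p ∂m
      = m (Metric.ball x r) * ((m (Metric.ball x r))⁻¹ *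
          ∫⁻ y in Metric.ball x r, ‖f y - f x‖ₑ ^ p ∂m) := by
        rw [← mul_assoc, ENNReal.mul_inv_cancel h0 h1, one_mul]
    _ ≤ _ := by
        gcongr
        exact hV.ball_le x r hr hr₁

end VolumeBounds

/-- Morrey's inequality along segments. -/
theorem IsAbsGradient.enorm_sub_rpow_le [BorelSpace X] {ι : ℝ} (hX : IsUniformLocalTree X ι) {F G : X → ℝ}
    (h : IsAbsGradient ι F G) (hp : 1 ≤ p) (hrι : r ≤ ι) {x y : X}
    (hxy : dist x y < r) :
    ‖F y - F x‖ₑ ^ p ≤ ENNReal.ofReal r ^ (p - 1) *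
      ∫⁻ z in Metric.ball x r, ‖G z‖ₑ ^ p ∂(lengthMeasure X ι) := by
  obtain ⟨-, hGm, hg⟩ := h
  obtain ⟨g, ⟨hgm, hgu⟩, hgG⟩ := hg x
  have hd : dist x y < ι := hxy.trans_le hrι
  have hsub : openSeg x y ⊆ Metric.ball x r :=
    (openSeg_subset_ball x y).trans (Metric.ball_subset_ball hxy.le)
  have hae : ∀ᵐ z ∂((lengthMeasure X ι).restrict (openSeg x y)), ‖g z‖ₑ = ‖G z‖ₑ := by
    have := ae_restrict_of_ae_restrict_of_subset
      (hsub.trans (Metric.ball_subset_ball hrι)) hgG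
    filter_upwards [this] with z hz
    rw [hz]
    simp
  rw [(hgu y (by rwa [Metric.mem_ball, dist_comm])).2]
  calc ‖∫ z in openSeg x y, g z ∂(lengthMeasure X ι)‖ₑ ^ p
      ≤ (∫⁻ z in openSeg x y, ‖G z‖ₑ ∂(lengthMeasure X ι)) ^ p := by
        refine ENNReal.rpow_le_rpow ?_ (by linarith)
        rw [← lintegral_congr_ae hae]
        exact enorm_integral_le_lintegral_enorm _
    _ ≤ (((lengthMeasure X ι).restrict (openSeg x y)) univ) ^ (p - 1) *
          ∫⁻ z in openSeg x y, ‖G z‖ₑ ^ p ∂(lengthMeasure X ι) :=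
        rpow_lintegral_le hGm.enorm.aemeasurable hp
    _ ≤ _ := by
        rw [Measure.restrict_apply_univ, lengthMeasure_openSeg hX hd]
        have hp1 : 0 ≤ p - 1 := by linarith
        gcongr

/-! ### Tonelli on balls and the `L^p` bound for the energy -/

variable [BorelSpace X] [SecondCountableTopology X]

/-- Both sides are the product measure of the symmetric set `{dist x y < r}`. -/
theorem lintegral_measure_ball_comm (μ ν : Measure X) [SFinite μ] [SFinite ν] (r : ℝ) :
    ∫⁻ x, μ (Metric.ball x r) ∂ν = ∫⁻ y, ν (Metric.ball y r) ∂μ := by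
  have hs : MeasurableSet {q : X × X | dist q.1 q.2 < r} :=
    (isOpen_lt (by fun_prop) (by fun_prop)).measurableSet
  calc ∫⁻ x, μ (Metric.ball x r) ∂ν = (ν.prod μ) {q : X × X | dist q.1 q.2 < r} := by
        rw [Measure.prod_apply hs]
        refine lintegral_congr fun x => ?_
        congr 1
        ext y
        simp [dist_comm]
    _ = _ := by
        rw [Measure.prod_apply_symm hs]
        rfl

variable [SFinite m]

theorem measurable_measure_ball (μ : Measure X) [SFinite μ] (r : ℝ) :
    Measurable fun x => μ (Metric.ball x r) := by
  have hs : MeasurableSet {q : X × X | dist q.1 q.2 < r} :=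
    (isOpen_lt (by fun_prop) (by fun_prop)).measurableSet
  convert measurable_measure_prodMk_left (ν := μ) hs using 3
  ext y
  simp [dist_comm]

theorem measurable_setLIntegral_ball_sub (p r : ℝ) {f : X → ℝ} (hf : Measurable f) :
    Measurable fun x => ∫⁻ y in Metric.ball x r, ‖f y - f x‖ₑ ^ p ∂m := by
  have hs : MeasurableSet {q : X × X | dist q.1 q.2 < r} :=
    (isOpen_lt (by fun_prop) (by fun_prop)).measurableSet
  have : Measurable fun q : X × X =>
      {q : X × X | dist q.1 q.2 < r}.indicator (fun q => ‖f q.2 - f q.1‖ₑ ^ p) q :=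
    ((((hf.comp measurable_snd).sub
      (hf.comp measurable_fst)).enorm).pow_const p).indicator hs
  convert this.lintegral_prod_right' (ν := m) using 2 with x
  rw [← lintegral_indicator Metric.isOpen_ball.measurableSet]
  refine lintegral_congr fun y => ?_
  by_cases h : dist x y < r <;> simp [indicator, dist_comm, h]

theorem VolumeBounds.lintegral_ball_le (hV : VolumeBounds m dh c C r₁) (hr : 0 < r)
    (hr₁ : r < r₁) (μ : Measure X) [SFinite μ] :
    ∫⁻ x, μ (Metric.ball x r) ∂m ≤ ENNReal.ofReal (C * r ^ dh) * μ univ := by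
  rw [lintegral_measure_ball_comm, ← lintegral_const]
  exact lintegral_mono fun x => hV.ball_le x r hr hr₁

theorem enorm_sub_rpow_le {a b : ℝ} (hp : 1 ≤ p) :
    ‖a - b‖ₑ ^ p ≤ 2 ^ (p - 1) * (‖a‖ₑ ^ p + ‖b‖ₑ ^ p) :=
  (ENNReal.rpow_le_rpow enorm_sub_le (by linarith)).trans
    (ENNReal.rpow_add_le_mul_rpow_add_rpow _ _ hp)

theorem two_rpow_ne_top (p : ℝ) : (2 : ℝ≥0∞) ^ p ≠ ∞ := by
  rw [show (2 : ℝ≥0∞) = ENNReal.ofReal 2 by simp, ENNReal.ofReal_rpow_of_pos two_pos]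
  exact ENNReal.ofReal_ne_top

theorem two_rpow_sub_one_mul_two (p : ℝ) : (2 : ℝ≥0∞) ^ (p - 1) * 2 = 2 ^ p := by
  nth_rewrite 2 [← ENNReal.rpow_one 2]
  rw [← ENNReal.rpow_add _ _ two_ne_zero ENNReal.ofNat_ne_top, sub_add_cancel]

theorem VolumeBounds.pairEnergy_le_lintegral (hV : VolumeBounds m dh c C r₁) (hp : 1 ≤ p)
    (hr : 0 < r) (hr₁ : r < r₁) {g : X → ℝ} (hg : Measurable g) :
    pairEnergy m p g r ≤
      2 ^ p * (ENNReal.ofReal (C * r ^ dh) * ∫⁻ x, ‖g x‖ₑ ^ p ∂m) := by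
  have hgm : Measurable fun x => ‖g x‖ₑ ^ p := hg.enorm.pow_const p
  have hd : ∀ x, ∫⁻ y in Metric.ball x r, ‖g y‖ₑ ^ p ∂m =
      (m.withDensity fun y => ‖g y‖ₑ ^ p) (Metric.ball x r) := fun x =>
    (withDensity_apply _ Metric.isOpen_ball.measurableSet).symm
  have h1 : ∫⁻ x, ∫⁻ y in Metric.ball x r, ‖g y‖ₑ ^ p ∂m ∂m ≤
      ENNReal.ofReal (C * r ^ dh) * ∫⁻ x, ‖g x‖ₑ ^ p ∂m := by
    simp only [hd]
    refine (hV.lintegral_ball_le hr hr₁ _).trans_eq ?_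
    rw [withDensity_apply _ MeasurableSet.univ, Measure.restrict_univ]
  have h2 : ∫⁻ x, ‖g x‖ₑ ^ p * m (Metric.ball x r) ∂m ≤
      ENNReal.ofReal (C * r ^ dh) * ∫⁻ x, ‖g x‖ₑ ^ p ∂m := by
    rw [← lintegral_const_mul' _ _ ENNReal.ofReal_ne_top]
    refine lintegral_mono fun x => ?_
    rw [mul_comm]
    gcongr
    exact hV.ball_le x r hr hr₁
  have hm1 : Measurable fun x => ∫⁻ y in Metric.ball x r, ‖g y‖ₑ ^ p ∂m := by
    simp only [hd]
    exact measurable_measure_ball _ r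
  calc pairEnergy m p g r
      ≤ ∫⁻ x, 2 ^ (p - 1) * (∫⁻ y in Metric.ball x r, ‖g y‖ₑ ^ p ∂m +
          ‖g x‖ₑ ^ p * m (Metric.ball x r)) ∂m := by
        refine lintegral_mono fun x => ?_
        calc ∫⁻ y in Metric.ball x r, ‖g y - g x‖ₑ ^ p ∂m
            ≤ ∫⁻ y in Metric.ball x r, 2 ^ (p - 1) * (‖g y‖ₑ ^ p + ‖g x‖ₑ ^ p) ∂m :=
              lintegral_mono fun y => enorm_sub_rpow_le hp
          _ = _ := by
              rw [lintegral_const_mul' _ _ (two_rpow_ne_top _), lintegral_add_left hgm]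
              simp
    _ = 2 ^ (p - 1) * (∫⁻ x, ∫⁻ y in Metric.ball x r, ‖g y‖ₑ ^ p ∂m ∂m +
          ∫⁻ x, ‖g x‖ₑ ^ p * m (Metric.ball x r) ∂m) := by
        rw [lintegral_const_mul' _ _ (two_rpow_ne_top _), lintegral_add_left hm1]
    _ ≤ 2 ^ (p - 1) * (ENNReal.ofReal (C * r ^ dh) * ∫⁻ x, ‖g x‖ₑ ^ p ∂m +
          ENNReal.ofReal (C * r ^ dh) * ∫⁻ x, ‖g x‖ₑ ^ p ∂m) := by
        gcongr
    _ = _ := by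
        rw [← two_mul, ← mul_assoc, two_rpow_sub_one_mul_two]

theorem VolumeBounds.besovEnergy_le_lpNorm (hV : VolumeBounds m dh c C r₁) (hp : 1 ≤ p)
    (hr : 0 < r) (hr₁ : r < r₁) (g : X →ₘ[m] ℝ) :
    besovEnergy m p 0 g r ≤ ENNReal.ofReal (2 ^ p * (C / c)) * lpNorm m p g ^ p := by
  have hc := hV.c_pos
  have hC := hV.C_pos
  have hrd : 0 < r ^ dh := Real.rpow_pos_of_pos hr _
  refine (hV.besovEnergy_le hp hr hr₁ g).trans ?_
  rw [lpNorm_rpow hp]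
  refine (mul_le_mul_right (hV.pairEnergy_le_lintegral hp hr hr₁ g.measurable) _).trans_eq ?_
  rw [show (2 : ℝ≥0∞) = ENNReal.ofReal 2 by simp, ENNReal.ofReal_rpow_of_pos two_pos, ← mul_assoc,
    ← mul_assoc, ← ENNReal.ofReal_mul (by positivity), ← ENNReal.ofReal_mul (by positivity)]
  congr 2
  field_simp

/-! ### The energy of absolutely continuous functions -/

variable {ι : ℝ}

/-- The Morrey bound does not depend on the position of `y` in the ball, so integration in `y`
contributes one volume factor; exchanging the order of integration in `x` and the point of the
skeleton contributes the other. -/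
theorem VolumeBounds.pairEnergy_le_gradient (hX : IsUniformLocalTree X ι)
    (hV : VolumeBounds m dh c C r₁) {F G : X → ℝ} (h : IsAbsGradient ι F G) (hp : 1 ≤ p)
    (hr : 0 < r) (hrι : r ≤ ι) (hr₁ : r < r₁) :
    pairEnergy m p F r ≤ ENNReal.ofReal r ^ (p - 1) * ENNReal.ofReal (C * r ^ dh) *
      ENNReal.ofReal (C * r ^ dh) * ∫⁻ z, ‖G z‖ₑ ^ p ∂(lengthMeasure X ι) := by
  have hC := hV.C_pos
  have hrd : 0 < C * r ^ dh := mul_pos hC (Real.rpow_pos_of_pos hr _)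
  have hr0 : ENNReal.ofReal r ^ (p - 1) ≠ 0 := by simp [hr]
  -- Tonelli is applied to the weighted length measure `|G|^p ν`, which is finite unless the bound
  -- is trivial.
  by_cases hfin : ∫⁻ z, ‖G z‖ₑ ^ p ∂(lengthMeasure X ι) = ∞
  · rw [hfin, ENNReal.mul_top]
    · exact le_top
    · simp only [ne_eq, mul_eq_zero, hr0, ENNReal.ofReal_eq_zero, not_le.2 hrd, or_self,
        not_false_eq_true]
  set μ := (lengthMeasure X ι).withDensity fun z => ‖G z‖ₑ ^ p with hμ
  have : IsFiniteMeasure μ := isFiniteMeasure_withDensity hfin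
  have hrt : ENNReal.ofReal r ^ (p - 1) ≠ ∞ :=
    ENNReal.rpow_ne_top_of_nonneg (by linarith) ENNReal.ofReal_ne_top
  calc pairEnergy m p F r
      ≤ ∫⁻ x, ENNReal.ofReal r ^ (p - 1) * ENNReal.ofReal (C * r ^ dh) *
          μ (Metric.ball x r) ∂m := by
        refine lintegral_mono fun x => ?_
        calc ∫⁻ y in Metric.ball x r, ‖F y - F x‖ₑ ^ p ∂m
            ≤ ∫⁻ y in Metric.ball x r, ENNReal.ofReal r ^ (p - 1) * μ (Metric.ball x r) ∂m := by
              refine setLIntegral_mono' Metric.isOpen_ball.measurableSet fun y hy => ?_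
              rw [hμ, withDensity_apply _ Metric.isOpen_ball.measurableSet]
              exact h.enorm_sub_rpow_le hX hp hrι (by rwa [Metric.mem_ball, dist_comm] at hy)
          _ = ENNReal.ofReal r ^ (p - 1) * m (Metric.ball x r) * μ (Metric.ball x r) := by
              rw [lintegral_const, Measure.restrict_apply_univ]
              ring
          _ ≤ _ := by
              gcongr
              exact hV.ball_le x r hr hr₁
    _ = ENNReal.ofReal r ^ (p - 1) * ENNReal.ofReal (C * r ^ dh) *
          ∫⁻ x, μ (Metric.ball x r) ∂m :=
        lintegral_const_mul' _ _ (ENNReal.mul_ne_top hrt ENNReal.ofReal_ne_top)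
    _ ≤ ENNReal.ofReal r ^ (p - 1) * ENNReal.ofReal (C * r ^ dh) *
          (ENNReal.ofReal (C * r ^ dh) * μ univ) := by
        gcongr
        exact hV.lintegral_ball_le hr hr₁ μ
    _ = _ := by
        rw [hμ, withDensity_apply _ MeasurableSet.univ, Measure.restrict_univ, ← mul_assoc]

/-- The origin of the critical exponent: `r ^ (p - 1)` comes from Hölder along segments, and `r ^
dh` is the volume factor that survives the normalization by `m (B(x, r))`. -/
theorem rpow_mul_alphaCrit (hp : 1 ≤ p) (hr : 0 < r) :
    (r ^ alphaCrit dh p) ^ p = r ^ (p - 1) * r ^ dh := by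
  have hp0 : p ≠ 0 := by linarith
  rw [← Real.rpow_mul hr.le, ← Real.rpow_add hr]
  congr 1
  unfold alphaCrit
  field_simp
  ring

theorem VolumeBounds.besovEnergy_le_gradNorm (hX : IsUniformLocalTree X ι)
    (hV : VolumeBounds m dh c C r₁) (hp : 1 ≤ p)
    (hr : 0 < r) (hrι : r ≤ ι) (hr₁ : r < r₁) (h : X →ₘ[m] ℝ) :
    besovEnergy m p 0 h r ≤ ENNReal.ofReal (C ^ 2 / c) *
      (ENNReal.ofReal (r ^ alphaCrit dh p) * gradNorm ι m p h) ^ p := by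
  have hc := hV.c_pos
  have hC := hV.C_pos
  have hrd : 0 < r ^ dh := Real.rpow_pos_of_pos hr _
  have hp0 : 0 < p := by linarith
  have key : ∀ F G : X → ℝ, h =ᵐ[m] F → IsAbsGradient ι F G →
      besovEnergy m p 0 h r ≤ ENNReal.ofReal (C ^ 2 / c) *
        (ENNReal.ofReal (r ^ alphaCrit dh p) *
          eLpNorm G (ENNReal.ofReal p) (lengthMeasure X ι)) ^ p := by
    intro F G hF hG
    refine (hV.besovEnergy_le hp hr hr₁ h).trans ?_
    rw [pairEnergy_congr hF, ENNReal.mul_rpow_of_nonneg _ _ hp0.le, eLpNorm_rpow hp,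
      ENNReal.ofReal_rpow_of_nonneg (by positivity) hp0.le, rpow_mul_alphaCrit hp hr]
    refine (mul_le_mul_right (hV.pairEnergy_le_gradient hX hG hp hr hrι hr₁) _).trans_eq ?_
    rw [ENNReal.ofReal_rpow_of_pos hr, ← mul_assoc, ← mul_assoc,
      ← mul_assoc, ← mul_assoc,
      ← ENNReal.ofReal_mul (by positivity), ← ENNReal.ofReal_mul (by positivity),
      ← ENNReal.ofReal_mul (by positivity), ← ENNReal.ofReal_mul (by positivity)]
    congr 2
    field_simp
  -- pass to the infimum
  have hK : ENNReal.ofReal (C ^ 2 / c) ≠ 0 := by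
    rw [Ne, ENNReal.ofReal_eq_zero, not_le]
    positivity
  have hR : ENNReal.ofReal (r ^ alphaCrit dh p) ≠ 0 := by
    rw [Ne, ENNReal.ofReal_eq_zero, not_le]
    exact Real.rpow_pos_of_pos hr _
  -- `gradNorm` is an infimum, so the estimate is solved for the norm `N` and becomes a lower bound
  -- that does not depend on the representatives.
  have inv : ∀ N : ℝ≥0∞, besovEnergy m p 0 h r ≤ ENNReal.ofReal (C ^ 2 / c) *
        (ENNReal.ofReal (r ^ alphaCrit dh p) * N) ^ p ↔
      (besovEnergy m p 0 h r / ENNReal.ofReal (C ^ 2 / c)) ^ (1 / p) /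
        ENNReal.ofReal (r ^ alphaCrit dh p) ≤ N := by
    intro N
    rw [ENNReal.div_le_iff' hR ENNReal.ofReal_ne_top, one_div, ENNReal.rpow_inv_le_iff hp0,
      ENNReal.div_le_iff' hK ENNReal.ofReal_ne_top]
  rw [inv, gradNorm]
  refine le_iInf fun F => le_iInf fun G => le_iInf fun hF => le_iInf fun hG => ?_
  exact (inv _).1 (key F G hF hG)

theorem besovEnergy_add_le (hp : 1 ≤ p) (f g : X →ₘ[m] ℝ) :
    besovEnergy m p 0 (f + g) r ≤
      2 ^ (p - 1) * (besovEnergy m p 0 f r + besovEnergy m p 0 g r) := by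
  have hball := measurable_measure_ball m r
  have hin := measurable_setLIntegral_ball_sub (m := m) p r f.measurable
  have hm : Measurable fun x => (m (Metric.ball x r))⁻¹ *
      ∫⁻ y in Metric.ball x r, ‖f y - f x‖ₑ ^ p ∂m := hball.inv.mul hin
  rw [besovEnergy_zero hp, besovEnergy_zero hp, besovEnergy_zero hp,
    ← lintegral_add_left hm, ← lintegral_const_mul' _ _ (two_rpow_ne_top _)]
  refine lintegral_mono_ae ?_
  filter_upwards [AEEqFun.coeFn_add f g] with x hx
  rw [← mul_add, mul_left_comm]
  gcongr
  rw [← lintegral_add_left (by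
      exact ((f.measurable.sub measurable_const).enorm).pow_const p),
    ← lintegral_const_mul' _ _ (two_rpow_ne_top _)]
  refine lintegral_mono_ae (ae_restrict_of_ae ?_)
  filter_upwards [AEEqFun.coeFn_add f g] with y hy
  rw [hx, hy, Pi.add_apply, Pi.add_apply]
  have : f y + g y - (f x + g x) = (f y - f x) - (g x - g y) := by ring
  rw [this, enorm_sub_rev (g y) (g x)]
  exact LocalTree.enorm_sub_rpow_le hp

end Energy

/-! ### Sums with few nonzero terms -/

theorem tsum_le_of_support {α : Type*} {f : α → ℝ≥0∞} {T : Set α} {N : ℕ} {M : ℝ≥0∞}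
    (hT : T.encard ≤ N) (h0 : ∀ i, i ∉ T → f i = 0) (hM : ∀ i, f i ≤ M) :
    ∑' i, f i ≤ N * M := by
  have hfin := finite_of_encard_le_coe hT
  rw [tsum_eq_sum (s := hfin.toFinset) fun i hi => h0 i (by simpa using hi)]
  refine (Finset.sum_le_card_nsmul _ _ M fun i _ => hM i).trans ?_
  rw [nsmul_eq_mul]
  gcongr
  rw [hfin.encard_eq_coe_toFinset_card] at hT
  exact_mod_cast hT

theorem tsum_rpow_le_of_support {α : Type*} {f : α → ℝ≥0∞} {T : Set α} {N : ℕ} {p : ℝ}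
    (hp : 1 ≤ p) (hT : T.encard ≤ N) (h0 : ∀ i, i ∉ T → f i = 0) :
    (∑' i, f i) ^ p ≤ (N : ℝ≥0∞) ^ (p - 1) * ∑' i, f i ^ p := by
  have hfin := finite_of_encard_le_coe hT
  rw [tsum_eq_sum (s := hfin.toFinset) fun i hi => h0 i (by simpa using hi)]
  refine (ENNReal.rpow_sum_le_const_mul_sum_rpow _ _ hp).trans ?_
  have hp1 : 0 ≤ p - 1 := by linarith
  rw [hfin.encard_eq_coe_toFinset_card] at hT
  gcongr
  · exact_mod_cast hT
  · exact ENNReal.sum_le_tsum _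

/-! ### Nets -/

/-- `A` is a maximal `δ`-separated set. -/
structure IsNet {X : Type*} [MetricSpace X] (A : Set X) (δ : ℝ) : Prop where
  separated : ∀ a ∈ A, ∀ b ∈ A, a ≠ b → δ ≤ dist a b
  exists_near : ∀ x, ∃ a ∈ A, dist a x < δ

/-- By Zorn's lemma there is a maximal separated set; a point with no neighbour in it at distance
less than `δ` could be added. -/
theorem exists_isNet (X : Type*) [MetricSpace X] {δ : ℝ} (hδ : 0 < δ) :
    ∃ A : Set X, IsNet A δ := by
  obtain ⟨A, hA⟩ := zorn_subset {A : Set X | ∀ a ∈ A, ∀ b ∈ A, a ≠ b → δ ≤ dist a b} (by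
    intro c hc hchain
    refine ⟨⋃₀ c, ?_, fun s hs => subset_sUnion_of_mem hs⟩
    rintro a ⟨s, hs, has⟩ b ⟨t, ht, hbt⟩ hab
    rcases hchain.total hs ht with h | h
    · exact hc ht a (h has) b hbt hab
    · exact hc hs a has b (h hbt) hab)
  refine ⟨A, hA.prop, fun x => ?_⟩
  by_contra! hx
  have hmem : insert x A ∈ {A : Set X | ∀ a ∈ A, ∀ b ∈ A, a ≠ b → δ ≤ dist a b} := by
    rintro a (rfl | ha) b (rfl | hb) hab
    · exact absurd rfl hab
    · rw [dist_comm]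
      exact hx b hb
    · exact hx a ha
    · exact hA.prop a ha b hb hab
  have hxA : x ∈ A := hA.le_of_ge hmem (subset_insert x A) (mem_insert x A)
  have := hx x hxA
  rw [dist_self] at this
  linarith

/-- A bound for the number of points of a `δ`-net in a ball of radius `19 δ`. -/
noncomputable def overlapBound (c C dh : ℝ) : ℕ := ⌈C / c * 40 ^ dh⌉₊

section Nets

variable {X : Type*} [MetricSpace X] {A : Set X} {δ : ℝ}

theorem IsNet.pairwiseDisjoint_ball (hA : IsNet A δ) :
    A.PairwiseDisjoint fun a => Metric.ball a (δ / 2) := fun a ha b hb hab =>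
  Metric.ball_disjoint_ball (by linarith [hA.separated a ha b hb hab])

theorem IsNet.countable [TopologicalSpace.SeparableSpace X] (hA : IsNet A δ) (hδ : 0 < δ) :
    A.Countable :=
  hA.pairwiseDisjoint_ball.countable_of_isOpen (fun _ _ => Metric.isOpen_ball)
    fun a _ => ⟨a, Metric.mem_ball_self (by linarith)⟩

variable [MeasurableSpace X] [BorelSpace X] {m : Measure X} {dh c C r₁ : ℝ}

/-- The balls of radius `δ / 2` around the net points are disjoint, lie in `B(x, 20 δ)` and have
volume at least `c (δ / 2) ^ dh`. Comparing volumes leaves the ratio `(20 δ) / (δ / 2) = 40` and no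
dependence on `δ`. -/
theorem IsNet.encard_le (hA : IsNet A δ) (hV : VolumeBounds m dh c C r₁) (hδ : 0 < δ)
    (hδ₁ : 20 * δ < r₁) (x : X) :
    {a : A | dist (a : X) x < 19 * δ}.encard ≤ overlapBound c C dh := by
  have hc := hV.c_pos
  have hC := hV.C_pos
  have hcard : ∀ F : Finset X, (∀ a ∈ F, a ∈ A ∧ dist a x < 19 * δ) →
      F.card ≤ overlapBound c C dh := by
    intro F hF
    have h1 : (F.card : ℝ≥0∞) * ENNReal.ofReal (c * (δ / 2) ^ dh) ≤
        ENNReal.ofReal (C * (20 * δ) ^ dh) := by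
      calc (F.card : ℝ≥0∞) * ENNReal.ofReal (c * (δ / 2) ^ dh)
          = ∑ a ∈ F, ENNReal.ofReal (c * (δ / 2) ^ dh) := by simp
        _ ≤ ∑ a ∈ F, m (Metric.ball a (δ / 2)) :=
            Finset.sum_le_sum fun a _ => hV.le_ball a _ (by linarith) (by linarith)
        _ = m (⋃ a ∈ F, Metric.ball a (δ / 2)) := by
            rw [measure_biUnion_finset (fun a ha b hb hab =>
              hA.pairwiseDisjoint_ball (hF a ha).1 (hF b hb).1 hab)
              fun a _ => Metric.isOpen_ball.measurableSet]
        _ ≤ m (Metric.ball x (20 * δ)) := by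
            refine measure_mono (iUnion₂_subset fun a ha => Metric.ball_subset_ball' ?_)
            linarith [(hF a ha).2]
        _ ≤ _ := hV.ball_le x _ (by linarith) hδ₁
    have hδd : 0 < (δ / 2) ^ dh := Real.rpow_pos_of_pos (by linarith) _
    rw [← ENNReal.ofReal_natCast, ← ENNReal.ofReal_mul (by positivity),
      ENNReal.ofReal_le_ofReal_iff (by positivity)] at h1
    have h2 : (20 * δ) ^ dh = 40 ^ dh * (δ / 2) ^ dh := by
      rw [← Real.mul_rpow (by norm_num) (by linarith)]
      congr 1
      ring
    have h3 : (F.card : ℝ) ≤ C / c * 40 ^ dh := by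
      rw [h2] at h1
      rw [div_mul_eq_mul_div, le_div_iff₀ hc]
      refine le_of_mul_le_mul_right ?_ hδd
      linarith
    exact_mod_cast h3.trans (Nat.le_ceil _)
  by_contra! hlt
  have hlt' : ((overlapBound c C dh + 1 : ℕ) : ℕ∞) ≤
      {a : A | dist (a : X) x < 19 * δ}.encard := by
    push_cast
    exact Order.add_one_le_of_lt hlt
  obtain ⟨t, ht, htc⟩ := exists_subset_encard_eq hlt'
  have htf : t.Finite := finite_of_encard_eq_coe htc
  have h1 := hcard (htf.toFinset.map ⟨Subtype.val, Subtype.val_injective⟩) (by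
    intro a ha
    simp only [Finset.mem_map, Finite.mem_toFinset, Function.Embedding.coeFn_mk] at ha
    obtain ⟨b, hb, rfl⟩ := ha
    exact ⟨b.2, ht hb⟩)
  rw [Finset.card_map] at h1
  rw [htf.encard_eq_coe_toFinset_card] at htc
  have : htf.toFinset.card = overlapBound c C dh + 1 := by exact_mod_cast htc
  omega

theorem IsNet.encard_le_of_subset (hA : IsNet A δ) (hV : VolumeBounds m dh c C r₁) (hδ : 0 < δ)
    (hδ₁ : 20 * δ < r₁) {x : X} {ρ : ℝ} (hρ : ρ ≤ 19 * δ) :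
    {a : A | dist (a : X) x < ρ}.encard ≤ overlapBound c C dh :=
  (encard_le_encard fun _ ha => lt_of_lt_of_le ha hρ).trans (hA.encard_le hV hδ hδ₁ x)

theorem IsNet.finite (hA : IsNet A δ) (hV : VolumeBounds m dh c C r₁) (hδ : 0 < δ)
    (hδ₁ : 20 * δ < r₁) (x : X) {ρ : ℝ} (hρ : ρ ≤ 19 * δ) :
    {a : A | dist (a : X) x < ρ}.Finite :=
  finite_of_encard_le_coe (hA.encard_le_of_subset hV hδ hδ₁ hρ)

/-- Balls around the points of a net overlap boundedly. -/
theorem IsNet.tsum_setLIntegral_le [Countable A] (hA : IsNet A δ)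
    (hV : VolumeBounds m dh c C r₁) (hδ : 0 < δ) (hδ₁ : 20 * δ < r₁) {H : X → ℝ≥0∞}
    (hH : Measurable H) :
    ∑' a : A, ∫⁻ y in Metric.ball (a : X) δ, H y ∂m ≤ overlapBound c C dh * ∫⁻ y, H y ∂m := by
  have : ∀ a : A, ∫⁻ y in Metric.ball (a : X) δ, H y ∂m =
      ∫⁻ y, (Metric.ball (a : X) δ).indicator H y ∂m := fun a =>
    (lintegral_indicator Metric.isOpen_ball.measurableSet _).symm
  simp only [this]
  rw [← lintegral_tsum fun a => (hH.indicator Metric.isOpen_ball.measurableSet).aemeasurable,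
    ← lintegral_const_mul _ hH]
  refine lintegral_mono fun y => ?_
  refine tsum_le_of_support (hA.encard_le_of_subset hV hδ hδ₁ (x := y) (ρ := δ) (by linarith))
    (fun a ha => indicator_of_notMem (fun h => ha ?_) _) fun a => indicator_le_self _ _ _
  rw [mem_ofPred_eq, dist_comm]
  exact h

end Nets

/-! ### Cutoff functions constant off a finite union of segments -/

section Cutoff

variable {X : Type*} [MetricSpace X] {A : Set X} {δ ι : ℝ}

/-- The distance from `a`, measured along the segments from `a` to the nearby points of `A`. -/
noncomputable def trimDist (A : Set X) (δ : ℝ) (a x : X) : ℝ :=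
  ⨆ b : {b : A // dist (b : X) a < 8 * δ}, gromov a (b : A) x

/-- The union of the segments from `a` to the nearby points of `A`. -/
def star (A : Set X) (δ : ℝ) (a : X) : Set X :=
  ⋃ b : {b : A // dist (b : X) a < 8 * δ}, mseg a (b : A)

open scoped Classical in
/-- A cutoff function at scale `δ` around `a`, which is constant off `star A δ a`. -/
noncomputable def cutoff (A : Set X) (δ : ℝ) (a x : X) : ℝ :=
  if dist a x < 5 * δ then max 0 (min 1 (2 - trimDist A δ a x / δ)) else 0

theorem bddAbove_gromov (a x : X) :
    BddAbove (range fun b : {b : A // dist (b : X) a < 8 * δ} => gromov a (b : A) x) :=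
  ⟨dist a x, by
    rintro _ ⟨b, rfl⟩
    exact gromov_le _ _ _⟩

theorem trimDist_le (hδ : 0 < δ) {a : X} (ha : a ∈ A) (x : X) : trimDist A δ a x ≤ dist a x := by
  have : Nonempty {b : A // dist (b : X) a < 8 * δ} := ⟨⟨⟨a, ha⟩, by simpa using hδ⟩⟩
  exact ciSup_le fun b => gromov_le _ _ _

/-- Testing with a net point `b` within `δ` of `x`: it lies within `8 δ` of `a`, and `(x|b)_a ≥ dist
a x - dist b x`. Trimming thus costs less than one mesh size. -/
theorem IsNet.sub_lt_trimDist (hA : IsNet A δ) {a x : X} (hx : dist a x < 7 * δ) :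
    dist a x - δ < trimDist A δ a x := by
  obtain ⟨b, hb, hbx⟩ := hA.exists_near x
  have hba : dist b a < 8 * δ := by
    have := dist_triangle b x a
    rw [dist_comm x a] at this
    linarith
  have h1 := le_ciSup (bddAbove_gromov a x)
    (⟨⟨b, hb⟩, hba⟩ : {b : A // dist (b : X) a < 8 * δ})
  have h2 := sub_dist_le_gromov a b x
  unfold trimDist
  exact lt_of_lt_of_le (by linarith) h1

theorem isClosed_star_of_finite {a : X} (h : {b : A | dist (b : X) a < 8 * δ}.Finite) :
    IsClosed (star A δ a) := by
  have : Finite {b : A // dist (b : X) a < 8 * δ} := h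
  exact isClosed_iUnion_of_finite fun b => isClosed_mseg _ _

theorem dist_lt_of_mem_star {a z : X} (hz : z ∈ star A δ a) : dist a z < 8 * δ := by
  obtain ⟨b, hb⟩ := mem_iUnion.1 hz
  refine (dist_left_mem_Icc hb).2.trans_lt ?_
  rw [dist_comm]
  exact b.2

theorem cutoff_nonneg (a x : X) : 0 ≤ cutoff A δ a x := by
  unfold cutoff
  split_ifs
  · exact le_max_left _ _
  · exact le_rfl

theorem cutoff_eq_one (hδ : 0 < δ) {a x : X} (ha : a ∈ A) (hx : dist a x < δ) :
    cutoff A δ a x = 1 := by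
  have h1 := trimDist_le hδ ha x
  have h2 : trimDist A δ a x / δ ≤ 1 := by
    rw [div_le_one hδ]
    linarith
  rw [cutoff, if_pos (by linarith), min_eq_left (by linarith), max_eq_right zero_le_one]

/-- From distance `3 δ` to `5 δ` the trimmed distance already exceeds `2 δ`, so the formula gives
zero before the truncation at `5 δ` sets in, and the truncation creates no jump. -/
theorem IsNet.dist_lt_of_cutoff_ne_zero (hA : IsNet A δ) (hδ : 0 < δ) {a x : X}
    (h : cutoff A δ a x ≠ 0) : dist a x < 3 * δ := by
  by_contra! hx
  apply h
  unfold cutoff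
  split_ifs with h5
  · have h1 := hA.sub_lt_trimDist (a := a) (x := x) (by linarith)
    have h2 : 2 ≤ trimDist A δ a x / δ := by
      rw [le_div_iff₀ hδ]
      linarith
    exact max_eq_left ((min_le_right _ _).trans (by linarith))
  · rfl

/-- If one of the two values is nonzero, both points are within `4 δ` of `a`; both values are then
given by the same `δ⁻¹`-Lipschitz function of the trimmed distance. -/
theorem IsNet.abs_cutoff_sub_le (hA : IsNet A δ) (hδ : 0 < δ) {a x u : X}
    (hxu : dist x u < δ) :
    |cutoff A δ a x - cutoff A δ a u| ≤ δ⁻¹ * |trimDist A δ a x - trimDist A δ a u| := by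
  by_cases h0 : cutoff A δ a x = 0 ∧ cutoff A δ a u = 0
  · rw [h0.1, h0.2, sub_self, abs_zero]
    positivity
  have h4 : dist a x < 4 * δ ∧ dist a u < 4 * δ := by
    have t1 := dist_triangle a x u
    have t2 := dist_triangle_right a x u
    rw [not_and_or] at h0
    rcases h0 with h | h
    · have := hA.dist_lt_of_cutoff_ne_zero hδ h
      constructor <;> linarith
    · have := hA.dist_lt_of_cutoff_ne_zero hδ h
      constructor <;> linarith
  unfold cutoff
  rw [if_pos (by linarith [h4.1]), if_pos (by linarith [h4.2])]
  refine (abs_max_sub_max_le_max _ _ _ _).trans (max_le (by rw [sub_self, abs_zero]; positivity) ?_)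
  refine (abs_min_sub_min_le_max _ _ _ _).trans (max_le (by rw [sub_self, abs_zero]; positivity) ?_)
  rw [← abs_of_pos (inv_pos.2 hδ), ← abs_mul, abs_sub_comm]
  refine le_of_eq ?_
  congr 1
  ring

variable [MeasurableSpace X] [BorelSpace X]

/-- Each Gromov product varies by at most the length of `]x,u[` inside its own segment, hence inside
the star; a supremum inherits a common bound on variations. -/
theorem IsUniformLocalTree.abs_trimDist_sub_le (hX : IsUniformLocalTree X ι) (hδ : 0 < δ)
    (hδι : 20 * δ < ι) {a x u : X} (ha : a ∈ A) (hx : dist a x + dist x u < ι) :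
    ENNReal.ofReal |trimDist A δ a x - trimDist A δ a u| ≤
      lengthMeasure X ι (openSeg x u ∩ star A δ a) := by
  have : Nonempty {b : A // dist (b : X) a < 8 * δ} := ⟨⟨⟨a, ha⟩, by simpa using hδ⟩⟩
  have hd : dist x u < ι := by linarith [dist_nonneg (x := a) (y := x)]
  set K := lengthMeasure X ι (openSeg x u ∩ star A δ a) with hK
  have hKtop : K ≠ ∞ := by
    refine ne_top_of_le_ne_top ?_ (measure_mono inter_subset_left)
    rw [lengthMeasure_openSeg hX hd]
    exact ENNReal.ofReal_ne_top
  have hb : ∀ b : {b : A // dist (b : X) a < 8 * δ},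
      |gromov a (b : A) x - gromov a (b : A) u| ≤ K.toReal := by
    intro b
    rw [← ENNReal.ofReal_le_iff_le_toReal hKtop]
    refine (hX.abs_gromov_sub_le (o := a) (by simpa using hX.pos) ?_ hx).trans
      (measure_mono (inter_subset_inter_right _ ?_))
    · have := b.2
      rw [dist_comm] at this
      linarith
    · exact subset_iUnion (fun b : {b : A // dist (b : X) a < 8 * δ} => mseg a (b : A)) b
  rw [ENNReal.ofReal_le_iff_le_toReal hKtop, abs_sub_le_iff]
  unfold trimDist
  constructor
  · rw [sub_le_iff_le_add]
    refine ciSup_le fun b => ?_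
    linarith [le_ciSup (bddAbove_gromov a u) b, (abs_sub_le_iff.1 (hb b)).1]
  · rw [sub_le_iff_le_add]
    refine ciSup_le fun b => ?_
    linarith [le_ciSup (bddAbove_gromov a x) b, (abs_sub_le_iff.1 (hb b)).2]

theorem IsNet.ofReal_abs_cutoff_sub_le (hA : IsNet A δ) (hX : IsUniformLocalTree X ι)
    (hδ : 0 < δ) (hδι : 20 * δ < ι) {a x u : X} (ha : a ∈ A) (hxu : dist x u < δ) :
    ENNReal.ofReal |cutoff A δ a x - cutoff A δ a u| ≤
      ENNReal.ofReal δ⁻¹ * lengthMeasure X ι (openSeg x u ∩ star A δ a) := by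
  by_cases hx : dist a x < 5 * δ
  · calc ENNReal.ofReal |cutoff A δ a x - cutoff A δ a u|
        ≤ ENNReal.ofReal (δ⁻¹ * |trimDist A δ a x - trimDist A δ a u|) :=
          ENNReal.ofReal_le_ofReal (hA.abs_cutoff_sub_le hδ hxu)
      _ = ENNReal.ofReal δ⁻¹ * ENNReal.ofReal |trimDist A δ a x - trimDist A δ a u| :=
          ENNReal.ofReal_mul (by positivity)
      _ ≤ _ := by
          gcongr
          exact hX.abs_trimDist_sub_le hδ hδι ha (by linarith)
  · have h1 : cutoff A δ a x = 0 := by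
      by_contra h
      linarith [hA.dist_lt_of_cutoff_ne_zero hδ h]
    have h2 : cutoff A δ a u = 0 := by
      by_contra h
      linarith [hA.dist_lt_of_cutoff_ne_zero hδ h, dist_triangle_right a x u]
    simp [h1, h2]

variable {m : Measure X} {dh c C r₁ : ℝ}

/-- This bound is the purpose of the trimming: a star consists of boundedly many segments, each
shorter than `8 δ`. -/
theorem IsNet.lengthMeasure_star_le (hA : IsNet A δ) (hX : IsUniformLocalTree X ι)
    (hV : VolumeBounds m dh c C r₁) (hδ : 0 < δ) (hδ₁ : 20 * δ < r₁) (hδι : 20 * δ < ι) (a : X) :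
    lengthMeasure X ι (star A δ a) ≤ overlapBound c C dh * ENNReal.ofReal (8 * δ) := by
  have hfin := hA.finite hV hδ hδ₁ a (ρ := 8 * δ) (by linarith)
  have hcard := hA.encard_le_of_subset hV hδ hδ₁ (x := a) (ρ := 8 * δ) (by linarith)
  have : Finite {b : A // dist (b : X) a < 8 * δ} := hfin
  refine (measure_iUnion_le _).trans (tsum_le_of_support (T := univ) ?_ (by simp) fun b => ?_)
  · rw [encard_univ]
    exact hcard
  · have hb := b.2
    rw [dist_comm] at hb
    exact (hX.lengthMeasure_mseg_le (by linarith)).trans (ENNReal.ofReal_le_ofReal hb.le)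

end Cutoff

/-! ### Interpolation of values on a net -/

section Interpolant

variable {X : Type*} [MetricSpace X] {A : Set X} {δ ι : ℝ}

/-- The average of the values `v` on the net `A` with the weights given by the cutoff functions. -/
noncomputable def interpolant (A : Set X) (δ : ℝ) (v : A → ℝ) (x : X) : ℝ :=
  (∑' a : A, cutoff A δ a x * v a) / ∑' a : A, cutoff A δ a x

/-- A density carried by the stars of the points of the net. -/
noncomputable def starDensity (A : Set X) (δ : ℝ) (k : A → ℝ≥0∞) (z : X) : ℝ≥0∞ :=
  ∑' a : A, (star A δ a).indicator (fun _ => k a) z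

/-! ### Algebra of the weighted means -/

section Sums

variable {T : Finset A} {v : A → ℝ} {x u : X}

theorem IsNet.one_le_sum_cutoff (hA : IsNet A δ) (hδ : 0 < δ)
    (hT : ∀ a : A, cutoff A δ a x ≠ 0 → a ∈ T) : 1 ≤ ∑ a ∈ T, cutoff A δ a x := by
  obtain ⟨a, ha, hax⟩ := hA.exists_near x
  have h1 := cutoff_eq_one hδ ha hax
  rw [← h1]
  exact Finset.single_le_sum (f := fun a : A => cutoff A δ a x) (fun _ _ => cutoff_nonneg _ _)
    (hT ⟨a, ha⟩ (by simp [h1]))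

theorem interpolant_eq_sum (hT : ∀ a : A, cutoff A δ a x ≠ 0 → a ∈ T) :
    interpolant A δ v x = (∑ a ∈ T, cutoff A δ a x * v a) / ∑ a ∈ T, cutoff A δ a x := by
  have h0 : ∀ a : A, a ∉ T → cutoff A δ a x = 0 := fun a ha => not_not.1 (mt (hT a) ha)
  rw [interpolant, tsum_eq_sum (s := T) fun a ha => by rw [h0 a ha, zero_mul],
    tsum_eq_sum (s := T) h0]

theorem IsNet.interpolant_sub_mul (hA : IsNet A δ) (hδ : 0 < δ)
    (hT : ∀ a : A, cutoff A δ a x ≠ 0 → a ∈ T) (w : ℝ) :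
    (interpolant A δ v x - w) * ∑ a ∈ T, cutoff A δ a x =
      ∑ a ∈ T, cutoff A δ a x * (v a - w) := by
  have h1 := hA.one_le_sum_cutoff hδ hT
  rw [interpolant_eq_sum hT, sub_mul, div_mul_cancel₀ _ (by linarith)]
  simp only [mul_sub, Finset.sum_sub_distrib, ← Finset.sum_mul]
  ring

theorem IsNet.abs_interpolant_sub_le_of_sum (hA : IsNet A δ) (hδ : 0 < δ)
    (hT : ∀ a : A, cutoff A δ a x ≠ 0 → a ∈ T) {w M : ℝ}
    (hM : ∀ a : A, dist (a : X) x < 3 * δ → |v a - w| ≤ M) :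
    |interpolant A δ v x - w| ≤ M := by
  have h1 := hA.one_le_sum_cutoff hδ hT
  have h2 := hA.interpolant_sub_mul (v := v) hδ hT w
  have h3 : |∑ a ∈ T, cutoff A δ a x * (v a - w)| ≤ (∑ a ∈ T, cutoff A δ a x) * M := by
    rw [Finset.sum_mul]
    refine (Finset.abs_sum_le_sum_abs _ _).trans (Finset.sum_le_sum fun a _ => ?_)
    by_cases h : cutoff A δ a x = 0
    · simp [h]
    · rw [abs_mul, abs_of_nonneg (cutoff_nonneg _ _)]
      exact mul_le_mul_of_nonneg_left (hM a (hA.dist_lt_of_cutoff_ne_zero hδ h))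
        (cutoff_nonneg _ _)
  rw [← h2, abs_mul, abs_of_pos (by linarith : 0 < ∑ a ∈ T, cutoff A δ a x), mul_comm] at h3
  exact le_of_mul_le_mul_left h3 (by linarith)

/-- Put `w` for the value at `u`. Since `∑ χ_a(u) (v_a - w) = 0`, the difference of the values at
`x` and `u`, multiplied by `∑ χ_a(x) ≥ 1`, equals `∑ (χ_a(x) - χ_a(u)) (v_a - w)`, so the variation
of the denominator never appears. A contributing `a` is within `4 δ` of `u`, and `w` is a convex
combination of values `v_b` with `b` within `3 δ` of `u`; hence the radius `7 δ`. -/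
theorem IsNet.abs_interpolant_sub_interpolant_le (hA : IsNet A δ) (hδ : 0 < δ)
    (hx : ∀ a : A, cutoff A δ a x ≠ 0 → a ∈ T) (hu : ∀ a : A, cutoff A δ a u ≠ 0 → a ∈ T)
    (hxu : dist x u < δ) {k : A → ℝ}
    (hk : ∀ a b : A, dist (a : X) b < 7 * δ → |v b - v a| ≤ k a) :
    |interpolant A δ v x - interpolant A δ v u| ≤
      ∑ a ∈ T, k a * |cutoff A δ a x - cutoff A δ a u| := by
  set w := interpolant A δ v u with hw
  have h1 := hA.one_le_sum_cutoff hδ hx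
  have e1 := hA.interpolant_sub_mul (v := v) hδ hx w
  have e2 := hA.interpolant_sub_mul (v := v) hδ hu w
  rw [← hw, sub_self, zero_mul] at e2
  have e3 : (interpolant A δ v x - w) * ∑ a ∈ T, cutoff A δ a x =
      ∑ a ∈ T, (cutoff A δ a x - cutoff A δ a u) * (v a - w) := by
    simp only [sub_mul, Finset.sum_sub_distrib] at e1 e2 ⊢
    rw [← sub_mul]
    linarith
  calc |interpolant A δ v x - w|
      ≤ |interpolant A δ v x - w| * ∑ a ∈ T, cutoff A δ a x :=
        le_mul_of_one_le_right (abs_nonneg _) h1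
    _ = |∑ a ∈ T, (cutoff A δ a x - cutoff A δ a u) * (v a - w)| := by
        rw [← e3, abs_mul, abs_of_pos (by linarith : 0 < ∑ a ∈ T, cutoff A δ a x)]
    _ ≤ ∑ a ∈ T, |(cutoff A δ a x - cutoff A δ a u) * (v a - w)| :=
        Finset.abs_sum_le_sum_abs _ _
    _ ≤ _ := by
        refine Finset.sum_le_sum fun a _ => ?_
        rw [abs_mul, mul_comm]
        by_cases h : cutoff A δ a x = 0 ∧ cutoff A δ a u = 0
        · simp [h.1, h.2]
        refine mul_le_mul_of_nonneg_right ?_ (abs_nonneg _)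
        have hau : dist (a : X) u < 4 * δ := by
          rw [not_and_or] at h
          rcases h with h | h
          · linarith [hA.dist_lt_of_cutoff_ne_zero hδ h, dist_triangle (a : X) x u]
          · linarith [hA.dist_lt_of_cutoff_ne_zero hδ h]
        rw [abs_sub_comm]
        refine hA.abs_interpolant_sub_le_of_sum hδ hu fun b hb => hk a b ?_
        linarith [dist_triangle_right (a : X) b u]

end Sums

variable [MeasurableSpace X] [BorelSpace X] {m : Measure X} {dh c C r₁ : ℝ}

theorem IsNet.abs_interpolant_sub_le (hA : IsNet A δ) (hV : VolumeBounds m dh c C r₁)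
    (hδ : 0 < δ) (hδ₁ : 20 * δ < r₁) {v : A → ℝ} {x : X} {w M : ℝ}
    (hM : ∀ a : A, dist (a : X) x < 3 * δ → |v a - w| ≤ M) :
    |interpolant A δ v x - w| ≤ M :=
  hA.abs_interpolant_sub_le_of_sum hδ (T := (hA.finite hV hδ hδ₁ x (ρ := 3 * δ)
    (by linarith)).toFinset) (fun a ha => by simpa using hA.dist_lt_of_cutoff_ne_zero hδ ha) hM

theorem IsNet.measurableSet_star (hA : IsNet A δ) (hV : VolumeBounds m dh c C r₁)
    (hδ : 0 < δ) (hδ₁ : 20 * δ < r₁) (a : X) : MeasurableSet (star A δ a) :=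
  (isClosed_star_of_finite (hA.finite hV hδ hδ₁ a (by linarith))).measurableSet

theorem IsNet.measurable_starDensity [Countable A] (hA : IsNet A δ)
    (hV : VolumeBounds m dh c C r₁) (hδ : 0 < δ) (hδ₁ : 20 * δ < r₁) (k : A → ℝ≥0∞) :
    Measurable (starDensity A δ k) :=
  Measurable.tsum fun a => measurable_const.indicator (hA.measurableSet_star hV hδ hδ₁ a)

theorem IsNet.lintegral_starDensity [Countable A] (hA : IsNet A δ)
    (hV : VolumeBounds m dh c C r₁) (hδ : 0 < δ) (hδ₁ : 20 * δ < r₁) (k : A → ℝ≥0∞)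
    (μ : Measure X) :
    ∫⁻ z, starDensity A δ k z ∂μ = ∑' a : A, k a * μ (star A δ a) := by
  unfold starDensity
  rw [lintegral_tsum (f := fun (a : A) z => (star A δ a).indicator (fun _ => k a) z) fun a =>
    (measurable_const.indicator (hA.measurableSet_star hV hδ hδ₁ a)).aemeasurable]
  refine tsum_congr fun a => ?_
  rw [lintegral_indicator_const (hA.measurableSet_star hV hδ hδ₁ a)]

/-- A point lies only in stars of centres within `8 δ`, which are boundedly many, so the power of
the sum is comparable to the sum of the powers; each star then contributes its length. -/
theorem IsNet.lintegral_starDensity_rpow_le [Countable A] (hA : IsNet A δ)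
    (hX : IsUniformLocalTree X ι)
    (hV : VolumeBounds m dh c C r₁) (hδ : 0 < δ) (hδ₁ : 20 * δ < r₁) (hδι : 20 * δ < ι)
    {p : ℝ} (hp : 1 ≤ p) (k : A → ℝ≥0∞) :
    ∫⁻ z, starDensity A δ k z ^ p ∂(lengthMeasure X ι) ≤
      (overlapBound c C dh : ℝ≥0∞) ^ (p - 1) *
        (overlapBound c C dh * ENNReal.ofReal (8 * δ)) * ∑' a : A, k a ^ p := by
  have hp0 : 0 < p := by linarith
  have hp1 : 0 ≤ p - 1 := by linarith
  have hNt : (overlapBound c C dh : ℝ≥0∞) ^ (p - 1) ≠ ∞ :=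
    ENNReal.rpow_ne_top_of_nonneg hp1 (ENNReal.natCast_ne_top _)
  have hpt : ∀ z, starDensity A δ k z ^ p ≤
      (overlapBound c C dh : ℝ≥0∞) ^ (p - 1) * starDensity A δ (fun a => k a ^ p) z := by
    intro z
    refine (tsum_rpow_le_of_support hp (hA.encard_le_of_subset hV hδ hδ₁ (x := z) (ρ := 8 * δ)
      (by linarith)) fun a ha => indicator_of_notMem (fun h => ha (dist_lt_of_mem_star h)) _).trans
      (le_of_eq ?_)
    unfold starDensity
    congr 1
    refine tsum_congr fun a => ?_
    by_cases h : z ∈ star A δ a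
    · simp [h]
    · simp [h, hp0]
  refine (lintegral_mono hpt).trans ?_
  rw [lintegral_const_mul' _ _ hNt, hA.lintegral_starDensity hV hδ hδ₁, mul_assoc]
  gcongr
  rw [← ENNReal.tsum_mul_left]
  refine ENNReal.tsum_le_tsum fun a => ?_
  rw [mul_comm]
  gcongr
  exact hA.lengthMeasure_star_le hX hV hδ hδ₁ hδι a

theorem IsNet.ofReal_abs_interpolant_sub_le (hA : IsNet A δ)
    (hX : IsUniformLocalTree X ι)
    (hV : VolumeBounds m dh c C r₁) (hδ : 0 < δ) (hδ₁ : 20 * δ < r₁) (hδι : 20 * δ < ι)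
    {v : A → ℝ} {k : A → ℝ≥0∞} (hkt : ∀ a, k a ≠ ∞)
    (hk : ∀ a b : A, dist (a : X) b < 7 * δ → ‖v b - v a‖ₑ ≤ k a)
    {x u : X} (hxu : dist x u < δ) :
    ENNReal.ofReal |interpolant A δ v x - interpolant A δ v u| ≤
      ∑ a ∈ (hA.finite hV hδ hδ₁ x (ρ := 5 * δ) (by linarith)).toFinset,
        ENNReal.ofReal δ⁻¹ * k a * lengthMeasure X ι (openSeg x u ∩ star A δ a) := by
  have hk' : ∀ a b : A, dist (a : X) b < 7 * δ → |v b - v a| ≤ (k a).toReal := by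
    intro a b hab
    rw [← ENNReal.ofReal_le_iff_le_toReal (hkt a), ← Real.norm_eq_abs, ofReal_norm]
    exact hk a b hab
  have h := hA.abs_interpolant_sub_interpolant_le (v := v) hδ
    (T := (hA.finite hV hδ hδ₁ x (ρ := 5 * δ) (by linarith)).toFinset) (x := x) (u := u)
    (fun a ha => by
      simp only [Finite.mem_toFinset, mem_ofPred_eq]
      linarith [hA.dist_lt_of_cutoff_ne_zero hδ ha])
    (fun a ha => by
      simp only [Finite.mem_toFinset, mem_ofPred_eq]
      linarith [hA.dist_lt_of_cutoff_ne_zero hδ ha, dist_triangle_right (a : X) x u])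
    hxu hk'
  refine (ENNReal.ofReal_le_ofReal h).trans ?_
  rw [ENNReal.ofReal_sum_of_nonneg fun a _ => by positivity]
  refine Finset.sum_le_sum fun a _ => ?_
  rw [ENNReal.ofReal_mul ENNReal.toReal_nonneg, ENNReal.ofReal_toReal (hkt a),
    mul_comm (ENNReal.ofReal δ⁻¹), mul_assoc]
  gcongr
  exact hA.ofReal_abs_cutoff_sub_le hX hδ hδι a.2 hxu

/-- Near `x` only finitely many weights vary, and each intersection of a star with `]x,u[` has
length at most `dist x u`; this gives a Lipschitz bound at `x`. -/
theorem IsNet.continuous_interpolant (hA : IsNet A δ)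
    (hX : IsUniformLocalTree X ι)
    (hV : VolumeBounds m dh c C r₁) (hδ : 0 < δ) (hδ₁ : 20 * δ < r₁) (hδι : 20 * δ < ι)
    {v : A → ℝ} {k : A → ℝ≥0∞} (hkt : ∀ a, k a ≠ ∞)
    (hk : ∀ a b : A, dist (a : X) b < 7 * δ → ‖v b - v a‖ₑ ≤ k a) :
    Continuous (interpolant A δ v) := by
  rw [continuous_iff_continuousAt]
  intro x
  set T := (hA.finite hV hδ hδ₁ x (ρ := 5 * δ) (by linarith)).toFinset with hT
  set K := ∑ a ∈ T, ENNReal.ofReal δ⁻¹ * k a with hK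
  have hKt : K ≠ ∞ := ENNReal.sum_ne_top.2 fun a _ =>
    ENNReal.mul_ne_top ENNReal.ofReal_ne_top (hkt a)
  have hle : ∀ u, dist u x < δ →
      |interpolant A δ v u - interpolant A δ v x| ≤ K.toReal * dist u x := by
    intro u hu
    rw [dist_comm] at hu
    have h := hA.ofReal_abs_interpolant_sub_le hX hV hδ hδ₁ hδι hkt hk hu
    have h2 : ENNReal.ofReal |interpolant A δ v x - interpolant A δ v u| ≤
        ENNReal.ofReal (K.toReal * dist x u) := by
      refine h.trans ?_
      rw [ENNReal.ofReal_mul ENNReal.toReal_nonneg, ENNReal.ofReal_toReal hKt, hK,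
        Finset.sum_mul]
      refine Finset.sum_le_sum fun a _ => ?_
      gcongr
      rw [← lengthMeasure_openSeg hX (by linarith : dist x u < ι)]
      exact measure_mono inter_subset_left
    rw [abs_sub_comm, dist_comm u x]
    exact (ENNReal.ofReal_le_ofReal_iff (by positivity)).1 h2
  rw [ContinuousAt, tendsto_iff_dist_tendsto_zero]
  have hlim : Tendsto (fun u => K.toReal * dist u x) (𝓝 x) (𝓝 0) := by
    have : Continuous fun u => K.toReal * dist u x := by fun_prop
    simpa using this.tendsto x
  refine squeeze_zero' (Eventually.of_forall fun _ => dist_nonneg) ?_ hlim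
  filter_upwards [Metric.ball_mem_nhds x hδ] with u hu
  rw [Real.dist_eq]
  exact hle u hu

/-- The interpolant is absolutely continuous, with a gradient carried by the stars of the points of
the net. -/
theorem IsNet.exists_isAbsGradient_interpolant [Countable A] [Nonempty X] (hA : IsNet A δ)
    (hX : IsUniformLocalTree X ι)
    (hV : VolumeBounds m dh c C r₁) (hδ : 0 < δ) (hδ₁ : 20 * δ < r₁) (hδι : 20 * δ < ι)
    {v : A → ℝ} {k : A → ℝ≥0∞}
    (hk : ∀ a b : A, dist (a : X) b < 7 * δ → ‖v b - v a‖ₑ ≤ k a)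
    {p : ℝ} (hp : 1 ≤ p) (hfin : ∑' a, k a ^ p ≠ ∞) :
    ∃ G : X → ℝ, IsAbsGradient ι (interpolant A δ v) G ∧
      ∫⁻ z, ‖G z‖ₑ ^ p ∂(lengthMeasure X ι) ≤
        (overlapBound c C dh : ℝ≥0∞) ^ (p - 1) *
          (overlapBound c C dh * ENNReal.ofReal (8 * δ)) *
          (ENNReal.ofReal δ⁻¹ ^ p * ∑' a : A, k a ^ p) := by
  have hp0 : 0 < p := by linarith
  have hp1 : 0 ≤ p - 1 := by linarith
  have hkt : ∀ a, k a ≠ ∞ := by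
    intro a h
    have := ENNReal.ne_top_of_tsum_ne_top hfin a
    rw [h, ENNReal.top_rpow_of_pos hp0] at this
    exact this rfl
  set Λ := starDensity A δ fun a => ENNReal.ofReal δ⁻¹ * k a with hΛ
  have hΛm : Measurable Λ := hA.measurable_starDensity hV hδ hδ₁ _
  have hΛp : ∫⁻ z, Λ z ^ p ∂(lengthMeasure X ι) ≤
      (overlapBound c C dh : ℝ≥0∞) ^ (p - 1) *
          (overlapBound c C dh * ENNReal.ofReal (8 * δ)) *
          (ENNReal.ofReal δ⁻¹ ^ p * ∑' a : A, k a ^ p) := by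
    refine (hA.lintegral_starDensity_rpow_le hX hV hδ hδ₁ hδι hp _).trans_eq ?_
    congr 1
    rw [← ENNReal.tsum_mul_left]
    exact tsum_congr fun a => ENNReal.mul_rpow_of_nonneg _ _ hp0.le
  have hΛpt : ∫⁻ z, Λ z ^ p ∂(lengthMeasure X ι) ≠ ∞ := by
    refine ne_top_of_le_ne_top ?_ hΛp
    refine ENNReal.mul_ne_top (ENNReal.mul_ne_top
      (ENNReal.rpow_ne_top_of_nonneg hp1 (ENNReal.natCast_ne_top _))
      (ENNReal.mul_ne_top (ENNReal.natCast_ne_top _) ENNReal.ofReal_ne_top)) ?_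
    exact ENNReal.mul_ne_top (ENNReal.rpow_ne_top_of_nonneg hp0.le ENNReal.ofReal_ne_top) hfin
  -- the segments that carry the density
  let Q := {q : A × A // dist (q.2 : X) q.1 < 8 * δ}
  obtain ⟨a₀, ha₀, -⟩ := hA.exists_near (Classical.arbitrary X)
  have : Nonempty Q := ⟨⟨(⟨a₀, ha₀⟩, ⟨a₀, ha₀⟩), by simpa using hδ⟩⟩
  obtain ⟨e, he⟩ := exists_surjective_nat Q
  obtain ⟨G, hG, hGΛ⟩ := hX.exists_isAbsGradient (f := interpolant A δ v) (Λ := Λ) (δ := δ)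
    (hA.continuous_interpolant hX hV hδ hδ₁ hδι hkt hk) hΛm hδ
    -- By Hölder, an `L^p` density is integrable along a segment, which has finite length.
    (fun x u hxu => by
      have h := rpow_lintegral_le (μ := (lengthMeasure X ι).restrict (openSeg x u))
        hΛm.aemeasurable hp
      have ht : (((lengthMeasure X ι).restrict (openSeg x u)) univ) ^ (p - 1) *
          ∫⁻ z in openSeg x u, Λ z ^ p ∂(lengthMeasure X ι) ≠ ∞ := by
        rw [Measure.restrict_apply_univ, lengthMeasure_openSeg hX hxu]
        exact ENNReal.mul_ne_top (ENNReal.rpow_ne_top_of_nonneg hp1 ENNReal.ofReal_ne_top)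
          (ne_top_of_le_ne_top hΛpt (setLIntegral_le_lintegral _ _))
      intro htop
      rw [htop, ENNReal.top_rpow_of_pos hp0] at h
      exact ht (top_le_iff.1 h))
    (fun x u hxu => by
      rw [hΛ, hA.lintegral_starDensity hV hδ hδ₁]
      refine (hA.ofReal_abs_interpolant_sub_le hX hV hδ hδ₁ hδι hkt hk hxu).trans ?_
      refine (Finset.sum_le_sum fun a _ => ?_).trans (ENNReal.sum_le_tsum _)
      rw [Measure.restrict_apply (hA.measurableSet_star hV hδ hδ₁ a), inter_comm])
    (a := fun n => ((e n).1.1 : X)) (b := fun n => ((e n).1.2 : X))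
    (fun n => by
      have := (e n).2
      rw [dist_comm] at this
      linarith)
    (fun z hz => by
      refine ENNReal.tsum_eq_zero.2 fun a => indicator_of_notMem (fun h => ?_) _
      obtain ⟨b, hb⟩ := mem_iUnion.1 h
      obtain ⟨n, hn⟩ := he ⟨(a, b.1), b.2⟩
      apply hz n
      rw [hn]
      exact hb)
  refine ⟨G, hG, le_trans (lintegral_mono_ae ?_) hΛp⟩
  filter_upwards [hGΛ] with z hz
  rw [← ofReal_norm, Real.norm_eq_abs]
  exact ENNReal.rpow_le_rpow hz hp0.le

end Interpolant

/-! ### Approximation by Sobolev functions -/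

theorem enorm_average_sub_rpow_le {α : Type*} [MeasurableSpace α] {μ : Measure α}
    [IsFiniteMeasure μ] [NeZero μ] {f : α → ℝ} (hf : Integrable f μ) {p : ℝ} (hp : 1 ≤ p)
    (w : ℝ) :
    ‖(⨍ y, f y ∂μ) - w‖ₑ ^ p ≤ (μ univ)⁻¹ * ∫⁻ y, ‖f y - w‖ₑ ^ p ∂μ := by
  have hprob : IsProbabilityMeasure ((μ univ)⁻¹ • μ) := inferInstance
  have hint : Integrable f ((μ univ)⁻¹ • μ) :=
    hf.smul_measure (ENNReal.inv_ne_top.2 (NeZero.ne _))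
  have h1 : (⨍ y, f y ∂μ) - w = ∫ y, (f y - w) ∂((μ univ)⁻¹ • μ) := by
    rw [integral_sub hint (integrable_const w), average]
    simp
  rw [h1]
  calc ‖∫ y, (f y - w) ∂((μ univ)⁻¹ • μ)‖ₑ ^ p
      ≤ (∫⁻ y, ‖f y - w‖ₑ ∂((μ univ)⁻¹ • μ)) ^ p :=
        ENNReal.rpow_le_rpow (enorm_integral_le_lintegral_enorm _) (by linarith)
    _ ≤ ((μ univ)⁻¹ • μ) univ ^ (p - 1) * ∫⁻ y, ‖f y - w‖ₑ ^ p ∂((μ univ)⁻¹ • μ) :=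
        rpow_lintegral_le ((hint.aestronglyMeasurable.sub
          aestronglyMeasurable_const).enorm) hp
    _ = _ := by
        rw [measure_univ, ENNReal.one_rpow, one_mul, lintegral_smul_measure, smul_eq_mul]

section Approx

variable {X : Type*} [MeasurableSpace X] {m : Measure X} {dh c C r₁ δ ι p : ℝ}

theorem mem_lpSpace_add {f g : X →ₘ[m] ℝ} (hf : f ∈ lpSpace m p) (hg : g ∈ lpSpace m p) :
    f + g ∈ lpSpace m p :=
  (MemLp.add hf hg).ae_eq (AEEqFun.coeFn_add f g).symm

theorem mem_lpSpace_sub {f g : X →ₘ[m] ℝ} (hf : f ∈ lpSpace m p) (hg : g ∈ lpSpace m p) :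
    f - g ∈ lpSpace m p :=
  (MemLp.sub hf hg).ae_eq (AEEqFun.coeFn_sub f g).symm

theorem mem_lpSpace_iff (f : X →ₘ[m] ℝ) : f ∈ lpSpace m p ↔ lpNorm m p f < ∞ :=
  ⟨fun h => h.2, fun h => ⟨f.aestronglyMeasurable, h⟩⟩

variable [MetricSpace X]

theorem VolumeBounds.enorm_average_ball_sub_rpow_le (hV : VolumeBounds m dh c C r₁)
    (hδ : 0 < δ) (hδ₁ : δ < r₁) (hp : 1 ≤ p) {f : X → ℝ}
    (hf : MemLp f (ENNReal.ofReal p) m) (a : X) (w : ℝ) :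
    ‖(⨍ y in Metric.ball a δ, f y ∂m) - w‖ₑ ^ p ≤
      ENNReal.ofReal (c * δ ^ dh)⁻¹ * ∫⁻ y in Metric.ball a δ, ‖f y - w‖ₑ ^ p ∂m := by
  have hpos : 0 < c * δ ^ dh := mul_pos hV.c_pos (Real.rpow_pos_of_pos hδ _)
  have hle := hV.le_ball a δ hδ hδ₁
  have hlt : m (Metric.ball a δ) < ∞ := (hV.ball_le a δ hδ hδ₁).trans_lt ENNReal.ofReal_lt_top
  have : IsFiniteMeasure (m.restrict (Metric.ball a δ)) := ⟨by simpa using hlt⟩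
  have : NeZero (m.restrict (Metric.ball a δ)) := ⟨by
    rw [Ne, Measure.restrict_eq_zero]
    exact ((ENNReal.ofReal_pos.2 hpos).trans_le hle).ne'⟩
  have hint : Integrable f (m.restrict (Metric.ball a δ)) :=
    (hf.restrict _).integrable (by simpa using hp)
  refine (enorm_average_sub_rpow_le hint hp w).trans ?_
  rw [Measure.restrict_apply_univ, ENNReal.ofReal_inv_of_pos hpos]
  gcongr

variable [BorelSpace X] [SecondCountableTopology X] [SFinite m]

/-- `h` is the interpolant of the averages of `f` over the balls `B(a, δ)`. At `x` it is a convex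
combination of averages over balls contained in `B(x, 4 δ)`, so Jensen bounds `|f - h|^p` pointwise
by the local oscillation of `f`. Its gradient is bounded by `δ⁻¹` times differences of neighbouring
averages. -/
theorem VolumeBounds.exists_sobolev_approx [Nonempty X] (hX : IsUniformLocalTree X ι)
    (hV : VolumeBounds m dh c C r₁) (hδ : 0 < δ) (hδ₁ : 20 * δ < r₁) (hδι : 20 * δ < ι)
    (hp : 1 ≤ p) {f : X →ₘ[m] ℝ} (hf : f ∈ lpSpace m p) :
    ∃ h ∈ sobolev ι m p,
      lpNorm m p (f - h) ^ p ≤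
        ENNReal.ofReal (c * δ ^ dh)⁻¹ * pairEnergy m p f (20 * δ) ∧
      gradNorm ι m p h ^ p ≤ (overlapBound c C dh : ℝ≥0∞) ^ (p - 1) *
        (overlapBound c C dh * ENNReal.ofReal (8 * δ)) * (ENNReal.ofReal δ⁻¹ ^ p *
          (ENNReal.ofReal (c * δ ^ dh)⁻¹ ^ 2 *
            (overlapBound c C dh * pairEnergy m p f (20 * δ)))) := by
  have hp0 : 0 < p := by linarith
  set V := ENNReal.ofReal (c * δ ^ dh)⁻¹ with hVdef
  have hVt : V ≠ ∞ := ENNReal.ofReal_ne_top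
  set N := overlapBound c C dh with hN
  set J := pairEnergy m p f (20 * δ) with hJ
  set H : X → ℝ≥0∞ := fun x => ∫⁻ y in Metric.ball x (20 * δ), ‖f y - f x‖ₑ ^ p ∂m with hH
  have hHm : Measurable H := measurable_setLIntegral_ball_sub p (20 * δ) f.measurable
  have hJH : J = ∫⁻ x, H x ∂m := rfl
  have hJt : J ≠ ∞ := by
    refine ne_top_of_le_ne_top ?_ (hV.pairEnergy_le_lintegral hp (by linarith) hδ₁ f.measurable)
    refine ENNReal.mul_ne_top (two_rpow_ne_top p) (ENNReal.mul_ne_top ENNReal.ofReal_ne_top ?_)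
    rw [← lpNorm_rpow hp]
    exact ENNReal.rpow_ne_top_of_nonneg hp0.le ((mem_lpSpace_iff f).1 hf).ne
  obtain ⟨A, hA⟩ := exists_isNet X hδ
  have : Countable A := (hA.countable hδ).to_subtype
  set v : A → ℝ := fun a => ⨍ y in Metric.ball (a : X) δ, f y ∂m with hv
  have hvw : ∀ (a : A) (w : ℝ), ‖v a - w‖ₑ ^ p ≤
      V * ∫⁻ y in Metric.ball (a : X) δ, ‖f y - w‖ₑ ^ p ∂m := fun a w =>
    hV.enorm_average_ball_sub_rpow_le hδ (by linarith) hp hf a w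
  -- The bound for differences of neighbouring averages: Jensen is used once for each of the two
  -- averages, hence the factor `V ^ 2`.
  set k : A → ℝ≥0∞ := fun a => (V ^ 2 * ∫⁻ y in Metric.ball (a : X) δ, H y ∂m) ^ (1 / p) with hk
  have hkp : ∀ a, k a ^ p = V ^ 2 * ∫⁻ y in Metric.ball (a : X) δ, H y ∂m := fun a => by
    rw [hk, ← ENNReal.rpow_mul, one_div_mul_cancel hp0.ne', ENNReal.rpow_one]
  have hkv : ∀ a b : A, dist (a : X) b < 7 * δ → ‖v b - v a‖ₑ ≤ k a := by
    intro a b hab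
    rw [← ENNReal.rpow_le_rpow_iff hp0, hkp, enorm_sub_rev]
    refine (hvw a (v b)).trans ?_
    rw [pow_two, mul_assoc]
    gcongr V * ?_
    rw [← lintegral_const_mul' _ _ hVt]
    -- For `y ∈ B(a, δ)` and `dist a b < 7 δ`, the ball `B(b, δ)` lies in `B(y, 9 δ)`, inside the
    -- ball over which `H` integrates.
    refine setLIntegral_mono' Metric.isOpen_ball.measurableSet fun y hy => ?_
    rw [enorm_sub_rev]
    refine (hvw b (f y)).trans ?_
    gcongr V * ?_
    refine lintegral_mono_set (Metric.ball_subset_ball' ?_)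
    rw [Metric.mem_ball] at hy
    linarith [dist_triangle (b : X) a y, dist_comm (b : X) a, dist_comm (a : X) y]
  have hksum : ∑' a, k a ^ p ≤ V ^ 2 * (N * J) := by
    simp only [hkp]
    rw [ENNReal.tsum_mul_left]
    gcongr
    exact hA.tsum_setLIntegral_le hV hδ hδ₁ hHm
  have hkt : ∑' a, k a ^ p ≠ ∞ := ne_top_of_le_ne_top
    (ENNReal.mul_ne_top (ENNReal.pow_ne_top hVt)
      (ENNReal.mul_ne_top (ENNReal.natCast_ne_top _) hJt)) hksum
  obtain ⟨G, hG, hGle⟩ :=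
    hA.exists_isAbsGradient_interpolant hX hV hδ hδ₁ hδι hkv hp hkt
  set u := interpolant A δ v with hu
  have huc : Continuous u := hG.1
  set h : X →ₘ[m] ℝ := AEEqFun.mk u huc.aestronglyMeasurable with hh
  have hhu : h =ᵐ[m] u := AEEqFun.coeFn_mk _ _
  have hpt : ∀ x, ‖f x - u x‖ₑ ^ p ≤ V * H x := by
    intro x
    by_cases htop : V * H x = ∞
    · rw [htop]
      exact le_top
    set M := (V * H x) ^ (1 / p) with hM
    have hMp : M ^ p = V * H x := by
      rw [hM, ← ENNReal.rpow_mul, one_div_mul_cancel hp0.ne', ENNReal.rpow_one]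
    have hMt : M ≠ ∞ := ENNReal.rpow_ne_top_of_nonneg (by positivity) htop
    rw [← hMp]
    refine ENNReal.rpow_le_rpow ?_ hp0.le
    rw [enorm_sub_rev, ← ofReal_norm, ENNReal.ofReal_le_iff_le_toReal hMt, Real.norm_eq_abs]
    refine hA.abs_interpolant_sub_le hV hδ hδ₁ fun a ha => ?_
    rw [← Real.norm_eq_abs, ← ENNReal.ofReal_le_iff_le_toReal hMt, ofReal_norm,
      ← ENNReal.rpow_le_rpow_iff hp0, hMp]
    refine (hvw a (f x)).trans ?_
    gcongr V * ?_
    exact lintegral_mono_set (Metric.ball_subset_ball' (by linarith))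
  have hfh : lpNorm m p (f - h) ^ p ≤ V * J := by
    rw [lpNorm_rpow hp, hJH, ← lintegral_const_mul' _ _ hVt]
    refine lintegral_mono_ae ?_
    filter_upwards [AEEqFun.coeFn_sub f h, hhu] with x h1 h2
    rw [h1, Pi.sub_apply, h2]
    exact hpt x
  have hfhl : f - h ∈ lpSpace m p := by
    rw [mem_lpSpace_iff, lt_top_iff_ne_top]
    intro htop
    rw [htop, ENNReal.top_rpow_of_pos hp0, top_le_iff] at hfh
    exact ENNReal.mul_ne_top hVt hJt hfh
  have hhl : h ∈ lpSpace m p := by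
    have := mem_lpSpace_sub hf hfhl
    rwa [sub_sub_cancel] at this
  have hGp : eLpNorm G (ENNReal.ofReal p) (lengthMeasure X ι) ^ p ≤
      (N : ℝ≥0∞) ^ (p - 1) * (N * ENNReal.ofReal (8 * δ)) *
        (ENNReal.ofReal δ⁻¹ ^ p * (V ^ 2 * (N * J))) := by
    rw [eLpNorm_rpow hp]
    refine hGle.trans ?_
    gcongr
  refine ⟨h, ⟨hhl, u, G, hhu, hG, hG.2.1.aestronglyMeasurable, ?_⟩, hfh, ?_⟩
  · rw [lt_top_iff_ne_top]
    intro htop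
    rw [htop, ENNReal.top_rpow_of_pos hp0, top_le_iff] at hGp
    refine ENNReal.mul_ne_top (ENNReal.mul_ne_top
      (ENNReal.rpow_ne_top_of_nonneg (by linarith) (ENNReal.natCast_ne_top _))
      (ENNReal.mul_ne_top (ENNReal.natCast_ne_top _) ENNReal.ofReal_ne_top))
      (ENNReal.mul_ne_top (ENNReal.rpow_ne_top_of_nonneg hp0.le ENNReal.ofReal_ne_top)
        (ENNReal.mul_ne_top (ENNReal.pow_ne_top hVt)
          (ENNReal.mul_ne_top (ENNReal.natCast_ne_top _) hJt))) hGp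
  · refine le_trans (ENNReal.rpow_le_rpow ?_ hp0.le) hGp
    exact iInf_le_of_le u (iInf_le_of_le G (iInf_le_of_le hhu (iInf_le_of_le hG le_rfl)))

theorem le_ofReal_mul_of_rpow_le {a b : ℝ≥0∞} {K : ℝ} (hp : 1 ≤ p) (hK : 0 ≤ K)
    (h : a ^ p ≤ ENNReal.ofReal K * b) :
    a ≤ ENNReal.ofReal (K ^ (1 / p)) * b ^ (1 / p) := by
  have hp0 : 0 < p := by linarith
  rw [← ENNReal.ofReal_rpow_of_nonneg hK (by positivity),
    ← ENNReal.mul_rpow_of_nonneg _ _ (by positivity)]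
  rwa [one_div, ENNReal.le_rpow_inv_iff hp0]

/-- Every `f ∈ L^p` splits as `(f - h) + h` with `h ∈ W^{1,p}`, with both parts controlled by the
energy at scale `r`. -/
theorem VolumeBounds.exists_sobolev_splitting [Nonempty X] (hX : IsUniformLocalTree X ι)
    (hV : VolumeBounds m dh c C r₁) (hp : 1 ≤ p) :
    ∃ K₁ K₂ : ℝ, 0 < K₁ ∧ 0 ≤ K₂ ∧ ∀ r, 0 < r → r < r₁ → r < ι → ∀ f ∈ lpSpace m p,
      ∃ h ∈ sobolev ι m p,
        lpNorm m p (f - h) ≤ ENNReal.ofReal K₁ * besovEnergy m p 0 f r ^ (1 / p) ∧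
        ENNReal.ofReal (r ^ alphaCrit dh p) * gradNorm ι m p h ≤
          ENNReal.ofReal K₂ * besovEnergy m p 0 f r ^ (1 / p) := by
  have hc := hV.c_pos
  have hC := hV.C_pos
  have hp0 : 0 < p := by linarith
  set N := overlapBound c C dh with hN
  have h20 : (0 : ℝ) < 20 ^ dh := by positivity
  have h20' : (0 : ℝ) < 20 ^ (p - 1) := by positivity
  -- With `r = 20 δ` all powers of `δ` cancel. In the gradient estimate the exponents are `p - 1 +
  -- dh` from `r ^ (p α_p)`, `1` from the stars, `-p` from the slopes, `-2 dh` from the two averages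
  -- and `dh` from the normalization of the energy.
  refine ⟨(C / c * 20 ^ dh) ^ (1 / p), ((N : ℝ) ^ (p - 1) * N ^ 2 * 8 * 20 ^ (p - 1) *
    (20 ^ dh) ^ 2 * (C / c ^ 2)) ^ (1 / p), by positivity, by positivity, ?_⟩
  intro r hr hr₁ hrι f hf
  obtain ⟨δ, rfl⟩ : ∃ δ, r = 20 * δ := ⟨r / 20, by ring⟩
  have hδ : 0 < δ := by linarith
  have hδd : 0 < δ ^ dh := Real.rpow_pos_of_pos hδ _
  have hδp : 0 < δ ^ (p - 1) := Real.rpow_pos_of_pos hδ _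
  have ed : (20 * δ) ^ dh = 20 ^ dh * δ ^ dh := Real.mul_rpow (by norm_num) hδ.le
  have ep : (20 * δ) ^ (p - 1) = 20 ^ (p - 1) * δ ^ (p - 1) := Real.mul_rpow (by norm_num) hδ.le
  have ep' : δ⁻¹ ^ p = (δ ^ (p - 1))⁻¹ * δ⁻¹ := by
    rw [Real.inv_rpow hδ.le, ← mul_inv, ← Real.rpow_add_one hδ.ne', sub_add_cancel]
  obtain ⟨h, hs, h1, h2⟩ := hV.exists_sobolev_approx hX hδ hr₁ hrι hp hf
  have hJ := hV.pairEnergy_le hp hr hr₁ f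
  refine ⟨h, hs, le_ofReal_mul_of_rpow_le hp (by positivity) ?_,
    le_ofReal_mul_of_rpow_le hp (by positivity) ?_⟩
  · refine h1.trans ((mul_le_mul_right hJ _).trans_eq ?_)
    rw [← mul_assoc, ← ENNReal.ofReal_mul (by positivity), ed]
    congr 2
    field_simp
  · rw [ENNReal.mul_rpow_of_nonneg _ _ hp0.le, ENNReal.ofReal_rpow_of_nonneg (by positivity) hp0.le,
      rpow_mul_alphaCrit hp hr]
    calc ENNReal.ofReal ((20 * δ) ^ (p - 1) * (20 * δ) ^ dh) * gradNorm ι m p h ^ p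
        ≤ ENNReal.ofReal ((20 * δ) ^ (p - 1) * (20 * δ) ^ dh) * ((N : ℝ≥0∞) ^ (p - 1) *
          (N * ENNReal.ofReal (8 * δ)) * (ENNReal.ofReal δ⁻¹ ^ p *
          (ENNReal.ofReal (c * δ ^ dh)⁻¹ ^ 2 *
            (N * (ENNReal.ofReal (C * (20 * δ) ^ dh) * besovEnergy m p 0 f (20 * δ)))))) := by
          refine mul_le_mul_right (h2.trans ?_) _
          gcongr
      _ = ENNReal.ofReal ((20 * δ) ^ (p - 1) * (20 * δ) ^ dh * ((N : ℝ) ^ (p - 1) *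
          (N * (8 * δ)) * (δ⁻¹ ^ p * ((c * δ ^ dh)⁻¹ ^ 2 * (N * (C * (20 * δ) ^ dh)))))) *
          besovEnergy m p 0 f (20 * δ) := by
          rw [← ENNReal.ofReal_natCast N, ENNReal.ofReal_rpow_of_nonneg (by positivity)
            (by linarith), ENNReal.ofReal_rpow_of_nonneg (by positivity) hp0.le,
            ← ENNReal.ofReal_pow (by positivity)]
          simp only [← mul_assoc]
          repeat rw [← ENNReal.ofReal_mul (by positivity)]
          congr 2
          ring
      _ = _ := by
          rw [ed, ep, ep']
          congr 2
          field_simp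

end Approx

/-! ### Bounds for the `K`-functional -/

section KFunctional

variable {X : Type*} [MeasurableSpace X] {m : Measure X} {dh c C r₁ ι p α r : ℝ}

theorem kFunctional_le {A : Type*} [AddCommGroup A] {X₀ X₁ : Set A} {N₀ N₁ : A → ℝ≥0∞}
    {f h : A} (hfh : f - h ∈ X₀) (hh : h ∈ X₁) (t : ℝ) :
    kFunctional X₀ X₁ N₀ N₁ f t ≤ N₀ (f - h) + ENNReal.ofReal t * N₁ h :=
  iInf₂_le_of_le (f - h) hfh (iInf₂_le_of_le h hh (iInf_le_of_le (by abel) le_rfl))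

theorem lpNorm_zero : lpNorm m p 0 = 0 := by
  unfold lpNorm
  rw [eLpNorm_congr_ae AEEqFun.coeFn_zero, eLpNorm_zero]

variable [MetricSpace X]

theorem rpow_besovEnergy {r : ℝ} (hp : 1 ≤ p) (hr : 0 < r) (f : X →ₘ[m] ℝ) :
    besovEnergy m p α f r ^ (1 / p) =
      ENNReal.ofReal (r ^ (-α)) * besovEnergy m p 0 f r ^ (1 / p) := by
  have hp0 : 0 < p := by linarith
  rw [besovEnergy_eq_mul hp hr, ENNReal.mul_rpow_of_nonneg _ _ (by positivity),
    ENNReal.ofReal_rpow_of_nonneg (by positivity) (by positivity), ← Real.rpow_neg hr.le,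
    ← Real.rpow_mul hr.le]
  congr 3
  field_simp

/-! ### Interpolation spaces on spaces of finite measure -/

/-- For `r ≥ s` the normalization is at most `(c s ^ dh)⁻¹`, and on a finite measure space the
oscillation integral over all pairs of points is controlled by the `L^p` norm. -/
theorem VolumeBounds.exists_besovEnergy_le [IsFiniteMeasure m] (hV : VolumeBounds m dh c C r₁)
    (hp : 1 ≤ p) {s : ℝ} (hs : 0 < s) (hs₁ : s < r₁) {f : X →ₘ[m] ℝ} (hf : f ∈ lpSpace m p) :
    ∃ M : ℝ≥0∞, M < ∞ ∧ ∀ r, s ≤ r → besovEnergy m p 0 f r ≤ M := by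
  have hp0 : 0 < p := by linarith
  have hpos : 0 < c * s ^ dh := mul_pos hV.c_pos (Real.rpow_pos_of_pos hs _)
  refine ⟨ENNReal.ofReal (c * s ^ dh)⁻¹ * ∫⁻ x, ∫⁻ y, ‖f y - f x‖ₑ ^ p ∂m ∂m, ?_, fun r hr => ?_⟩
  · refine ENNReal.mul_lt_top ENNReal.ofReal_lt_top ?_
    have hI : ∫⁻ y, ‖f y‖ₑ ^ p ∂m ≠ ∞ := by
      rw [← lpNorm_rpow hp]
      exact ENNReal.rpow_ne_top_of_nonneg hp0.le ((mem_lpSpace_iff f).1 hf).ne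
    have hfm : Measurable fun y => ‖f y‖ₑ ^ p := f.measurable.enorm.pow_const p
    refine lt_of_le_of_lt (b := ∫⁻ x, 2 ^ (p - 1) * (∫⁻ y, ‖f y‖ₑ ^ p ∂m +
      ‖f x‖ₑ ^ p * m univ) ∂m) ?_ ?_
    · refine lintegral_mono fun x => ?_
      calc ∫⁻ y, ‖f y - f x‖ₑ ^ p ∂m
          ≤ ∫⁻ y, 2 ^ (p - 1) * (‖f y‖ₑ ^ p + ‖f x‖ₑ ^ p) ∂m :=
            lintegral_mono fun y => enorm_sub_rpow_le hp
        _ = _ := by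
            rw [lintegral_const_mul' _ _ (two_rpow_ne_top _), lintegral_add_left hfm,
              lintegral_const]
    · rw [lintegral_const_mul' _ _ (two_rpow_ne_top _), lintegral_add_left measurable_const,
        lintegral_const, lintegral_mul_const _ hfm]
      have hmt : m univ ≠ ∞ := measure_ne_top m univ
      exact (ENNReal.mul_ne_top (two_rpow_ne_top _) (ENNReal.add_ne_top.2
        ⟨ENNReal.mul_ne_top hI hmt, ENNReal.mul_ne_top hI hmt⟩)).lt_top
  · rw [besovEnergy_zero hp, ← lintegral_const_mul' _ _ ENNReal.ofReal_ne_top]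
    refine lintegral_mono fun x => ?_
    have h1 : (m (Metric.ball x r))⁻¹ ≤ ENNReal.ofReal (c * s ^ dh)⁻¹ := by
      rw [ENNReal.ofReal_inv_of_pos hpos]
      exact ENNReal.inv_le_inv.2 ((hV.le_ball x s hs hs₁).trans
        (measure_mono (Metric.ball_subset_ball hr)))
    gcongr
    exact Measure.restrict_le_self

/-- The substitution `t = r ^ α_p` turns `t ^ (-θ)` into `r ^ (-α)`, so the two suprema are
comparable at small scales. At large scales neither imposes a condition: `K(f, t)` is at most the
`L^p` norm, and the energies are bounded because the measure is finite. -/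
theorem VolumeBounds.besov_eq_interpInfty [IsFiniteMeasure m] (hV : VolumeBounds m dh c C r₁)
    (hr₁ : 0 < r₁) (hdh : 1 ≤ dh) (hp : 1 ≤ p)
    {X₁ : Set (X →ₘ[m] ℝ)} {N₁ : (X →ₘ[m] ℝ) → ℝ≥0∞} (hX₁ : X₁ ⊆ lpSpace m p)
    (h0 : 0 ∈ X₁) (hN0 : N₁ 0 = 0) {r₀ C₁ C₂ : ℝ} (hr₀ : 0 < r₀) (hC₁ : 0 < C₁)
    (hK : ∀ r, 0 < r → r < r₀ → ∀ f ∈ lpSpace m p,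
      ENNReal.ofReal C₁ * besovEnergy m p 0 f r ^ (1 / p) ≤
        kFunctional (lpSpace m p) X₁ (lpNorm m p) N₁ f (r ^ alphaCrit dh p) ∧
      kFunctional (lpSpace m p) X₁ (lpNorm m p) N₁ f (r ^ alphaCrit dh p) ≤
        ENNReal.ofReal C₂ * besovEnergy m p 0 f r ^ (1 / p))
    (hα : 0 ≤ α) :
    besov m p α =
      interpInfty (lpSpace m p) X₁ (lpNorm m p) N₁ (α / alphaCrit dh p) := by
  have hp0 : 0 < p := by linarith
  have ha : 0 < alphaCrit dh p := by
    have : 0 ≤ (dh - 1) / p := div_nonneg (by linarith) hp0.le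
    unfold alphaCrit
    linarith
  set a := alphaCrit dh p with hadef
  set θ := α / a with hθ
  have hθ0 : 0 ≤ θ := div_nonneg hα ha.le
  have haθ : a * θ = α := by rw [hθ, mul_div_cancel₀ _ ha.ne']
  have hpow : ∀ r : ℝ, 0 < r → (r ^ a) ^ (-θ) = r ^ (-α) := fun r hr => by
    rw [← Real.rpow_mul hr.le, mul_neg, haθ]
  set s := min r₀ (r₁ / 2) with hs
  have hs0 : 0 < s := lt_min hr₀ (by linarith)
  have hs₁ : s < r₁ := (min_le_right _ _).trans_lt (by linarith)
  ext f
  constructor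
  · rintro ⟨hf, hsup⟩
    refine ⟨⟨f, hf, 0, h0, by simp⟩, ?_⟩
    set S := ⨆ r ∈ Ioo (0 : ℝ) 1, besovEnergy m p α f r with hS
    -- The Besov supremum covers only `r < 1`, and the estimate of `K` only `r < r₀`.
    set ρ := min s 1 with hρ
    have hρ0 : 0 < ρ := lt_min hs0 one_pos
    refine lt_of_le_of_lt (b := max (ENNReal.ofReal C₂ * S ^ (1 / p))
      (ENNReal.ofReal ((ρ ^ a) ^ (-θ)) * lpNorm m p f)) (iSup₂_le fun t ht => ?_) ?_
    · have ht0 : 0 < t := ht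
      rcases lt_or_ge t (ρ ^ a) with hlt | hge
      · refine le_max_of_le_left ?_
        set r := t ^ (1 / a) with hr
        have hr0 : 0 < r := Real.rpow_pos_of_pos ht0 _
        have htr : r ^ a = t := by
          rw [hr, ← Real.rpow_mul ht0.le, one_div_mul_cancel ha.ne', Real.rpow_one]
        have hrρ : r < ρ := by
          rw [← htr] at hlt
          exact (Real.rpow_lt_rpow_iff hr0.le hρ0.le ha).1 hlt
        have hrs : r < r₀ := hrρ.trans_le ((min_le_left _ _).trans (min_le_left _ _))
        have hr1 : r < 1 := hrρ.trans_le (min_le_right _ _)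
        rw [← htr, hpow r hr0]
        calc ENNReal.ofReal (r ^ (-α)) * kFunctional (lpSpace m p) X₁ (lpNorm m p) N₁ f (r ^ a)
            ≤ ENNReal.ofReal (r ^ (-α)) *
                (ENNReal.ofReal C₂ * besovEnergy m p 0 f r ^ (1 / p)) := by
              gcongr
              exact (hK r hr0 hrs f hf).2
          _ = ENNReal.ofReal C₂ * besovEnergy m p α f r ^ (1 / p) := by
              rw [rpow_besovEnergy (α := α) hp hr0, mul_left_comm]
          _ ≤ _ := by
              gcongr
              exact le_iSup₂_of_le r ⟨hr0, hr1⟩ le_rfl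
      · refine le_max_of_le_right ?_
        -- The trivial splitting `f = f + 0`; for `t ≥ ρ ^ a` the weight `t ^ (-θ)` is bounded.
        have hk := kFunctional_le (N₀ := lpNorm m p) (N₁ := N₁) (f := f) (h := 0)
          (by simpa using hf) h0 t
        rw [sub_zero, hN0, mul_zero, add_zero] at hk
        refine mul_le_mul' (ENNReal.ofReal_le_ofReal ?_) hk
        exact Real.rpow_le_rpow_of_nonpos (Real.rpow_pos_of_pos hρ0 _) hge (by linarith)
    · refine max_lt (ENNReal.mul_lt_top ENNReal.ofReal_lt_top ?_)
        (ENNReal.mul_lt_top ENNReal.ofReal_lt_top ((mem_lpSpace_iff f).1 hf))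
      exact (ENNReal.rpow_ne_top_of_nonneg (by positivity) hsup.ne).lt_top
  · rintro ⟨⟨g, hg, h, hh, rfl⟩, hsup⟩
    have hf : g + h ∈ lpSpace m p := mem_lpSpace_add hg (hX₁ hh)
    refine ⟨hf, ?_⟩
    beta_reduce at hsup
    set f := g + h with hfdef
    set S := ⨆ t ∈ Ioi (0 : ℝ), ENNReal.ofReal (t ^ (-θ)) *
      kFunctional (lpSpace m p) X₁ (lpNorm m p) N₁ f t with hS
    obtain ⟨M, hM, hMle⟩ := hV.exists_besovEnergy_le hp hs0 hs₁ hf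
    refine lt_of_le_of_lt (b := max ((ENNReal.ofReal C₁⁻¹ * S) ^ p)
      (ENNReal.ofReal (s ^ (p * α))⁻¹ * M)) (iSup₂_le fun r hr => ?_) ?_
    · rcases lt_or_ge r s with hlt | hge
      · refine le_max_of_le_left ?_
        rw [← ENNReal.rpow_inv_le_iff hp0, ← one_div, rpow_besovEnergy hp hr.1]
        have hK1 := (hK r hr.1 (hlt.trans_le (min_le_left _ _)) f hf).1
        have hSle : ENNReal.ofReal (r ^ (-α)) *
            kFunctional (lpSpace m p) X₁ (lpNorm m p) N₁ f (r ^ a) ≤ S := by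
          rw [← hpow r hr.1]
          exact le_iSup₂_of_le (r ^ a) (Real.rpow_pos_of_pos hr.1 _) le_rfl
        calc ENNReal.ofReal (r ^ (-α)) * besovEnergy m p 0 f r ^ (1 / p)
            = ENNReal.ofReal C₁⁻¹ * (ENNReal.ofReal (r ^ (-α)) *
                (ENNReal.ofReal C₁ * besovEnergy m p 0 f r ^ (1 / p))) := by
              rw [mul_left_comm (ENNReal.ofReal (r ^ (-α))), ← mul_assoc (ENNReal.ofReal C₁⁻¹),
                ← ENNReal.ofReal_mul (by positivity), inv_mul_cancel₀ hC₁.ne',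
                ENNReal.ofReal_one, one_mul]
          _ ≤ ENNReal.ofReal C₁⁻¹ * S := by
              gcongr
              exact (mul_le_mul_right hK1 _).trans hSle
      · refine le_max_of_le_right ?_
        rw [besovEnergy_eq_mul hp hr.1]
        refine mul_le_mul' (ENNReal.ofReal_le_ofReal ?_) (hMle r hge)
        exact inv_anti₀ (Real.rpow_pos_of_pos hs0 _)
          (Real.rpow_le_rpow hs0.le hge (by positivity))
    · refine max_lt ?_ (ENNReal.mul_lt_top ENNReal.ofReal_lt_top hM)
      exact (ENNReal.rpow_ne_top_of_nonneg hp0.le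
        (ENNReal.mul_ne_top ENNReal.ofReal_ne_top hsup.ne)).lt_top

/-! ### Sobolev and BV functions -/

variable [BorelSpace X]

theorem isAbsGradient_zero : IsAbsGradient (X := X) ι 0 0 := by
  refine ⟨continuous_zero, measurable_zero, fun x => ⟨0, ⟨measurable_zero, fun u _ => ?_⟩, ?_⟩⟩
  · exact ⟨integrableOn_zero, by simp⟩
  · exact Eventually.of_forall fun z => by simp

theorem zero_mem_sobolev : (0 : X →ₘ[m] ℝ) ∈ sobolev ι m p := by
  refine ⟨?_, 0, 0, AEEqFun.coeFn_zero, isAbsGradient_zero, MemLp.zero⟩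
  rw [mem_lpSpace_iff, lpNorm_zero]
  exact ENNReal.zero_lt_top

theorem gradNorm_zero : gradNorm ι m p (0 : X →ₘ[m] ℝ) = 0 := by
  refine le_antisymm ?_ zero_le
  refine iInf_le_of_le 0 (iInf_le_of_le 0 (iInf_le_of_le AEEqFun.coeFn_zero
    (iInf_le_of_le isAbsGradient_zero ?_)))
  rw [eLpNorm_zero]

theorem gradNorm_lt_top {h : X →ₘ[m] ℝ} (hh : h ∈ sobolev ι m p) : gradNorm ι m p h < ∞ := by
  obtain ⟨-, F, G, hF, hG, hL⟩ := hh
  refine lt_of_le_of_lt ?_ hL.2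
  exact iInf_le_of_le F (iInf_le_of_le G (iInf_le_of_le hF (iInf_le_of_le hG le_rfl)))

/-- A constant sequence is admissible in the relaxation. -/
theorem totalVariation_le_gradNorm {h : X →ₘ[m] ℝ} (hh : h ∈ sobolev ι m 1) :
    totalVariation ι m h ≤ gradNorm ι m 1 h := by
  refine iInf_le_of_le (fun _ => h) (iInf_le_of_le (fun _ => hh) (iInf_le_of_le ?_ ?_))
  · simp [lpNorm_zero]
  · simp

theorem sobolev_subset_bv : sobolev ι m 1 ⊆ bv ι m := fun _ hh =>
  ⟨hh.1, (totalVariation_le_gradNorm hh).trans_lt (gradNorm_lt_top hh)⟩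

theorem totalVariation_zero : totalVariation ι m (0 : X →ₘ[m] ℝ) = 0 :=
  le_antisymm ((totalVariation_le_gradNorm zero_mem_sobolev).trans_eq gradNorm_zero) zero_le

/-! ### Energy of BV functions and the two-sided estimate -/

variable [SecondCountableTopology X] [SFinite m]

/-- For `p = 1` the energy is subadditive and bounded by the `L¹` norm, so the energy of `h` exceeds
that of an approximating `u n` by at most `D * lpNorm m 1 (u n - h)`, which tends to zero. The
gradient bound for `u n` thus passes to the limit inferior with the same constant. -/
theorem VolumeBounds.besovEnergy_le_totalVariation (hX : IsUniformLocalTree X ι)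
    (hV : VolumeBounds m dh c C r₁) (hr : 0 < r) (hrι : r ≤ ι) (hr₁ : r < r₁) (h : X →ₘ[m] ℝ)
    (hh : h ∈ lpSpace m 1) :
    besovEnergy m 1 0 h r ≤ ENNReal.ofReal (C ^ 2 / c) *
      (ENNReal.ofReal (r ^ alphaCrit dh 1) * totalVariation ι m h) ^ (1 : ℝ) := by
  have hc := hV.c_pos
  have hC := hV.C_pos
  have hK : ENNReal.ofReal (C ^ 2 / c) ≠ 0 := by
    rw [Ne, ENNReal.ofReal_eq_zero, not_le]
    positivity
  have hR : ENNReal.ofReal (r ^ alphaCrit dh 1) ≠ 0 := by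
    rw [Ne, ENNReal.ofReal_eq_zero, not_le]
    exact Real.rpow_pos_of_pos hr _
  -- Finiteness makes the truncated subtraction in `ℝ≥0∞` continuous, so that the error term can be
  -- moved to the left-hand side.
  have htop : besovEnergy m 1 0 h r ≠ ∞ := by
    refine ne_top_of_le_ne_top ?_ (hV.besovEnergy_le_lpNorm le_rfl hr hr₁ h)
    rw [ENNReal.rpow_one]
    exact ENNReal.mul_ne_top ENNReal.ofReal_ne_top ((mem_lpSpace_iff h).1 hh).ne
  set R := ENNReal.ofReal (C ^ 2 / c) * ENNReal.ofReal (r ^ alphaCrit dh 1) with hRdef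
  have hR0 : R ≠ 0 := mul_ne_zero hK hR
  have hRt : R ≠ ∞ := ENNReal.mul_ne_top ENNReal.ofReal_ne_top ENNReal.ofReal_ne_top
  rw [ENNReal.rpow_one, ← mul_assoc, ← ENNReal.div_le_iff' hR0 hRt, totalVariation]
  refine le_iInf fun u => le_iInf fun hu => le_iInf fun hlim => ?_
  rw [ENNReal.div_le_iff' hR0 hRt, ← ENNReal.liminf_const_mul_of_ne_top hRt]
  set D := ENNReal.ofReal (2 ^ (1 : ℝ) * (C / c)) with hD
  have hlim' : Tendsto (fun n => besovEnergy m 1 0 h r - D * lpNorm m 1 (u n - h)) atTop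
      (𝓝 (besovEnergy m 1 0 h r)) := by
    have h1 := ENNReal.Tendsto.const_mul hlim (a := D) (Or.inr ENNReal.ofReal_ne_top)
    have h2 := ENNReal.Tendsto.sub (tendsto_const_nhds (x := besovEnergy m 1 0 h r)) h1
      (Or.inl htop)
    simpa using h2
  rw [← hlim'.liminf_eq]
  refine liminf_le_liminf (Eventually.of_forall fun n => ?_)
  rw [tsub_le_iff_right]
  have hsub : lpNorm m 1 (u n - h) = lpNorm m 1 (h - u n) := by
    unfold lpNorm
    have : (u n - h : X →ₘ[m] ℝ) =ᵐ[m] -(h - u n : X →ₘ[m] ℝ) := by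
      filter_upwards [AEEqFun.coeFn_sub (u n) h, AEEqFun.coeFn_sub h (u n)] with x h1 h2
      rw [h1, Pi.neg_apply, h2]
      simp
    rw [eLpNorm_congr_ae this, eLpNorm_neg]
  have e : h = u n + (h - u n) := by abel
  calc besovEnergy m 1 0 h r = besovEnergy m 1 0 (u n + (h - u n)) r := by rw [← e]
    _ ≤ 2 ^ ((1 : ℝ) - 1) * (besovEnergy m 1 0 (u n) r + besovEnergy m 1 0 (h - u n) r) :=
        besovEnergy_add_le le_rfl _ _
    _ = besovEnergy m 1 0 (u n) r + besovEnergy m 1 0 (h - u n) r := by simp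
    _ ≤ R * gradNorm ι m 1 (u n) + D * lpNorm m 1 (u n - h) := by
        refine add_le_add ?_ ?_
        · refine (hV.besovEnergy_le_gradNorm hX le_rfl hr hrι hr₁ (u n)).trans_eq ?_
          rw [ENNReal.rpow_one, hRdef, mul_assoc]
        · refine (hV.besovEnergy_le_lpNorm le_rfl hr hr₁ (h - u n)).trans_eq ?_
          rw [ENNReal.rpow_one, hsub]

/-- Lower bound for the `K`-functional by the energy. -/
theorem VolumeBounds.energy_le_kFunctional (hV : VolumeBounds m dh c C r₁) (hp : 1 ≤ p)
    {X₁ : Set (X →ₘ[m] ℝ)} {N₁ : (X →ₘ[m] ℝ) → ℝ≥0∞} {ρ : ℝ}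
    (hN₁ : ∀ r, 0 < r → r < ρ → ∀ h ∈ X₁, besovEnergy m p 0 h r ≤ ENNReal.ofReal (C ^ 2 / c) *
      (ENNReal.ofReal (r ^ alphaCrit dh p) * N₁ h) ^ p) :
    ∃ C₁ : ℝ, 0 < C₁ ∧ ∀ r, 0 < r → r < r₁ → r < ρ → ∀ f,
      ENNReal.ofReal C₁ * besovEnergy m p 0 f r ^ (1 / p) ≤
        kFunctional (lpSpace m p) X₁ (lpNorm m p) N₁ f (r ^ alphaCrit dh p) := by
  have hc := hV.c_pos
  have hC := hV.C_pos
  have hp0 : 0 < p := by linarith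
  -- A common constant for the `L^p` part and the `X₁` part; the factor `2 ^ (p - 1)` that joins it
  -- comes from splitting the energy of a sum.
  set K := max (2 ^ p * (C / c)) (C ^ 2 / c) with hK
  have hKpos : 0 < K := lt_max_of_lt_right (by positivity)
  have hM : 0 < (2 ^ (p - 1) * K) ^ (1 / p) := by positivity
  refine ⟨((2 ^ (p - 1) * K) ^ (1 / p))⁻¹, inv_pos.2 hM, fun r hr hr₁ hρ f => ?_⟩
  refine le_iInf₂ fun g hg => le_iInf₂ fun h hh => le_iInf fun hf => ?_
  set a := lpNorm m p g
  set b := ENNReal.ofReal (r ^ alphaCrit dh p) * N₁ h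
  have hE : besovEnergy m p 0 f r ≤ ENNReal.ofReal (2 ^ (p - 1) * K) * (a + b) ^ p := by
    rw [hf]
    calc besovEnergy m p 0 (g + h) r
        ≤ 2 ^ (p - 1) * (besovEnergy m p 0 g r + besovEnergy m p 0 h r) :=
          besovEnergy_add_le hp g h
      _ ≤ 2 ^ (p - 1) * (ENNReal.ofReal K * a ^ p + ENNReal.ofReal K * b ^ p) := by
          gcongr
          · refine (hV.besovEnergy_le_lpNorm hp hr hr₁ g).trans ?_
            gcongr
            exact le_max_left _ _
          · refine (hN₁ r hr hρ h hh).trans ?_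
            gcongr
            exact le_max_right _ _
      _ = ENNReal.ofReal (2 ^ (p - 1) * K) * (a ^ p + b ^ p) := by
          rw [ENNReal.ofReal_mul (by positivity), ← ENNReal.ofReal_rpow_of_pos two_pos,
            ENNReal.ofReal_ofNat, mul_add, mul_add, mul_assoc, mul_assoc]
      _ ≤ _ := by
          gcongr
          exact ENNReal.add_rpow_le_rpow_add a b hp
  have h2 : besovEnergy m p 0 f r ^ (1 / p) ≤
      ENNReal.ofReal ((2 ^ (p - 1) * K) ^ (1 / p)) * (a + b) := by
    rw [← ENNReal.ofReal_rpow_of_nonneg (by positivity) (by positivity), one_div,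
      ENNReal.rpow_inv_le_iff hp0, ENNReal.mul_rpow_of_nonneg _ _ hp0.le, ← ENNReal.rpow_mul,
      inv_mul_cancel₀ hp0.ne', ENNReal.rpow_one]
    exact hE
  calc ENNReal.ofReal ((2 ^ (p - 1) * K) ^ (1 / p))⁻¹ * besovEnergy m p 0 f r ^ (1 / p)
      ≤ ENNReal.ofReal ((2 ^ (p - 1) * K) ^ (1 / p))⁻¹ *
          (ENNReal.ofReal ((2 ^ (p - 1) * K) ^ (1 / p)) * (a + b)) := by gcongr
    _ = a + b := by
        rw [← mul_assoc, ← ENNReal.ofReal_mul (by positivity), inv_mul_cancel₀ hM.ne',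
          ENNReal.ofReal_one, one_mul]

/-- Upper bound for the `K`-functional by the energy. -/
theorem VolumeBounds.kFunctional_le_energy [Nonempty X] (hX : IsUniformLocalTree X ι)
    (hV : VolumeBounds m dh c C r₁) (hp : 1 ≤ p)
    {X₁ : Set (X →ₘ[m] ℝ)} {N₁ : (X →ₘ[m] ℝ) → ℝ≥0∞} (hX₁ : sobolev ι m p ⊆ X₁)
    (hN₁ : ∀ h ∈ sobolev ι m p, N₁ h ≤ gradNorm ι m p h) :
    ∃ C₂ : ℝ, 0 < C₂ ∧ ∀ r, 0 < r → r < r₁ → r < ι → ∀ f ∈ lpSpace m p,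
      kFunctional (lpSpace m p) X₁ (lpNorm m p) N₁ f (r ^ alphaCrit dh p) ≤
        ENNReal.ofReal C₂ * besovEnergy m p 0 f r ^ (1 / p) := by
  obtain ⟨K₁, K₂, hK₁, hK₂, h⟩ := hV.exists_sobolev_splitting hX hp
  refine ⟨K₁ + K₂, by linarith, fun r hr hr₁ hrι f hf => ?_⟩
  obtain ⟨u, hu, h1, h2⟩ := h r hr hr₁ hrι f hf
  refine (kFunctional_le (mem_lpSpace_sub hf hu.1) (hX₁ hu) _).trans ?_
  rw [ENNReal.ofReal_add hK₁.le hK₂, add_mul]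
  refine add_le_add h1 (le_trans ?_ h2)
  gcongr
  exact hN₁ u hu

/-- The two-sided estimate of the `K`-functional, and its consequence for interpolation spaces,
for a space `X₁` between `W^{1,p}` and `L^p` whose seminorm controls the energy. -/
theorem VolumeBounds.kFunctional_and_interpolation [Nonempty X] (hX : IsUniformLocalTree X ι)
    (hV : VolumeBounds m dh c C r₁) (hr₁ : 0 < r₁) (hdh : 1 ≤ dh) (hp : 1 ≤ p)
    {X₁ : Set (X →ₘ[m] ℝ)} {N₁ : (X →ₘ[m] ℝ) → ℝ≥0∞} (hX₁ : X₁ ⊆ lpSpace m p)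
    (h0 : 0 ∈ X₁) (hN0 : N₁ 0 = 0) (hSX : sobolev ι m p ⊆ X₁)
    (hSN : ∀ h ∈ sobolev ι m p, N₁ h ≤ gradNorm ι m p h)
    (hN₁ : ∀ r, 0 < r → r < min r₁ ι → ∀ h ∈ X₁, besovEnergy m p 0 h r ≤
      ENNReal.ofReal (C ^ 2 / c) * (ENNReal.ofReal (r ^ alphaCrit dh p) * N₁ h) ^ p) :
    (∃ r₀ C₁ C₂ : ℝ, 0 < r₀ ∧ 0 < C₁ ∧ 0 < C₂ ∧
      ∀ f ∈ lpSpace m p + X₁, ∀ r : ℝ, 0 < r → r < r₀ →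
        ENNReal.ofReal C₁ * besovEnergy m p 0 f r ^ (1 / p) ≤
          kFunctional (lpSpace m p) X₁ (lpNorm m p) N₁ f (r ^ alphaCrit dh p) ∧
        kFunctional (lpSpace m p) X₁ (lpNorm m p) N₁ f (r ^ alphaCrit dh p) ≤
          ENNReal.ofReal C₂ * besovEnergy m p 0 f r ^ (1 / p)) ∧
    (IsFiniteMeasure m → ∀ α : ℝ, 0 ≤ α → besov m p α =
      interpInfty (lpSpace m p) X₁ (lpNorm m p) N₁ (α / alphaCrit dh p)) := by
  obtain ⟨C₁, hC₁, hlow⟩ := hV.energy_le_kFunctional hp hN₁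
  obtain ⟨C₂, hC₂, hup⟩ := hV.kFunctional_le_energy hX hp hSX hSN
  have hρ : 0 < min r₁ ι := lt_min hr₁ hX.pos
  have hK : ∀ r, 0 < r → r < min r₁ ι → ∀ f ∈ lpSpace m p,
      ENNReal.ofReal C₁ * besovEnergy m p 0 f r ^ (1 / p) ≤
        kFunctional (lpSpace m p) X₁ (lpNorm m p) N₁ f (r ^ alphaCrit dh p) ∧
      kFunctional (lpSpace m p) X₁ (lpNorm m p) N₁ f (r ^ alphaCrit dh p) ≤
        ENNReal.ofReal C₂ * besovEnergy m p 0 f r ^ (1 / p) := fun r hr hlt f hf =>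
    ⟨hlow r hr (hlt.trans_le (min_le_left _ _)) hlt f,
      hup r hr (hlt.trans_le (min_le_left _ _)) (hlt.trans_le (min_le_right _ _)) f hf⟩
  refine ⟨⟨min r₁ ι, C₁, C₂, hρ, hC₁, hC₂, ?_⟩, fun _ α hα => ?_⟩
  · rintro _ ⟨g, hg, h, hh, rfl⟩ r hr hlt
    exact hK r hr hlt _ (mem_lpSpace_add hg (hX₁ hh))
  · exact hV.besov_eq_interpInfty hr₁ hdh hp hX₁ h0 hN0 hρ hC₁ hK hα

end KFunctional

end LocalTree

/-! ### The theorem -/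

theorem theorem3p11 {X : Type*} [MetricSpace X] [LocallyCompactSpace X] [ConnectedSpace X]
    [TopologicalSpace.SeparableSpace X] [MeasurableSpace X] [BorelSpace X]
    (ι : ℝ) (hX : LocalTree.IsUniformLocalTree X ι)
    (m : Measure X) [m.Regular] [m.IsOpenPosMeasure]
    (dh : ℝ) (hdh : 1 ≤ dh) (hvol : LocalTree.HasUniformVolume m (fun r => r ^ dh)) :
    (∀ p : ℝ, 1 < p →
      (∃ r₀ C₁ C₂ : ℝ, 0 < r₀ ∧ 0 < C₁ ∧ 0 < C₂ ∧
        ∀ f ∈ LocalTree.lpSpace m p + LocalTree.sobolev ι m p, ∀ r : ℝ, 0 < r → r < r₀ →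
          ENNReal.ofReal C₁ * LocalTree.besovEnergy m p 0 f r ^ (1 / p) ≤
              LocalTree.kFunctional (LocalTree.lpSpace m p) (LocalTree.sobolev ι m p)
                (LocalTree.lpNorm m p) (LocalTree.gradNorm ι m p) f
                (r ^ LocalTree.alphaCrit dh p) ∧
            LocalTree.kFunctional (LocalTree.lpSpace m p) (LocalTree.sobolev ι m p)
                (LocalTree.lpNorm m p) (LocalTree.gradNorm ι m p) f
                (r ^ LocalTree.alphaCrit dh p) ≤
              ENNReal.ofReal C₂ * LocalTree.besovEnergy m p 0 f r ^ (1 / p)) ∧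
      (CompactSpace X → ∀ α : ℝ, 0 ≤ α → α ≤ LocalTree.alphaCrit dh p →
        LocalTree.besov m p α =
          LocalTree.interpInfty (LocalTree.lpSpace m p) (LocalTree.sobolev ι m p)
            (LocalTree.lpNorm m p) (LocalTree.gradNorm ι m p)
            (α / LocalTree.alphaCrit dh p))) ∧
    ((∃ r₀ C₁ C₂ : ℝ, 0 < r₀ ∧ 0 < C₁ ∧ 0 < C₂ ∧
        ∀ f ∈ LocalTree.lpSpace m 1 + LocalTree.bv ι m, ∀ r : ℝ, 0 < r → r < r₀ →
          ENNReal.ofReal C₁ * LocalTree.besovEnergy m 1 0 f r ≤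
              LocalTree.kFunctional (LocalTree.lpSpace m 1) (LocalTree.bv ι m)
                (LocalTree.lpNorm m 1) (LocalTree.totalVariation ι m) f
                (r ^ LocalTree.alphaCrit dh 1) ∧
            LocalTree.kFunctional (LocalTree.lpSpace m 1) (LocalTree.bv ι m)
                (LocalTree.lpNorm m 1) (LocalTree.totalVariation ι m) f
                (r ^ LocalTree.alphaCrit dh 1) ≤
              ENNReal.ofReal C₂ * LocalTree.besovEnergy m 1 0 f r) ∧
      (CompactSpace X → ∀ α : ℝ, 0 ≤ α → α ≤ LocalTree.alphaCrit dh 1 →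
        LocalTree.besov m 1 α =
          LocalTree.interpInfty (LocalTree.lpSpace m 1) (LocalTree.bv ι m)
            (LocalTree.lpNorm m 1) (LocalTree.totalVariation ι m)
            (α / LocalTree.alphaCrit dh 1))) := by
  obtain ⟨c, C, r₁, hc, hC, hr₁, hb⟩ := hvol
  have hV : LocalTree.VolumeBounds m dh c C r₁ :=
    ⟨hc, hC, fun x r h0 h1 => (hb x r h0 h1).1, fun x r h0 h1 => (hb x r h0 h1).2⟩
  have : SecondCountableTopology X := UniformSpace.secondCountable_of_separable X
  constructor
  · intro p hp
    obtain ⟨h1, h2⟩ := hV.kFunctional_and_interpolation hX hr₁ hdh hp.le (fun _ h => h.1)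
      LocalTree.zero_mem_sobolev LocalTree.gradNorm_zero Subset.rfl (fun _ _ => le_rfl)
      fun r hr hlt h _ => hV.besovEnergy_le_gradNorm hX hp.le hr
        (hlt.le.trans (min_le_right _ _)) (hlt.trans_le (min_le_left _ _)) h
    -- Compactness enters only through the finiteness of `m`.
    exact ⟨h1, fun _ α hα _ => h2 inferInstance α hα⟩
  · obtain ⟨h1, h2⟩ := hV.kFunctional_and_interpolation hX hr₁ hdh le_rfl (fun _ h => h.1)
      (LocalTree.sobolev_subset_bv LocalTree.zero_mem_sobolev) LocalTree.totalVariation_zero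
      LocalTree.sobolev_subset_bv (fun _ => LocalTree.totalVariation_le_gradNorm)
      fun r hr hlt h hh => hV.besovEnergy_le_totalVariation hX hr
        (hlt.le.trans (min_le_right _ _)) (hlt.trans_le (min_le_left _ _)) h hh.1
    simp only [one_div_one, ENNReal.rpow_one] at h1
    exact ⟨h1, fun _ α hα _ => h2 inferInstance α hα⟩
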